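/- Let $\mathcal X,\mathcal Y$ be finite alphabets, $W(y|x)$ a discrete memoryless channel, and $\mathcal P(\cdot)$ the probability simplex; all logarithms are natural. Let $q:\mathcal P(\mathcal X\times\mathcal Y)\to\mathbb R$ be a continuous decoding metric and let $d:\mathcal P(\mathcal X\times\mathcal X)\to\mathbb R$ be continuous and symmetric ($d(P_{X\tilde X})=d(P_{\tilde XX})$); for sequences write $q(\mathbf x,\mathbf y)=q(\hat P_{\mathbf x\mathbf y})$ and $d(\mathbf x,\mathbf x')=d(\hat P_{\mathbf x\mathbf x'})$, where $\hat P$ denotes the joint type. Let $P\in\mathcal P(\mathcal X)$, $\delta>0$, $\Delta\in\mathbb R$, and let $R>0$ satisfy $$R\le \min_{P_{X\tilde X}:\ d(P_{X\tilde X})\le\Delta,\ P_X=P_{\tilde X}=P} I(X;\tilde X)-2\delta .$$ For all large $n$ let $P_n$ be a type of length-$n$ sequences with the same support as $P$ and $\max_x|P_n(x)-P(x)|\le 1/n$, let $\mathcal T(P_n)$ be its type class, and let $M_n\in\mathbb N$ satisfy $\frac1n\log M_n\to R$. The generalized RGV code draws $\mathbf x_1,\dots,\mathbf x_{M_n}$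 recursively, $\mathbf x_i$ being uniform on $\{\bar{\mathbf x}\in\mathcal T(P_n): d(\bar{\mathbf x},\mathbf x_j)>\Delta,\ j<i\}$ given $\mathbf x_1,\dots,\mathbf x_{i-1}$. An equiprobable message $m\in\{1,\dots,M_n\}$ is sent as $\mathbf x_m$ over $W^n$, and with output $\mathbf y$ an error occurs if $q(\mathbf x_i,\mathbf y)\ge q(\mathbf x_m,\mathbf y)$ for some $i\ne m$. Let $\bar P_e^{(n)}$ be the error probability averaged over messages, codebooks and channel outputs. Define $$E_{RGV}(R,P,W,q,d,\Delta)=\min_{V_{X\tilde XY}} D(V_{Y|X}\|W|P)+\bigl|I(\tilde X;Y,X)-R\bigr|_+ ,$$ the minimum being over all $V_{X\tilde XY}\in\mathcal P(\mathcal X\times\mathcal X\times\mathcal Y)$ with $V_X=V_{\tilde X}=P$, $q(V_{\tilde XY})\ge q(V_{XY})$ and $d(V_{X\tilde X})\ge\Delta$. Minima over empty sets are $+\infty$, and $e^{-\infty}=0$. Write $f_n\,\dot\le\,g_n$, or $g_n\,\dot\ge\,f_n$, if $\limsup_n\frac1n\log\frac{f_n}{g_n}\le0$ (indices with $f_n=0$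 count as $-\infty$, those with $f_n>0=g_n$ as $+\infty$). Then for all sufficiently large $n$ one has $M_n e^{n\delta}\,|\{\bar{\mathbf x}\in\mathcal T(P_n): d(\bar{\mathbf x},\mathbf x)\le\Delta\}|\le|\mathcal T(P_n)|$ for every $\mathbf x\in\mathcal T(P_n)$ and the construction almost surely produces all $M_n$ codewords; and $$\bar P_e^{(n)}\ \dot\le\ e^{-nE_{RGV}(R,P,W,q,d,\Delta)} .$$ If moreover $q$ is additive, i.e. $q(V)=\sum_{x,y}V(x,y)\,\rho(x,y)$ for some $\rho:\mathcal X\times\mathcal Y\to\mathbb R$, then for every $\epsilon>0$ $$\bar P_e^{(n)}\ \dot\ge\ e^{-nE_{RGV}(R,P,W,q,d,\Delta+\epsilon)} .$$ -/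

import Mathlib

open Filter Topology
open scoped ENNReal

namespace RGV

noncomputable section

/-! ### Distributions on finite alphabets

A distribution on a finite type `A` is an element of `stdSimplex ℝ A`, a function `A → ℝ`. -/

/-- The distribution of `f Z` when `Z` has distribution `V`; marginals are obtained by taking for
`f` a projection. -/
def marginal {A B : Type*} [Fintype A] [DecidableEq B] (f : A → B) (V : A → ℝ) : B → ℝ :=
  fun b => ∑ a with f a = b, V a

/-- Mutual information (in nats) between the two coordinates under the joint distribution `V`. -/
def mutualInfo {A B : Type*} [Fintype A] [DecidableEq A] [Fintype B] [DecidableEq B]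
    (V : A × B → ℝ) : ℝ :=
  ∑ z : A × B, V z * Real.log (V z / (marginal Prod.fst V z.1 * marginal Prod.snd V z.2))

/-- The conditional divergence `D(V_{Y|X} ‖ W | V_X)` (in nats), where `V` is a joint distribution
of `(X, Y)` and `V_{Y|X}(y|x) = V(x, y) / V_X(x)`. It is `⊤` as soon as `V` charges a pair `(x, y)`
with `W(y|x) = 0`. -/
def condDiv {A B : Type*} [Fintype A] [DecidableEq A] [Fintype B]
    (V : A × B → ℝ) (W : A → B → ℝ) : EReal :=
  open scoped Classical in
  if ∀ x y, W x y = 0 → V (x, y) = 0 then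
    ((∑ x, ∑ y, V (x, y) * Real.log (V (x, y) / marginal Prod.fst V x / W x y) : ℝ) : EReal)
  else ⊤

/-- `W x y` is the transition law `W(y|x)` of a discrete memoryless channel. -/
def IsChannel {A B : Type*} [Fintype B] (W : A → B → ℝ) : Prop :=
  ∀ x, W x ∈ stdSimplex ℝ B

/-! ### Types -/

/-- The type (empirical distribution) of a sequence. -/
def empirical {A : Type*} [DecidableEq A] {n : ℕ} (x : Fin n → A) : A → ℝ :=
  fun a => ((Finset.univ.filter fun i => x i = a).card : ℝ) / n

/-- The joint type of two sequences of the same length. -/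
def jointType {A B : Type*} [DecidableEq A] [DecidableEq B] {n : ℕ}
    (x : Fin n → A) (y : Fin n → B) : A × B → ℝ :=
  empirical fun i => (x i, y i)

/-- The type class of sequences of length `n` with type `Q`. -/
def typeClass {A : Type*} [Fintype A] [DecidableEq A] (n : ℕ) (Q : A → ℝ) :
    Finset (Fin n → A) :=
  open scoped Classical in Finset.univ.filter fun x => empirical x = Q

/-- `Q` is a type of sequences of length `n`, with the same support as `P` and at `ℓ_∞`-distance at
most `1/n` from `P`. -/
def IsTypeApprox {A : Type*} [DecidableEq A] (n : ℕ) (P Q : A → ℝ) : Prop :=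
  (∃ x : Fin n → A, empirical x = Q) ∧ (∀ a, Q a ≠ 0 ↔ P a ≠ 0) ∧ ∀ a, |Q a - P a| ≤ 1 / n

/-! ### Distance functions and decoding metrics

Type-dependent functions of two sequences are given by functions of a joint distribution; they are
evaluated at joint types. Only their values on the simplex matter. -/

/-- The class `Ω`: symmetric type-dependent distance functions that are continuous (hence bounded)
on the simplex. -/
structure IsDistance {A : Type*} [Fintype A] (d : (A × A → ℝ) → ℝ) : Prop where
  continuousOn : ContinuousOn d (stdSimplex ℝ (A × A))
  symm : ∀ V ∈ stdSimplex ℝ (A × A), d (V ∘ Prod.swap) = d V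

/-- `q` is additive: the expectation of a single-letter metric. -/
def IsAdditive {A B : Type*} [Fintype A] [Fintype B] (q : (A × B → ℝ) → ℝ) : Prop :=
  ∃ ρ : A → B → ℝ, ∀ V ∈ stdSimplex ℝ (A × B), q V = ∑ x, ∑ y, V (x, y) * ρ x y

/-! ### The recursive random code -/

/-- The candidates for the `i`-th codeword: the sequences of type `Q` whose distance from each of
the codewords preceding the `i`-th one in `c` exceeds `Δ`. -/
def candidates {A : Type*} [Fintype A] [DecidableEq A] {n M : ℕ} (Q : A → ℝ)
    (d : (A × A → ℝ) → ℝ) (Δ : ℝ) (c : Fin M → Fin n → A) (i : Fin M) : Finset (Fin n → A) :=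
  open scoped Classical in
  (typeClass n Q).filter fun x => ∀ j, j < i → Δ < d (jointType x (c j))

/-- The probability that the recursive construction produces the codebook `c`: given its
predecessors, each codeword is drawn uniformly from its set of candidates. -/
def codeProb {A : Type*} [Fintype A] [DecidableEq A] {n M : ℕ} (Q : A → ℝ)
    (d : (A × A → ℝ) → ℝ) (Δ : ℝ) (c : Fin M → Fin n → A) : ℝ :=
  open scoped Classical in
  ∏ i, if c i ∈ candidates Q d Δ c i then 1 / ((candidates Q d Δ c i).card : ℝ) else 0

/-- The volume condition `e^{n(R_n + δ)} vol_x(Δ) ≤ |T(Q)|`, where `R_n = (1/n) log M`, so that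
`e^{n R_n} = M`. -/
def VolumeCondition {A : Type*} [Fintype A] [DecidableEq A] (n M : ℕ) (Q : A → ℝ)
    (d : (A × A → ℝ) → ℝ) (Δ δ : ℝ) : Prop :=
  open scoped Classical in
  ∀ x ∈ typeClass n Q,
    (M : ℝ) * Real.exp (n * δ) *
      (((typeClass n Q).filter fun x' => d (jointType x' x) ≤ Δ).card : ℝ)
      ≤ ((typeClass n Q).card : ℝ)

/-- Probability that the maximum-metric decoder errs when codeword `m` of the codebook `c` is sent
over the channel; ties count as errors. -/
def errorProb {A B : Type*} [DecidableEq A] [Fintype B] [DecidableEq B]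
    {n M : ℕ} (W : A → B → ℝ) (q : (A × B → ℝ) → ℝ) (c : Fin M → Fin n → A) (m : Fin M) : ℝ :=
  open scoped Classical in
  ∑ y : Fin n → B, if ∃ i, i ≠ m ∧ q (jointType (c m) y) ≤ q (jointType (c i) y)
    then ∏ k, W (c m k) (y k) else 0

/-- The ensemble average error probability, with `M` equiprobable messages. -/
def avgErrorProb {A B : Type*} [Fintype A] [DecidableEq A] [Fintype B] [DecidableEq B]
    (n M : ℕ) (Q : A → ℝ) (W : A → B → ℝ) (q : (A × B → ℝ) → ℝ)
    (d : (A × A → ℝ) → ℝ) (Δ : ℝ) : ℝ :=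
  (1 / (M : ℝ)) * ∑ m : Fin M, ∑ c : Fin M → Fin n → A, codeProb Q d Δ c * errorProb W q c m

/-! ### Single-letter quantities

An infimum over an empty set is `⊤`. -/

/-- The minimum of `I(X; X̃)` over the joint distributions with both marginals equal to `P` and
`d(P_{X X̃}) ≤ Δ`. -/
def minMutualInfo {A : Type*} [Fintype A] [DecidableEq A] (P : A → ℝ)
    (d : (A × A → ℝ) → ℝ) (Δ : ℝ) : EReal :=
  ⨅ V ∈ {V : A × A → ℝ | V ∈ stdSimplex ℝ (A × A) ∧ marginal Prod.fst V = P ∧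
    marginal Prod.snd V = P ∧ d V ≤ Δ}, (mutualInfo V : EReal)

/-- The constraint set of the exponent; `V` is the joint distribution of `(X, X̃, Y)`. -/
def feasible {A B : Type*} [Fintype A] [DecidableEq A] [Fintype B] [DecidableEq B] (P : A → ℝ)
    (q : (A × B → ℝ) → ℝ) (d : (A × A → ℝ) → ℝ) (Δ : ℝ) : Set (A × A × B → ℝ) :=
  {V | V ∈ stdSimplex ℝ (A × A × B) ∧
    marginal (fun z => z.1) V = P ∧ marginal (fun z => z.2.1) V = P ∧
    q (marginal (fun z => (z.1, z.2.2)) V) ≤ q (marginal (fun z => (z.2.1, z.2.2)) V) ∧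
    Δ ≤ d (marginal (fun z => (z.1, z.2.1)) V)}

/-- The exponent `E_RGV(R, P, W, q, d, Δ)`: the minimum over the constraint set of
`D(V_{Y|X} ‖ W | P) + |I(X̃; Y, X) - R|₊`. -/
def exponent {A B : Type*} [Fintype A] [DecidableEq A] [Fintype B] [DecidableEq B] (R : ℝ)
    (P : A → ℝ) (W : A → B → ℝ) (q : (A × B → ℝ) → ℝ) (d : (A × A → ℝ) → ℝ) (Δ : ℝ) : EReal :=
  ⨅ V ∈ feasible P q d Δ,
    condDiv (marginal (fun z => (z.1, z.2.2)) V) W +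
      ((max (mutualInfo (marginal (fun z => (z.2.1, (z.2.2, z.1))) V) - R) 0 : ℝ) : EReal)

/-! ### Exponential inequality -/

/-- `f ≤̇ g`, that is `limsup (1/n) log (f_n / g_n) ≤ 0`. With `0 / 0 = 0` and `log 0 = ⊥`, indices
where both sequences vanish satisfy the inequality, and `f_n > 0 = g_n` gives the value `⊤`.
The relation `f ≥̇ g` is `g ≤̇ f`. -/
def ExpLE (f g : ℕ → ℝ≥0∞) : Prop :=
  limsup (fun n : ℕ => ENNReal.log (f n / g n) / (n : EReal)) atTop ≤ 0

/-- The sequence `e^{-nE}`. -/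
def expDecay (E : EReal) : ℕ → ℝ≥0∞ := fun n => EReal.exp (-((n : EReal) * E))

end

end RGV

set_option linter.unusedSectionVars false

namespace RGV

noncomputable section

open Finset

/-! The recursive code behaves almost like a code of independent uniform codewords, and the method
of types then evaluates its error probability. Put `η = e^{-nδ}` and let `T` be the type class of
`P_n`. By the volume condition all earlier codewords together exclude at most `η|T|` sequences, so
each new codeword is uniform on a set of size between `(1-η)|T|` and `|T|`. Hence prescribed
codewords fall into prescribed sets with at most the product probability, `|T|` being replaced by
`(1-η)|T|` (`codebookPr_forall_mem_le`), while two compatible sequences occupy two given positions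
with probability at least a constant times `|T|^{-2}` (`codebookPr_eq_pair_ge`). The event that `x`
is the sent codeword and some other codeword lies in a set `S` of compatible sequences then has
probability of order `|T|^{-1} min(1, M|S|/|T|)`. Above this is a union bound
(`codebookPr_union_le`); below it is Bonferroni's inequality on a truncated set of competitors
(`le_codebookPr_union`).

Sorting the triples (sent, competing, received) by joint type `V`, the competitors of type `V`
number `|T(V)|/|T(V_{XY})|`. With `|T(V)| ≐ e^{nH(V)}` the contribution of `V` is `e^{-n cost}` up
to polynomial factors (`typeTerm_bounds_cost`), where `cost` is the objective of the exponent at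
rate `(log M_n)/n`. There are polynomially many types. For the upper bound, compactness of the
simplex shows that limits of admissible types are feasible
(`exists_limit_of_frequently_admissible`). The volume condition is obtained in the same way from the
rate condition.

For the lower bound a nearly optimal `V` at level `Δ+ε` must be approximated by joint types with
marginals exactly `P_n`, support inside the channel's, distance above `Δ`, and the closed metric
constraint still in force. The slack `ε` handles the distance. For the metric, additivity makes the
constraint linear: `metricGap ≥ 0`. If some coupling has positive gap, mixing it in makes the
constraint strict, hence open. Otherwise `V` maximises a linear functional, and by complementary
slackness the gap stays nonnegative for everything with equal marginals supported on the support of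
`V` (`metricGap_nonneg_of_support`). The approximation (`eventually_exists_type`) therefore never
enlarges the support: it rounds `V` to rationals respecting its rational linear relations and
repairs the marginals on the diagonal `X = X̃`, where one correction changes both marginals equally.
-/

/-! ### Entropy -/

/-- Shannon entropy, in nats. -/
def entropy {A : Type*} [Fintype A] (V : A → ℝ) : ℝ := ∑ a, Real.negMulLog (V a)

theorem continuous_entropy {A : Type*} [Fintype A] :
    Continuous (entropy : (A → ℝ) → ℝ) := by
  unfold entropy
  exact continuous_finsetSum _ fun a _ => Real.continuous_negMulLog.comp (continuous_apply a)

/-! ### Marginals of distributions -/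

section Marginal

variable {A B C : Type*} [Fintype A] [Fintype B] [DecidableEq B] [DecidableEq C]

theorem continuous_marginal (f : A → B) :
    Continuous (marginal f : (A → ℝ) → B → ℝ) := by
  unfold marginal
  fun_prop

theorem marginal_nonneg (f : A → B) {V : A → ℝ} (hV : ∀ a, 0 ≤ V a) (b : B) :
    0 ≤ marginal f V b :=
  sum_nonneg fun a _ => hV a

theorem sum_marginal_mul (f : A → B) (V : A → ℝ) (g : B → ℝ) :
    ∑ b, marginal f V b * g b = ∑ a, V a * g (f a) := by
  unfold marginal
  simp_rw [sum_mul]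
  rw [← sum_fiberwise univ f (fun a => V a * g (f a))]
  refine sum_congr rfl fun b _ => sum_congr rfl fun a ha => ?_
  rw [(mem_filter.1 ha).2]

theorem sum_marginal (f : A → B) (V : A → ℝ) : ∑ b, marginal f V b = ∑ a, V a := by
  simpa using sum_marginal_mul f V 1

theorem marginal_mem_stdSimplex (f : A → B) {V : A → ℝ} (hV : V ∈ stdSimplex ℝ A) :
    marginal f V ∈ stdSimplex ℝ B :=
  ⟨marginal_nonneg f hV.1, (sum_marginal f V).trans hV.2⟩

theorem le_marginal (f : A → B) {V : A → ℝ} (hV : ∀ a, 0 ≤ V a) (a : A) :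
    V a ≤ marginal f V (f a) :=
  single_le_sum (f := V) (fun a _ => hV a) (mem_filter.2 ⟨mem_univ a, rfl⟩)

theorem marginal_pos (f : A → B) {V : A → ℝ} (hV : ∀ a, 0 ≤ V a) {a : A} (ha : V a ≠ 0) :
    marginal f V (f a) ≠ 0 :=
  (((hV a).lt_of_ne' ha).trans_le (le_marginal f hV a)).ne'

theorem marginal_marginal (f : A → B) (g : B → C) (V : A → ℝ) :
    marginal g (marginal f V) = marginal (fun a => g (f a)) V := by
  ext c
  have h := sum_marginal_mul f V (fun b => if g b = c then 1 else 0)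
  simpa [marginal, sum_filter] using h

end Marginal

/-! ### Information quantities as continuous combinations of entropies -/

section Information

variable {A B : Type*} [Fintype A] [DecidableEq A] [Fintype B] [DecidableEq B]

/-- A point with `V z ≠ 0` has nonzero marginals, so the logarithm splits; elsewhere the factor `V
z` kills the term. The entropy form is visibly continuous, which the compactness arguments need. -/
theorem mutualInfo_eq_entropy {V : A × B → ℝ} (hV : ∀ z, 0 ≤ V z) :
    mutualInfo V =
      entropy (marginal Prod.fst V) + entropy (marginal Prod.snd V) - entropy V := by
  have h1 := sum_marginal_mul Prod.fst V fun a => Real.log (marginal Prod.fst V a)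
  have h2 := sum_marginal_mul Prod.snd V fun a => Real.log (marginal Prod.snd V a)
  simp only [entropy, Real.negMulLog, neg_mul, sum_neg_distrib, h1, h2]
  rw [mutualInfo, ← sum_neg_distrib, ← sum_neg_distrib, ← sum_neg_distrib, ← sum_add_distrib,
    ← sum_sub_distrib]
  refine sum_congr rfl fun z _ => ?_
  by_cases hz : V z = 0
  · simp [hz]
  · have a1 := marginal_pos Prod.fst hV hz
    have a2 := marginal_pos Prod.snd hV hz
    rw [Real.log_div hz (mul_ne_zero a1 a2), Real.log_mul a1 a2]
    ring

/-- The conditional divergence, as a continuous function on all `V` whose support is contained in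
that of the channel. -/
def condDivReal (V : A × B → ℝ) (W : A → B → ℝ) : ℝ :=
  entropy (marginal Prod.fst V) - entropy V - ∑ z, V z * Real.log (W z.1 z.2)

theorem condDiv_eq_condDivReal {V : A × B → ℝ} {W : A → B → ℝ} (hV : ∀ z, 0 ≤ V z)
    (h : ∀ x y, W x y = 0 → V (x, y) = 0) : condDiv V W = (condDivReal V W : EReal) := by
  rw [condDiv, if_pos h]
  congr 1
  have h1 := sum_marginal_mul Prod.fst V fun a => Real.log (marginal Prod.fst V a)
  simp only [condDivReal, entropy, Real.negMulLog, neg_mul, sum_neg_distrib, h1]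
  rw [← sum_neg_distrib, ← sum_neg_distrib, ← sum_sub_distrib, ← sum_sub_distrib,
    Fintype.sum_prod_type]
  refine sum_congr rfl fun x _ => sum_congr rfl fun y _ => ?_
  by_cases hz : V (x, y) = 0
  · simp [hz]
  · have a1 := marginal_pos Prod.fst hV hz
    have a2 : W x y ≠ 0 := fun h0 => hz (h x y h0)
    rw [Real.log_div (div_ne_zero hz a1) a2, Real.log_div hz a1]
    ring

theorem condDiv_eq_top {V : A × B → ℝ} {W : A → B → ℝ}
    (h : ¬ ∀ x y, W x y = 0 → V (x, y) = 0) : condDiv V W = ⊤ := by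
  rw [condDiv, if_neg h]

end Information

/-! ### Type classes -/

section Types

variable {A C : Type*} [Fintype A] [DecidableEq A] [Fintype C] [DecidableEq C] {n : ℕ}

/-- The number of occurrences of the letter `a` in `x`. -/
def letterCount (x : Fin n → A) (a : A) : ℕ := #{i | x i = a}

theorem sum_letterCount (x : Fin n → A) : ∑ a, letterCount x a = n := by
  simpa [letterCount] using (card_eq_sum_card_fiberwise (f := x) (s := univ) (t := univ)
    (by simp)).symm

theorem empirical_apply (x : Fin n → A) (a : A) : empirical x a = letterCount x a / n := rfl

theorem natCast_mul_empirical (x : Fin n → A) (a : A) : n * empirical x a = letterCount x a := by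
  rcases Nat.eq_zero_or_pos n with rfl | hn
  · simp [letterCount]
  · rw [empirical_apply, mul_div_cancel₀]; positivity

theorem letterCount_eq_of_empirical_eq {x y : Fin n → A} (h : empirical x = empirical y) (a : A) :
    letterCount x a = letterCount y a := by
  have := natCast_mul_empirical x a
  rw [h, natCast_mul_empirical] at this
  exact_mod_cast this.symm

theorem empirical_mem_stdSimplex (hn : 0 < n) (x : Fin n → A) : empirical x ∈ stdSimplex ℝ A := by
  refine ⟨fun a => by rw [empirical_apply]; positivity, ?_⟩
  simp_rw [empirical_apply]
  rw [← sum_div, ← Nat.cast_sum, sum_letterCount, div_self]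
  positivity

theorem marginal_empirical (f : A → C) (x : Fin n → A) :
    marginal f (empirical x) = empirical fun i => f (x i) := by
  ext c
  simp only [marginal, empirical_apply]
  rw [← sum_div, ← Nat.cast_sum]
  congr 2
  unfold letterCount
  rw [card_eq_sum_card_fiberwise (f := x) (s := {i | f (x i) = c}) (t := {a | f a = c})]
  · refine sum_congr rfl fun a ha => ?_
    congr 1
    ext i
    simp only [mem_filter, mem_univ, true_and] at ha ⊢
    constructor
    · rintro rfl; exact ⟨ha, rfl⟩
    · exact fun h => h.2
  · intro i hi; simpa using hi

theorem mem_typeClass {Q : A → ℝ} {x : Fin n → A} : x ∈ typeClass n Q ↔ empirical x = Q := by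
  simp [typeClass]

theorem empirical_comp_perm (x : Fin n → A) (σ : Equiv.Perm (Fin n)) :
    empirical (x ∘ σ) = empirical x := by
  ext a
  simp only [empirical_apply]
  congr 2
  exact card_equiv σ (by simp)

theorem exists_perm_of_empirical_eq {x y : Fin n → A} (h : empirical x = empirical y) :
    ∃ σ : Equiv.Perm (Fin n), x ∘ σ = y := by
  have e : ∀ a, {i // y i = a} ≃ {i // x i = a} := fun a => Fintype.equivOfCardEq (by
    have := letterCount_eq_of_empirical_eq h a
    simpa [letterCount, Fintype.card_subtype] using this.symm)
  exact ⟨Equiv.ofFiberEquiv e, funext fun i => Equiv.ofFiberEquiv_map e i⟩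

/-- Orbit–stabiliser: permutations of the positions act transitively on the type class, and each
fibre of `σ ↦ x ∘ σ` is a coset of the stabiliser of `x`, which permutes the positions of each
letter separately. -/
theorem card_typeClass_mul_prod_factorial (x : Fin n → A) :
    #(typeClass n (empirical x)) * ∏ a, (letterCount x a).factorial = n.factorial := by
  have h1 : n.factorial = #(univ : Finset (Equiv.Perm (Fin n))) := by
    rw [card_univ, Fintype.card_perm, Fintype.card_fin]
  have h2 : ∀ z ∈ typeClass n (empirical x),
      #{σ : Equiv.Perm (Fin n) | x ∘ σ = z} = ∏ a, (letterCount x a).factorial := by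
    intro z hz
    obtain ⟨τ, rfl⟩ := exists_perm_of_empirical_eq (mem_typeClass.1 hz).symm
    have h3 := DomMulAct.stabilizer_card x
    simp only [Fintype.card_subtype] at h3
    unfold letterCount
    rw [← h3]
    refine card_equiv (Equiv.mulRight τ⁻¹) fun σ => ?_
    simp only [mem_filter, mem_univ, true_and, Equiv.coe_mulRight, Equiv.Perm.coe_mul]
    rw [← Function.comp_assoc]
    constructor
    · intro h; rw [h, Function.comp_assoc]; ext i; simp
    · intro h
      nth_rewrite 2 [← h]
      ext i; simp
  rw [h1, card_eq_sum_card_fiberwise (f := fun σ : Equiv.Perm (Fin n) => x ∘ σ)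
    (t := typeClass n (empirical x)), sum_congr rfl h2, sum_const, smul_eq_mul]
  intro σ _
  simp [mem_typeClass, empirical_comp_perm]

/-- Given a sequence `z` and a map `f` on letters, every sequence of the type of `f ∘ z` has the
same number of preimages in the type class of `z`. -/
theorem card_fiber_mul_card_typeClass (f : A → C) (z : Fin n → A) (w : Fin n → C)
    (hw : empirical w = empirical fun i => f (z i)) :
    #{z' ∈ typeClass n (empirical z) | (fun i => f (z' i)) = w} * #(typeClass n (empirical w)) =
      #(typeClass n (empirical z)) := by
  rw [card_eq_sum_card_fiberwise (s := typeClass n (empirical z))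
    (f := fun z' : Fin n → A => fun i => f (z' i)) (t := typeClass n (empirical w))]
  · have : ∀ w' ∈ typeClass n (empirical w),
        #{z' ∈ typeClass n (empirical z) | (fun i => f (z' i)) = w'} =
          #{z' ∈ typeClass n (empirical z) | (fun i => f (z' i)) = w} := by
      intro w' hw'
      obtain ⟨σ, rfl⟩ := exists_perm_of_empirical_eq (mem_typeClass.1 hw').symm
      -- Permuting the coordinates preserves the type and carries the fibre over `w ∘ σ` bijectively
      -- onto the fibre over `w`.
      refine card_equiv (Equiv.arrowCongr σ (Equiv.refl A)) fun z' => ?_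
      simp only [mem_filter, mem_typeClass]
      have e1 : (Equiv.arrowCongr σ (Equiv.refl A)) z' = z' ∘ σ.symm := rfl
      rw [e1, empirical_comp_perm]
      refine and_congr Iff.rfl ?_
      constructor
      · intro h
        ext i
        simpa using congrFun h (σ.symm i)
      · intro h
        ext i
        simpa using congrFun h (σ i)
    rw [sum_congr rfl this, sum_const, smul_eq_mul, mul_comm]
  · intro z' hz'
    simp only [mem_coe, mem_typeClass] at hz' ⊢
    rw [← marginal_empirical, hz', marginal_empirical, hw]

theorem factorial_mul_exp_le (k : ℕ) :
    (k.factorial : ℝ) * Real.exp k ≤ 3 * (k + 1) * (k : ℝ) ^ k := by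
  have key : ∀ k : ℕ, ((k + 1).factorial : ℝ) * Real.exp ((k + 1 : ℕ) : ℝ) ≤
      Real.exp 1 * (k + 1) * ((k : ℝ) + 1) ^ (k + 1) := by
    intro k
    induction k with
    | zero => simp
    | succ k ih =>
      -- Equivalent to `(1 - 1/(k+2))^(k+2) ≤ e⁻¹`, an instance of `1 - t ≤ e^{-t}`.
      have h1 : Real.exp 1 * ((k : ℝ) + 1) ^ (k + 2) ≤ ((k : ℝ) + 2) ^ (k + 2) := by
        have h := Real.one_sub_le_exp_neg (1 / ((k : ℝ) + 2))
        have h2 : (1 - 1 / ((k : ℝ) + 2)) = ((k : ℝ) + 1) / (k + 2) := by field_simp; ring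
        rw [h2] at h
        have h3 := pow_le_pow_left₀ (by positivity) h (k + 2)
        rw [← Real.exp_nat_mul, div_pow] at h3
        have h4 : ((k + 2 : ℕ) : ℝ) * -(1 / ((k : ℝ) + 2)) = -1 := by
          push_cast; field_simp
        rw [h4, div_le_iff₀ (by positivity), Real.exp_neg] at h3
        rw [← le_div_iff₀' (Real.exp_pos 1), div_eq_inv_mul]
        exact h3
      have h5 : ((k + 1 + 1).factorial : ℝ) * Real.exp ((k + 1 + 1 : ℕ) : ℝ) =
          ((k : ℝ) + 2) * Real.exp 1 * (((k + 1).factorial : ℝ) * Real.exp ((k + 1 : ℕ) : ℝ)) := by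
        rw [Nat.factorial_succ (k + 1)]
        push_cast
        rw [Real.exp_add ((k : ℝ) + 1) 1]
        ring
      rw [h5]
      calc ((k : ℝ) + 2) * Real.exp 1 * (((k + 1).factorial : ℝ) * Real.exp ((k + 1 : ℕ) : ℝ))
          ≤ ((k : ℝ) + 2) * Real.exp 1 * (Real.exp 1 * (k + 1) * ((k : ℝ) + 1) ^ (k + 1)) := by
            gcongr
        _ = ((k : ℝ) + 2) * Real.exp 1 * (Real.exp 1 * ((k : ℝ) + 1) ^ (k + 2)) := by ring
        _ ≤ ((k : ℝ) + 2) * Real.exp 1 * ((k : ℝ) + 2) ^ (k + 2) := by gcongr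
        _ = _ := by push_cast; ring
  rcases k with _ | k
  · simp
  · refine (key k).trans ?_
    push_cast
    have : Real.exp 1 ≤ 3 := by linarith [Real.exp_one_lt_d9]
    have hk : (0 : ℝ) ≤ k := k.cast_nonneg
    gcongr
    linarith

theorem pow_self_le_factorial_mul_exp (k : ℕ) :
    (k : ℝ) ^ k ≤ k.factorial * Real.exp k := by
  have := Real.pow_div_factorial_le_exp (k : ℝ) k.cast_nonneg k
  rwa [div_le_iff₀' (by positivity)] at this

/-- A letter with count `k` contributes `(n/k)^k` to the exponential, and the counts sum to `n`.
Absent letters contribute `1` because `0 ^ 0 = 1`. -/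
theorem exp_entropy_mul_prod (hn : 0 < n) (x : Fin n → A) :
    Real.exp (n * entropy (empirical x)) * ∏ a, (letterCount x a : ℝ) ^ letterCount x a =
      (n : ℝ) ^ n := by
  have h : ∀ a, Real.exp (n * Real.negMulLog (empirical x a)) *
      (letterCount x a : ℝ) ^ letterCount x a = (n : ℝ) ^ letterCount x a := by
    intro a
    rcases Nat.eq_zero_or_pos (letterCount x a) with h0 | h0
    · simp [empirical_apply, h0]
    · have hk : (0 : ℝ) < letterCount x a := by exact_mod_cast h0
      have hn' : (0 : ℝ) < n := by exact_mod_cast hn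
      rw [empirical_apply, Real.negMulLog]
      have : (n : ℝ) * (-(letterCount x a / n : ℝ) * Real.log (letterCount x a / n)) =
          letterCount x a * Real.log (n / letterCount x a) := by
        rw [Real.log_div hk.ne' hn'.ne', Real.log_div hn'.ne' hk.ne']
        field_simp
        ring
      rw [this, Real.exp_nat_mul, Real.exp_log (by positivity), ← mul_pow,
        div_mul_cancel₀ _ hk.ne']
  rw [entropy, mul_sum, Real.exp_sum, ← prod_mul_distrib, prod_congr rfl fun a _ => h a,
    prod_pow_eq_pow_sum, sum_letterCount]

theorem exp_sum_letterCount (x : Fin n → A) :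
    ∏ a, Real.exp (letterCount x a) = Real.exp n := by
  rw [← Real.exp_sum, ← Nat.cast_sum, sum_letterCount]

/-- The class has `n!/∏ k_a!` elements while `e^{nH} = n^n/∏ k_a^{k_a}`. Since `k! e^k` and `k^k`
agree up to a polynomial factor and the `e^{k_a}` multiply to `e^n`, the two ratios agree
polynomially. Here the factor is lost once, on `n!`; in `exp_entropy_le` it is lost once per letter.
-/
theorem card_typeClass_le (hn : 0 < n) (x : Fin n → A) :
    (#(typeClass n (empirical x)) : ℝ) ≤ 3 * (n + 1) * Real.exp (n * entropy (empirical x)) := by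
  have h1 : (#(typeClass n (empirical x)) : ℝ) * ∏ a, ((letterCount x a).factorial : ℝ) =
      n.factorial := by exact_mod_cast card_typeClass_mul_prod_factorial x
  have h2 := exp_entropy_mul_prod hn x
  set E := Real.exp (n * entropy (empirical x))
  set K := ∏ a, (letterCount x a : ℝ) ^ letterCount x a with hK
  have hE : 0 < E := Real.exp_pos _
  have hn' : (0 : ℝ) < n := by exact_mod_cast hn
  have hK0 : 0 < K := by
    have : 0 < E * K := by rw [h2]; positivity
    exact pos_of_mul_pos_right this hE.le
  have h3 : K ≤ (∏ a, ((letterCount x a).factorial : ℝ)) * Real.exp n := by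
    rw [← exp_sum_letterCount x, ← prod_mul_distrib]
    exact prod_le_prod (fun a _ => by positivity) fun a _ => pow_self_le_factorial_mul_exp _
  have h4 := factorial_mul_exp_le n
  refine le_of_mul_le_mul_right ?_ hK0
  calc (#(typeClass n (empirical x)) : ℝ) * K
      ≤ #(typeClass n (empirical x)) *
        ((∏ a, ((letterCount x a).factorial : ℝ)) * Real.exp n) := by gcongr
    _ = n.factorial * Real.exp n := by rw [← mul_assoc, h1]
    _ ≤ 3 * (n + 1) * (n : ℝ) ^ n := h4
    _ = 3 * (n + 1) * E * K := by rw [← h2]; ring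

theorem exp_entropy_le (hn : 0 < n) (x : Fin n → A) :
    Real.exp (n * entropy (empirical x)) ≤
      (3 * (n + 1)) ^ Fintype.card A * #(typeClass n (empirical x)) := by
  have h1 : (#(typeClass n (empirical x)) : ℝ) * ∏ a, ((letterCount x a).factorial : ℝ) =
      n.factorial := by exact_mod_cast card_typeClass_mul_prod_factorial x
  have h2 := exp_entropy_mul_prod hn x
  set E := Real.exp (n * entropy (empirical x))
  set K := ∏ a, (letterCount x a : ℝ) ^ letterCount x a with hK
  have hE : 0 < E := Real.exp_pos _
  have hn' : (0 : ℝ) < n := by exact_mod_cast hn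
  have hK0 : 0 < K := by
    have : 0 < E * K := by rw [h2]; positivity
    exact pos_of_mul_pos_right this hE.le
  have h3 : (∏ a, ((letterCount x a).factorial : ℝ)) * Real.exp n ≤
      (3 * (n + 1)) ^ Fintype.card A * K := by
    rw [← exp_sum_letterCount x, ← prod_mul_distrib]
    calc _ ≤ ∏ a, (3 * (n + 1) * (letterCount x a : ℝ) ^ letterCount x a) := by
          refine prod_le_prod (fun a _ => by positivity) fun a _ => ?_
          refine (factorial_mul_exp_le _).trans ?_
          have : letterCount x a ≤ n := by
            calc letterCount x a ≤ ∑ a, letterCount x a :=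
                  single_le_sum (f := letterCount x) (fun _ _ => Nat.zero_le _) (mem_univ a)
              _ = n := sum_letterCount x
          gcongr
      _ = _ := by rw [prod_mul_distrib, prod_const, card_univ]
  refine le_of_mul_le_mul_right ?_ hK0
  calc E * K = (n : ℝ) ^ n := h2
    _ ≤ n.factorial * Real.exp n := pow_self_le_factorial_mul_exp n
    _ = #(typeClass n (empirical x)) *
        ((∏ a, ((letterCount x a).factorial : ℝ)) * Real.exp n) := by rw [← mul_assoc, h1]
    _ ≤ #(typeClass n (empirical x)) * ((3 * (n + 1)) ^ Fintype.card A * K) := by gcongr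
    _ = _ := by ring

/-- The set of types of sequences of length `n`. -/
def types (A : Type*) [Fintype A] [DecidableEq A] (n : ℕ) : Finset (A → ℝ) :=
  open scoped Classical in univ.image (empirical : (Fin n → A) → A → ℝ)

theorem mem_types {V : A → ℝ} : V ∈ types A n ↔ ∃ x : Fin n → A, empirical x = V := by
  simp [types]

theorem card_types_le : #(types A n) ≤ (n + 1) ^ Fintype.card A := by
  classical
  have : types A n ⊆ (univ : Finset (A → Fin (n + 1))).image fun k a => ((k a : ℕ) : ℝ) / n := by
    intro V hV
    obtain ⟨x, rfl⟩ := mem_types.1 hV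
    refine mem_image.2 ⟨fun a => ⟨letterCount x a, Nat.lt_succ_of_le ?_⟩, mem_univ _, rfl⟩
    exact (card_filter_le _ _).trans (by simp)
  refine (card_le_card this).trans (card_image_le.trans ?_)
  simp

/-- A probability vector `V` with `n V` integral is a type. -/
theorem exists_empirical_eq {k : A → ℕ} (hk : ∑ a, k a = n) :
    ∃ x : Fin n → A, empirical x = fun a => (k a : ℝ) / n := by
  have e : Fin n ≃ Σ a, Fin (k a) := Fintype.equivOfCardEq (by simp [hk])
  refine ⟨fun i => (e i).1, funext fun a => ?_⟩
  rw [empirical_apply]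
  congr 2
  unfold letterCount
  have : #{i | (e i).1 = a} = #{s : Σ a, Fin (k a) | s.1 = a} := card_equiv e (by simp)
  rw [this]
  have h2 : ({s : Σ a, Fin (k a) | s.1 = a} : Finset _) =
      (univ : Finset (Fin (k a))).map ⟨Sigma.mk a, sigma_mk_injective⟩ := by
    ext ⟨b, j⟩
    simp only [mem_filter, mem_univ, true_and, Finset.mem_map, Function.Embedding.coeFn_mk]
    constructor
    · rintro rfl; exact ⟨j, rfl⟩
    · rintro ⟨j', h⟩; exact (congrArg Sigma.fst h).symm
  rw [h2, card_map, card_univ, Fintype.card_fin]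

end Types

/-! ### Recursive random codes over an abstract finite set

Codewords are drawn from `T`; a codeword `x` may follow `x'` only if `r x x'`. -/

section Recursive

open scoped Classical

variable {Ω : Type*} [Fintype Ω] {M : ℕ} (T : Finset Ω) (r : Ω → Ω → Prop)

/-- The elements of `T` that are allowed after the codewords in `c`. -/
def allowed (c : Fin M → Ω) : Finset Ω := T.filter fun x => ∀ j, r x (c j)

/-- The probability that `x` is drawn after the codewords in `c`. -/
def stepProb (c : Fin M → Ω) (x : Ω) : ℝ :=
  if x ∈ allowed T r c then 1 / (#(allowed T r c) : ℝ) else 0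

/-- The probability that the codebook `c` is drawn. -/
def seqProb (c : Fin M → Ω) : ℝ :=
  ∏ i, if c i ∈ T.filter (fun x => ∀ j, j < i → r x (c j))
    then 1 / (#(T.filter (fun x => ∀ j, j < i → r x (c j))) : ℝ) else 0

theorem stepProb_nonneg (c : Fin M → Ω) (x : Ω) : 0 ≤ stepProb T r c x := by
  unfold stepProb; positivity

theorem seqProb_nonneg (c : Fin M → Ω) : 0 ≤ seqProb T r c :=
  prod_nonneg fun i _ => by positivity

/-- Each codeword looks only at its predecessors, so appending one leaves the earlier factors
unchanged. Every induction on the code length rests on this. -/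
theorem seqProb_snoc (c : Fin M → Ω) (x : Ω) :
    seqProb T r (Fin.snoc c x : Fin (M + 1) → Ω) = seqProb T r c * stepProb T r c x := by
  have h1 : ∀ i : Fin M, (T.filter fun x' => ∀ j, j < i.castSucc →
      r x' ((Fin.snoc c x : Fin (M + 1) → Ω) j)) = T.filter fun x' => ∀ j, j < i → r x' (c j) := by
    intro i
    refine filter_congr fun x' _ => ?_
    constructor
    · intro h j hj
      simpa using h j.castSucc (by simpa using hj)
    · intro h j hj
      induction j using Fin.lastCases with
      | last => exact absurd hj (by simp [Fin.lt_def])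
      | cast j => simpa using h j (by simpa using hj)
  have h2 : (T.filter fun x' => ∀ j, j < Fin.last M →
      r x' ((Fin.snoc c x : Fin (M + 1) → Ω) j)) = allowed T r c := by
    refine filter_congr fun x' _ => ?_
    constructor
    · intro h j
      simpa using h j.castSucc (Fin.castSucc_lt_last j)
    · intro h j hj
      induction j using Fin.lastCases with
      | last => exact absurd hj (lt_irrefl _)
      | cast j => simpa using h j
  rw [seqProb, Fin.prod_univ_castSucc]
  simp only [h1, h2, Fin.snoc_castSucc, Fin.snoc_last]
  rfl

theorem sum_snoc (F : (Fin (M + 1) → Ω) → ℝ) :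
    ∑ c, F c = ∑ c : Fin M → Ω, ∑ x, F (Fin.snoc c x : Fin (M + 1) → Ω) := by
  rw [← (Fin.snocEquiv fun _ : Fin (M + 1) => Ω).sum_comp F, Fintype.sum_prod_type, sum_comm]
  rfl

theorem mem_of_seqProb_ne_zero {c : Fin M → Ω} (h : seqProb T r c ≠ 0) (i : Fin M) : c i ∈ T := by
  have := prod_ne_zero_iff.1 h i (mem_univ i)
  by_contra hi
  simp [hi] at this

theorem rel_of_seqProb_ne_zero {c : Fin M → Ω} (h : seqProb T r c ≠ 0) {i j : Fin M}
    (hij : j < i) : r (c i) (c j) := by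
  have := prod_ne_zero_iff.1 h i (mem_univ i)
  by_contra hi
  refine this (if_neg fun hm => hi ?_)
  exact (mem_filter.1 hm).2 j hij

/-- The volume condition: the codewords of a codebook of length less than `L` exclude altogether at
most a fraction `η` of `T`. -/
def SmallVolume (L : ℕ) (η : ℝ) : Prop :=
  ∀ x ∈ T, (L : ℝ) * #(T.filter fun x' => ¬ r x' x) ≤ η * #T

variable {T r} {L : ℕ} {η : ℝ}

/-- Each of the at most `L` codewords excludes at most `η #T / L` elements; the excluded sets are
added up. -/
theorem card_allowed_ge (h : SmallVolume T r L η) (hM : M ≤ L) {c : Fin M → Ω}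
    (hc : ∀ i, c i ∈ T) : (1 - η) * #T ≤ (#(allowed T r c) : ℝ) := by
  have h1 : #T ≤ #(allowed T r c) + ∑ j : Fin M, #(T.filter fun x' => ¬ r x' (c j)) := by
    have : T ⊆ allowed T r c ∪ univ.biUnion fun j => T.filter fun x' => ¬ r x' (c j) := by
      intro x hx
      by_cases hx' : ∀ j, r x (c j)
      · exact mem_union_left _ (mem_filter.2 ⟨hx, hx'⟩)
      · push Not at hx'
        obtain ⟨j, hj⟩ := hx'
        exact mem_union_right _ (mem_biUnion.2 ⟨j, mem_univ j, mem_filter.2 ⟨hx, hj⟩⟩)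
    exact (card_le_card this).trans ((card_union_le _ _).trans (by gcongr; exact card_biUnion_le))
  have h1' : (#T : ℝ) ≤ #(allowed T r c) +
      ∑ j : Fin M, (#(T.filter fun x' => ¬ r x' (c j)) : ℝ) := by exact_mod_cast h1
  rcases Nat.eq_zero_or_pos M with rfl | hM0
  -- The sign of `η` is not assumed: `0 ≤ η * #T` is read off the volume condition at an element of
  -- `T`.
  · simp only [univ_eq_empty, sum_empty, add_zero] at h1'
    rcases T.eq_empty_or_nonempty with rfl | ⟨x, hx⟩
    · simp
    · have := h x hx
      have h3 : 0 ≤ η * #T := le_trans (by positivity) this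
      linarith
  · have h2 : ∑ j : Fin M, (#(T.filter fun x' => ¬ r x' (c j)) : ℝ) ≤ η * #T := by
      calc _ ≤ ∑ _j : Fin M, η * #T / M := by
            refine sum_le_sum fun j _ => ?_
            rw [le_div_iff₀' (by exact_mod_cast hM0)]
            refine le_trans ?_ (h (c j) (hc j))
            gcongr
        _ = η * #T := by
            rw [sum_const, card_univ, Fintype.card_fin, nsmul_eq_mul, mul_div_cancel₀]
            positivity
    linarith

theorem sum_stepProb_le (c : Fin M → Ω) : ∑ x, stepProb T r c x ≤ 1 := by
  unfold stepProb
  rw [sum_ite_mem, univ_inter, sum_const, nsmul_eq_mul, mul_one_div]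
  exact div_self_le_one _

theorem sum_stepProb_eq (hT : T.Nonempty) (hη : η < 1) (h : SmallVolume T r L η) (hM : M ≤ L)
    {c : Fin M → Ω} (hc : ∀ i, c i ∈ T) : ∑ x, stepProb T r c x = 1 := by
  have h1 := card_allowed_ge h hM hc
  have h2 : (0 : ℝ) < #(allowed T r c) :=
    lt_of_lt_of_le (mul_pos (by linarith) (by exact_mod_cast hT.card_pos)) h1
  unfold stepProb
  rw [sum_ite_mem, univ_inter, sum_const, nsmul_eq_mul, mul_one_div, div_self h2.ne']

theorem stepProb_le (hT : T.Nonempty) (hη : η < 1) (h : SmallVolume T r L η) (hM : M ≤ L)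
    {c : Fin M → Ω} (hc : ∀ i, c i ∈ T) (x : Ω) : stepProb T r c x ≤ 1 / ((1 - η) * #T) := by
  have h1 := card_allowed_ge h hM hc
  have h2 : 0 < (1 - η) * #T := mul_pos (by linarith) (by exact_mod_cast hT.card_pos)
  unfold stepProb
  split_ifs
  · gcongr
  · positivity

theorem le_stepProb {c : Fin M → Ω} {x : Ω} (hx : x ∈ allowed T r c) :
    1 / (#T : ℝ) ≤ stepProb T r c x := by
  rw [stepProb, if_pos hx]
  have : 0 < #(allowed T r c) := card_pos.2 ⟨x, hx⟩
  have h2 : #(allowed T r c) ≤ #T := card_filter_le _ _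
  gcongr

variable (T r) in
/-- The probability of an event for a random codebook of length `M`. -/
def codebookPr (M : ℕ) (E : (Fin M → Ω) → Prop) : ℝ := ∑ c, if E c then seqProb T r c else 0

theorem codebookPr_nonneg (E : (Fin M → Ω) → Prop) : 0 ≤ codebookPr T r M E :=
  sum_nonneg fun c _ => by have := seqProb_nonneg T r c; positivity

theorem codebookPr_mono {E F : (Fin M → Ω) → Prop}
    (h : ∀ c, seqProb T r c ≠ 0 → E c → F c) : codebookPr T r M E ≤ codebookPr T r M F := by
  refine sum_le_sum fun c _ => ?_
  have := seqProb_nonneg T r c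
  by_cases h0 : seqProb T r c = 0
  · simp [h0]
  · by_cases hE : E c
    · simp [hE, h c h0 hE]
    · simp only [hE, if_false]; positivity

theorem codebookPr_exists_le {ι : Type*} (s : Finset ι) (E : ι → (Fin M → Ω) → Prop) :
    codebookPr T r M (fun c => ∃ i ∈ s, E i c) ≤ ∑ i ∈ s, codebookPr T r M (E i) := by
  unfold codebookPr
  rw [sum_comm]
  refine sum_le_sum fun c _ => ?_
  have := seqProb_nonneg T r c
  split_ifs with h
  · obtain ⟨i, hi, hE⟩ := h
    refine le_trans ?_ (single_le_sum (f := fun i => if E i c then seqProb T r c else 0)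
      (fun i _ => by positivity) hi)
    simp [hE]
  · exact sum_nonneg fun i _ => by positivity

/-- Events that depend only on the first codewords have the same probability for longer codes. -/
theorem codebookPr_castSucc (hT : T.Nonempty) (hη : η < 1) (h : SmallVolume T r L η)
    (hM : M ≤ L) (E : (Fin M → Ω) → Prop) :
    codebookPr T r (M + 1) (fun c => E fun i => c i.castSucc) = codebookPr T r M E := by
  unfold codebookPr
  rw [sum_snoc]
  refine sum_congr rfl fun c _ => ?_
  simp only [Fin.snoc_castSucc, seqProb_snoc]
  by_cases hE : E c
  · simp only [hE, if_true, ← mul_sum]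
    by_cases h0 : seqProb T r c = 0
    · simp [h0]
    · rw [sum_stepProb_eq hT hη h hM (mem_of_seqProb_ne_zero T r h0), mul_one]
  · simp [hE]

/-- The laws of codes of different lengths are consistent because the construction never gets stuck
up to length `L`; a codeword can thus be treated as if it were the last. -/
theorem codebookPr_castLE (hT : T.Nonempty) (hη : η < 1) (h : SmallVolume T r L η) {N : ℕ}
    (hNM : N ≤ M) (hM : M ≤ L) (E : (Fin N → Ω) → Prop) :
    codebookPr T r M (fun c => E fun i => c (Fin.castLE hNM i)) = codebookPr T r N E := by
  induction M, hNM using Nat.le_induction with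
  | base => rfl
  | succ M hNM ih =>
    rw [← ih (by omega), ← codebookPr_castSucc hT hη h (by omega : M ≤ L)]
    rfl

theorem codebookPr_true (hT : T.Nonempty) (hη : η < 1) (h : SmallVolume T r L η) (hM : M ≤ L) :
    codebookPr T r M (fun _ => True) = 1 := by
  have := codebookPr_castLE hT hη h (Nat.zero_le M) hM (fun _ => True)
  rw [this]
  simp [codebookPr, seqProb]

theorem sum_seqProb (hT : T.Nonempty) (hη : η < 1) (h : SmallVolume T r M η) :
    ∑ c : Fin M → Ω, seqProb T r c = 1 := by
  simpa [codebookPr] using codebookPr_true hT hη h le_rfl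

/-- Peel off the last codeword: given the others it lies in its set with probability at most the
size of the set times the bound of `stepProb_le`, and if unconstrained it contributes a factor at
most `1`. The applications use one, two or three positions. -/
theorem codebookPr_forall_mem_le (hT : T.Nonempty) (hη : η < 1) (h : SmallVolume T r L η)
    (hM : M ≤ L) (s : Finset (Fin M)) (F : Fin M → Finset Ω) :
    codebookPr T r M (fun c => ∀ i ∈ s, c i ∈ F i) ≤
      ∏ i ∈ s, (#(F i) * (1 / ((1 - η) * #T))) := by
  have h2 : 0 < (1 - η) * #T := mul_pos (by linarith) (by exact_mod_cast hT.card_pos)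
  induction M with
  | zero =>
    have : s = ∅ := by ext i; exact i.elim0
    subst this
    simp [codebookPr, seqProb]
  | succ M ih =>
    have ih' := ih (by omega) (univ.filter fun i => i.castSucc ∈ s) (fun i => F i.castSucc)
    set B := 1 / ((1 - η) * #T) with hB
    have hprod : ∏ i ∈ s, (#(F i) * B : ℝ) =
        (∏ i ∈ univ.filter (fun i : Fin M => i.castSucc ∈ s), (#(F i.castSucc) * B : ℝ)) *
          (if Fin.last M ∈ s then (#(F (Fin.last M)) * B : ℝ) else 1) := by
      rw [prod_filter, ← Fin.prod_univ_castSucc (f := fun i => if i ∈ s then (#(F i) * B : ℝ) else 1),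
        prod_ite_mem, univ_inter]
    rw [hprod]
    refine le_trans ?_ (mul_le_mul_of_nonneg_right ih' (by positivity))
    unfold codebookPr
    rw [sum_snoc, sum_mul]
    refine sum_le_sum fun c _ => ?_
    have hs := seqProb_nonneg T r c
    by_cases h0 : seqProb T r c = 0
    · simp [seqProb_snoc, h0]
    have hcT := mem_of_seqProb_ne_zero T r h0
    by_cases hE : ∀ i ∈ univ.filter (fun i : Fin M => i.castSucc ∈ s), c i ∈ F i.castSucc
    · rw [if_pos hE]
      by_cases hl : Fin.last M ∈ s
      · rw [if_pos hl]
        calc _ ≤ ∑ x, if x ∈ F (Fin.last M) then seqProb T r c * B else 0 := by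
              refine sum_le_sum fun x _ => ?_
              by_cases hx : x ∈ F (Fin.last M)
              · rw [if_pos hx, seqProb_snoc]
                have := stepProb_le hT hη h (by omega) hcT x
                split_ifs
                · gcongr
                · positivity
              · rw [if_neg hx, if_neg]
                intro hall
                exact hx (by simpa using hall _ hl)
          _ = seqProb T r c * (#(F (Fin.last M)) * B) := by
              rw [sum_ite_mem, univ_inter, sum_const, nsmul_eq_mul]; ring
      · rw [if_neg hl, mul_one]
        calc _ ≤ ∑ x, seqProb T r c * stepProb T r c x := by
              refine sum_le_sum fun x _ => ?_
              rw [seqProb_snoc]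
              have := stepProb_nonneg T r c x
              split_ifs
              · exact le_rfl
              · positivity
          _ ≤ seqProb T r c := by
              rw [← mul_sum]
              exact mul_le_of_le_one_right hs (sum_stepProb_le c)
    · rw [if_neg hE, zero_mul]
      refine (sum_eq_zero fun x _ => if_neg fun hall => hE fun i hi => ?_).le
      simpa using hall i.castSucc (mem_filter.1 hi).2

/-- The probability that the next codeword is `x` after an event `E`. -/
theorem le_codebookPr_snoc {E : (Fin M → Ω) → Prop} {x : Ω} (hx : x ∈ T) :
    1 / (#T : ℝ) * codebookPr T r M (fun c => E c ∧ ∀ j, r x (c j)) ≤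
      codebookPr T r (M + 1) (fun c => (E fun i => c i.castSucc) ∧ c (Fin.last M) = x) := by
  unfold codebookPr
  rw [sum_snoc, mul_sum]
  refine sum_le_sum fun c _ => ?_
  have hs := seqProb_nonneg T r c
  simp only [Fin.snoc_castSucc, Fin.snoc_last, seqProb_snoc]
  by_cases hE : E c ∧ ∀ j, r x (c j)
  · rw [if_pos hE]
    refine le_trans ?_ (single_le_sum (f := fun x' => if E c ∧ x' = x then
      seqProb T r c * stepProb T r c x' else 0) (fun x' _ => ?_) (mem_univ x))
    · simp only [hE.1, true_and, if_true]
      rw [mul_comm]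
      have := le_stepProb (T := T) (r := r) (c := c) (x := x) (mem_filter.2 ⟨hx, hE.2⟩)
      gcongr
    · have := stepProb_nonneg T r c x'
      positivity
  · rw [if_neg hE, mul_zero]
    refine sum_nonneg fun x' _ => ?_
    have := stepProb_nonneg T r c x'
    positivity

theorem codebookPr_le_add_not (E G : (Fin M → Ω) → Prop) :
    codebookPr T r M E ≤ codebookPr T r M (fun c => E c ∧ G c) +
      codebookPr T r M (fun c => E c ∧ ¬ G c) := by
  unfold codebookPr
  rw [← sum_add_distrib]
  refine sum_le_sum fun c _ => ?_
  by_cases h1 : E c <;> by_cases h2 : G c <;> simp [h1, h2]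

/-- Cut the code after position `i`. Then `x` is drawn with probability at least `1/#T` unless an
earlier codeword excludes it. By symmetry of `r`, such a codeword lies in the set excluded by `x`,
so a union bound gives this probability at most `η/(1-η)`. -/
theorem codebookPr_eq_singleton_ge (hT : T.Nonempty) (hη : η < 1) (h : SmallVolume T r L η)
    (hr : ∀ x y, r x y → r y x) (hM : M ≤ L) (i : Fin M) {x : Ω} (hx : x ∈ T) :
    1 / (#T : ℝ) * (1 - η / (1 - η)) ≤ codebookPr T r M (fun c => c i = x) := by
  have hiL : (i : ℕ) + 1 ≤ L := by omega
  have e := codebookPr_castLE hT hη h (N := i + 1) (by omega) hM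
    (fun c : Fin (i + 1) → Ω => c (Fin.last i) = x)
  have e' : codebookPr T r M (fun c => c i = x) =
      codebookPr T r (i + 1) (fun c => c (Fin.last i) = x) := by
    rw [← e]; rfl
  rw [e']
  have h1 := le_codebookPr_snoc (T := T) (r := r) (M := i) (E := fun _ => True) hx
  simp only [true_and] at h1
  refine le_trans ?_ h1
  gcongr
  have h2 := codebookPr_le_add_not (T := T) (r := r) (M := i) (fun _ => True)
    (fun c => ∀ j, r x (c j))
  simp only [true_and] at h2
  rw [codebookPr_true hT hη h (by omega)] at h2
  have hT0 : (0 : ℝ) < #T := by exact_mod_cast hT.card_pos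
  have hη' : 0 < 1 - η := by linarith
  have h3 : codebookPr T r i (fun c => ¬ ∀ j, r x (c j)) ≤ η / (1 - η) := by
    calc codebookPr T r i (fun c => ¬ ∀ j, r x (c j))
        ≤ codebookPr T r i (fun c => ∃ j ∈ (univ : Finset (Fin i)), ∀ k ∈ ({j} : Finset (Fin i)),
          c k ∈ T.filter fun x' => ¬ r x' x) := by
          refine codebookPr_mono fun c hc hE => ?_
          push Not at hE
          obtain ⟨j, hj⟩ := hE
          refine ⟨j, mem_univ j, fun k hk => ?_⟩
          rw [mem_singleton.1 hk]
          exact mem_filter.2 ⟨mem_of_seqProb_ne_zero T r hc j, fun h => hj (hr _ _ h)⟩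
      _ ≤ ∑ j : Fin i, codebookPr T r i (fun c => ∀ k ∈ ({j} : Finset (Fin i)),
          c k ∈ T.filter fun x' => ¬ r x' x) := codebookPr_exists_le _ _
      _ ≤ ∑ j : Fin i, (#(T.filter fun x' => ¬ r x' x) * (1 / ((1 - η) * #T)) : ℝ) := by
          refine sum_le_sum fun j _ => ?_
          refine (codebookPr_forall_mem_le hT hη h (by omega) {j}
            (fun _ => T.filter fun x' => ¬ r x' x)).trans_eq ?_
          rw [prod_singleton]
      _ = (i : ℝ) * #(T.filter fun x' => ¬ r x' x) * (1 / ((1 - η) * #T)) := by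
          rw [sum_const, card_univ, Fintype.card_fin, nsmul_eq_mul]; ring
      _ ≤ (L : ℝ) * #(T.filter fun x' => ¬ r x' x) * (1 / ((1 - η) * #T)) := by
          gcongr
          omega
      _ ≤ η * #T * (1 / ((1 - η) * #T)) := by
          exact mul_le_mul_of_nonneg_right (h x hx) (by positivity)
      _ = η / (1 - η) := by field_simp
  linarith

/-- The argument of `codebookPr_eq_singleton_ge` with the event `c i = x'` carried along. The new
loss is the event that `x'` sits at `i` while another earlier codeword excludes `x`: two positions
are prescribed, hence the square of `1-η`. -/
theorem codebookPr_eq_pair_ge (hT : T.Nonempty) (hη : η < 1) (h : SmallVolume T r L η)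
    (hr : ∀ x y, r x y → r y x) (hM : M ≤ L) {i m : Fin M} (him : i < m) {x x' : Ω} (hx : x ∈ T)
    (hx' : x' ∈ T) (hxx' : r x x') :
    (1 / (#T : ℝ)) ^ 2 * (1 - η / (1 - η) - η / (1 - η) ^ 2) ≤
      codebookPr T r M (fun c => c i = x' ∧ c m = x) := by
  have hmL : (m : ℕ) + 1 ≤ L := by omega
  set i' : Fin m := ⟨i, him⟩ with hi'
  have e := codebookPr_castLE hT hη h (N := m + 1) (by omega) hM
    (fun c : Fin (m + 1) → Ω => c i'.castSucc = x' ∧ c (Fin.last m) = x)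
  have e' : codebookPr T r M (fun c => c i = x' ∧ c m = x) =
      codebookPr T r (m + 1) (fun c => c i'.castSucc = x' ∧ c (Fin.last m) = x) := by
    rw [← e]; rfl
  rw [e']
  have h1 := le_codebookPr_snoc (T := T) (r := r) (M := m) (E := fun c => c i' = x') hx
  refine le_trans ?_ h1
  have h2 := codebookPr_le_add_not (T := T) (r := r) (M := m) (fun c => c i' = x')
    (fun c => ∀ j, r x (c j))
  have h4 := codebookPr_eq_singleton_ge hT hη h hr (M := m) (by omega) i' hx'
  have hT0 : (0 : ℝ) < #T := by exact_mod_cast hT.card_pos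
  have hη' : 0 < 1 - η := by linarith
  have h3 : codebookPr T r m (fun c => c i' = x' ∧ ¬ ∀ j, r x (c j)) ≤
      1 / (#T : ℝ) * (η / (1 - η) ^ 2) := by
    set F : Finset Ω := T.filter fun x' => ¬ r x' x with hF
    calc codebookPr T r m (fun c => c i' = x' ∧ ¬ ∀ j, r x (c j))
        ≤ codebookPr T r m (fun c => ∃ j ∈ univ.erase i', ∀ k ∈ ({j, i'} : Finset (Fin m)),
          c k ∈ if k = i' then {x'} else F) := by
          refine codebookPr_mono fun c hc hE => ?_
          obtain ⟨hE1, hE⟩ := hE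
          push Not at hE
          obtain ⟨j, hj⟩ := hE
          -- Since `r x x'`, position `i` cannot itself exclude `x`, so the bound for two distinct
          -- positions applies.
          have hji : j ≠ i' := by
            rintro rfl
            exact hj (by rwa [hE1])
          refine ⟨j, mem_erase.2 ⟨hji, mem_univ j⟩, fun k hk => ?_⟩
          rcases mem_insert.1 hk with rfl | hk
          · rw [if_neg hji]
            exact mem_filter.2 ⟨mem_of_seqProb_ne_zero T r hc k, fun h => hj (hr _ _ h)⟩
          · rw [mem_singleton.1 hk]; simp [hE1]
      _ ≤ ∑ j ∈ univ.erase i', codebookPr T r m (fun c => ∀ k ∈ ({j, i'} : Finset (Fin m)),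
          c k ∈ if k = i' then {x'} else F) := codebookPr_exists_le _ _
      _ ≤ ∑ j ∈ univ.erase i', (#F * (1 / ((1 - η) * #T)) * (1 / ((1 - η) * #T)) : ℝ) := by
          refine sum_le_sum fun j hj => ?_
          refine (codebookPr_forall_mem_le hT hη h (by omega) {j, i'}
            (fun k => if k = i' then {x'} else F)).trans_eq ?_
          have hji := (mem_erase.1 hj).1
          rw [prod_pair hji]
          simp [hji]
      _ ≤ ∑ _j : Fin m, (#F * (1 / ((1 - η) * #T)) * (1 / ((1 - η) * #T)) : ℝ) :=
          sum_le_sum_of_subset_of_nonneg (erase_subset _ _) fun _ _ _ => by positivity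
      _ = (m : ℝ) * #F * (1 / ((1 - η) * #T)) ^ 2 := by
          rw [sum_const, card_univ, Fintype.card_fin, nsmul_eq_mul]; ring
      _ ≤ (L : ℝ) * #F * (1 / ((1 - η) * #T)) ^ 2 := by
          gcongr
          omega
      _ ≤ η * #T * (1 / ((1 - η) * #T)) ^ 2 := by
          exact mul_le_mul_of_nonneg_right (h x hx) (by positivity)
      _ = 1 / (#T : ℝ) * (η / (1 - η) ^ 2) := by field_simp
  have h5 : 1 / (#T : ℝ) * (1 - η / (1 - η) - η / (1 - η) ^ 2) ≤
      codebookPr T r m (fun c => c i' = x' ∧ ∀ j, r x (c j)) := by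
    have : 1 / (#T : ℝ) * (1 - η / (1 - η) - η / (1 - η) ^ 2) =
      1 / (#T : ℝ) * (1 - η / (1 - η)) - 1 / (#T : ℝ) * (η / (1 - η) ^ 2) := by ring
    rw [this]
    linarith
  calc (1 / (#T : ℝ)) ^ 2 * (1 - η / (1 - η) - η / (1 - η) ^ 2)
      = 1 / (#T : ℝ) * (1 / (#T : ℝ) * (1 - η / (1 - η) - η / (1 - η) ^ 2)) := by ring
    _ ≤ _ := by gcongr

end Recursive

/-! ### Probability that some competitor falls in a given set -/

section UnionBounds

open scoped Classical

variable {Ω : Type*} [Fintype Ω] {M : ℕ} {T : Finset Ω} {r : Ω → Ω → Prop} {L : ℕ} {η : ℝ}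

/-- The first term of the minimum forgets the competitors; the second is a union bound over them,
using the product estimate for two positions. -/
theorem codebookPr_union_le (hT : T.Nonempty) (hη : η < 1) (h : SmallVolume T r M η)
    (m : Fin M) (x : Ω) (S : Finset Ω) :
    codebookPr T r M (fun c => c m = x ∧ ∃ i, i ≠ m ∧ c i ∈ S) ≤
      1 / ((1 - η) * #T) * min 1 (M * #S * (1 / ((1 - η) * #T))) := by
  have h2 : 0 < (1 - η) * #T := mul_pos (by linarith) (by exact_mod_cast hT.card_pos)
  set B := 1 / ((1 - η) * #T) with hB
  have hB0 : 0 < B := by positivity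
  rw [mul_min_of_nonneg _ _ hB0.le, mul_one]
  refine le_min ?_ ?_
  · have := codebookPr_forall_mem_le hT hη h le_rfl {m} (fun _ => {x})
    simp only [prod_singleton, card_singleton, Nat.cast_one, one_mul] at this
    refine (codebookPr_mono fun c _ hE => ?_).trans this
    simpa using hE.1
  · calc codebookPr T r M (fun c => c m = x ∧ ∃ i, i ≠ m ∧ c i ∈ S)
        ≤ codebookPr T r M (fun c => ∃ i ∈ univ.erase m, ∀ k ∈ ({i, m} : Finset (Fin M)),
          c k ∈ if k = m then {x} else S) := by
          refine codebookPr_mono fun c _ hE => ?_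
          obtain ⟨h1, i, him, hi⟩ := hE
          refine ⟨i, mem_erase.2 ⟨him, mem_univ i⟩, fun k hk => ?_⟩
          rcases mem_insert.1 hk with rfl | hk
          · rw [if_neg him]; exact hi
          · rw [mem_singleton.1 hk]; simp [h1]
      _ ≤ ∑ i ∈ univ.erase m, codebookPr T r M (fun c => ∀ k ∈ ({i, m} : Finset (Fin M)),
          c k ∈ if k = m then {x} else S) := codebookPr_exists_le _ _
      _ ≤ ∑ i ∈ univ.erase m, (#S * B * B : ℝ) := by
          refine sum_le_sum fun i hi => ?_
          refine (codebookPr_forall_mem_le hT hη h le_rfl {i, m}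
            (fun k => if k = m then {x} else S)).trans_eq ?_
          have him := (mem_erase.1 hi).1
          rw [prod_pair him]
          simp [him, hB]
      _ ≤ ∑ _i : Fin M, (#S * B * B : ℝ) :=
          sum_le_sum_of_subset_of_nonneg (erase_subset _ _) fun _ _ _ => by positivity
      _ = B * (M * #S * B) := by
          rw [sum_const, card_univ, Fintype.card_fin, nsmul_eq_mul]; ring

theorem sum_codebookPr_eq_le (E : (Fin M → Ω) → Prop) (i : Fin M) (S : Finset Ω) :
    ∑ x ∈ S, codebookPr T r M (fun c => c i = x ∧ E c) ≤
      codebookPr T r M (fun c => E c ∧ c i ∈ S) := by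
  unfold codebookPr
  rw [sum_comm]
  refine sum_le_sum fun c _ => ?_
  by_cases hE : E c
  · simp [hE]
  · simp [hE]

theorem codebookPr_bonferroni {ι : Type*} [DecidableEq ι] (s : Finset ι) (E : (Fin M → Ω) → Prop)
    (F : ι → (Fin M → Ω) → Prop) :
    ∑ i ∈ s, codebookPr T r M (fun c => E c ∧ F i c) -
      1 / 2 * ∑ i ∈ s, ∑ j ∈ s.erase i, codebookPr T r M (fun c => E c ∧ F i c ∧ F j c) ≤
    codebookPr T r M (fun c => E c ∧ ∃ i ∈ s, F i c) := by
  unfold codebookPr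
  rw [sum_comm]
  simp_rw [sum_comm (t := (univ : Finset (Fin M → Ω)))]
  rw [mul_sum, ← sum_sub_distrib]
  refine sum_le_sum fun c _ => ?_
  have hs := seqProb_nonneg T r c
  by_cases hE : E c
  swap
  · simp [hE]
  set p := seqProb T r c
  set t := s.filter fun i => F i c with ht
  have h1 : ∑ i ∈ s, (if E c ∧ F i c then p else 0) = #t * p := by
    simp only [hE, true_and]
    rw [← sum_filter, sum_const, nsmul_eq_mul]
  have h2 : ∑ i ∈ s, ∑ j ∈ s.erase i, (if E c ∧ F i c ∧ F j c then p else 0) =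
      #t * ((#t - 1) * p) := by
    simp only [hE, true_and]
    have : ∀ i ∈ s, ∑ j ∈ s.erase i, (if F i c ∧ F j c then p else 0) =
        if F i c then (#t - 1) * p else 0 := by
      intro i hi
      by_cases hF : F i c
      · simp only [hF, true_and, if_true]
        rw [← sum_filter, sum_const, nsmul_eq_mul, filter_erase, card_erase_of_mem]
        · have : i ∈ t := mem_filter.2 ⟨hi, hF⟩
          rw [Nat.cast_sub (card_pos.2 ⟨i, this⟩), Nat.cast_one]
        · exact mem_filter.2 ⟨hi, hF⟩
      · simp [hF]
    rw [sum_congr rfl this, ← sum_filter, sum_const, nsmul_eq_mul]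
  suffices hfin : #t * p - 1 / 2 * (#t * ((#t - 1) * p)) ≤
      if E c ∧ ∃ i ∈ s, F i c then p else 0 by
    rw [← h1, ← h2] at hfin
    calc _ = _ := by congr!
      _ ≤ _ := hfin
      _ = _ := by congr!
  rcases t.eq_empty_or_nonempty with h0 | ⟨i, hi⟩
  · simp only [h0, card_empty, Nat.cast_zero, zero_mul, mul_zero, sub_zero]
    positivity
  · have hex : ∃ i ∈ s, F i c := ⟨i, (mem_filter.1 hi).1, (mem_filter.1 hi).2⟩
    rw [if_pos ⟨hE, hex⟩]
    -- With `t` events occurring, the claim is `t - t(t-1)/2 ≤ 1`, that is `(t-1)(t-2) ≥ 0`, which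
    -- holds for integers `t ≥ 1`.
    have h3 : ((#t : ℝ) - 1) * (#t - 2) ≥ 0 := by
      have h4 : 1 ≤ #t := card_pos.2 ⟨i, hi⟩
      rcases h4.eq_or_lt with h5 | h5
      · rw [← h5]; simp
      · have h6 : (2 : ℝ) ≤ #t := by exact_mod_cast h5
        exact mul_nonneg (by linarith) (by linarith)
    nlinarith

theorem pair_const {η : ℝ} (hη0 : 0 ≤ η) (hη : η ≤ 1 / 10) :
    3 / 4 ≤ 1 - η / (1 - η) - η / (1 - η) ^ 2 := by
  have e1 : η / (1 - η) ≤ 1 / 9 := by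
    rw [div_le_iff₀ (by linarith)]; linarith
  have e2 : η / (1 - η) ^ 2 ≤ 10 / 81 := by
    rw [div_le_iff₀ (by nlinarith)]
    nlinarith
  linarith

theorem one_div_one_sub_mul_le {η t : ℝ} (ht : 0 < t) (hη : η ≤ 1 / 10) :
    1 / ((1 - η) * t) ≤ 10 / 9 * (1 / t) := by
  have h9 : 9 / 10 * t ≤ (1 - η) * t := by
    apply mul_le_mul_of_nonneg_right _ ht.le
    linarith
  calc 1 / ((1 - η) * t) ≤ 1 / (9 / 10 * t) := one_div_le_one_div_of_le (by positivity) h9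
    _ = 10 / 9 * (1 / t) := by field_simp

/-- The cap on `N` gives `(N-1)s ≤ t/4`, so the double sum is at most `(1/4)(10/9)³ = 250/729 ≤ 1/2`
in units of `Ns/t²`; after the factor `1/2` it removes at most `1/4` of the main term's `3/4`. If
the cap is active, `Ns/t ≥ 1/4`, which is where that constant in the minimum comes from. -/
theorem bonferroni_arith {t s B : ℝ} {K N : ℕ} (ht : 0 < t) (hs : 0 < s) (hB0 : 0 ≤ B)
    (hBle : B ≤ 10 / 9 * (1 / t)) (hN : N = min K ⌈t / (4 * s)⌉₊) :
    1 / (2 * t) * min (K * s / t) (1 / 4) ≤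
      N * (s * ((1 / t) ^ 2 * (3 / 4))) -
        1 / 2 * (N * ((N - 1 : ℕ) * (s * B * (s * B * B)))) := by
  have hN1 : ((N - 1 : ℕ) : ℝ) * s ≤ t / 4 := by
    have h3 : ((N - 1 : ℕ) : ℝ) ≤ t / (4 * s) := by
      rcases Nat.eq_zero_or_pos N with h0 | h0
      · rw [h0]; simp only [Nat.zero_sub, Nat.cast_zero]; positivity
      · rw [Nat.cast_sub h0, Nat.cast_one]
        have h4 : (N : ℝ) ≤ ⌈t / (4 * s)⌉₊ := by
          rw [hN]; exact_mod_cast min_le_right _ _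
        have h5 := Nat.ceil_lt_add_one (a := t / (4 * s)) (by positivity)
        linarith
    calc ((N - 1 : ℕ) : ℝ) * s ≤ t / (4 * s) * s := by gcongr
      _ = t / 4 := by field_simp
  have h3 : N * ((N - 1 : ℕ) * (s * B * (s * B * B))) ≤ N * s * ((1 / t) ^ 2 * (1 / 2)) := by
    calc N * ((N - 1 : ℕ) * (s * B * (s * B * B))) = N * s * (((N - 1 : ℕ) * s) * B ^ 3) := by ring
      _ ≤ N * s * (t / 4 * (10 / 9 * (1 / t)) ^ 3) := by gcongr
      _ = N * s * ((1 / t) ^ 2 * (250 / 729)) := by field_simp; ring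
      _ ≤ N * s * ((1 / t) ^ 2 * (1 / 2)) := by gcongr N * s * ((1 / t) ^ 2 * ?_); norm_num
  have h4 : min (K * s / t) (1 / 4) ≤ N * s / t := by
    rw [hN, Nat.cast_min]
    rcases min_cases (K : ℝ) (⌈t / (4 * s)⌉₊ : ℝ) with ⟨h5, -⟩ | ⟨h5, -⟩
    · rw [h5]; exact min_le_left _ _
    · rw [h5]
      refine (min_le_right _ _).trans ?_
      have h6 := Nat.le_ceil (t / (4 * s))
      calc (1 / 4 : ℝ) = t / (4 * s) * s / t := by field_simp
        _ ≤ _ := by gcongr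
  calc 1 / (2 * t) * min (K * s / t) (1 / 4) ≤ 1 / (2 * t) * (N * s / t) := by gcongr
    _ = N * (s * ((1 / t) ^ 2 * (3 / 4))) - 1 / 2 * (N * s * ((1 / t) ^ 2 * (1 / 2))) := by
      field_simp; ring
    _ ≤ _ := by linarith

/-- Only `N` competitors drawn before `m` are kept: earlier ones because the pair estimate asks for
this order, and few enough that multiple hits do not dominate. Bonferroni then combines the lower
bound for pairs with the product upper bound for triples. -/
theorem le_codebookPr_union (hT : T.Nonempty) (hη0 : 0 ≤ η) (hη : η ≤ 1 / 10)
    (h : SmallVolume T r M η) (hr : ∀ x y, r x y → r y x) (m : Fin M) {K : ℕ} (hK : K ≤ m)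
    {x : Ω} (hx : x ∈ T) {S : Finset Ω} (hS : S ⊆ T) (hrS : ∀ x' ∈ S, r x x') :
    1 / (2 * (#T : ℝ)) * min ((K : ℝ) * #S / #T) (1 / 4) ≤
      codebookPr T r M (fun c => c m = x ∧ ∃ i, i ≠ m ∧ c i ∈ S) := by
  have hη1 : η < 1 := by linarith
  have ht : (0 : ℝ) < #T := by exact_mod_cast hT.card_pos
  set t : ℝ := ((#T : ℕ) : ℝ) with htdef
  rcases S.eq_empty_or_nonempty with rfl | hSne
  · have : min ((K : ℝ) * #(∅ : Finset Ω) / t) (1 / 4) = 0 := by simp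
    rw [this, mul_zero]
    exact codebookPr_nonneg _
  have hs : (0 : ℝ) < #S := by exact_mod_cast hSne.card_pos
  set s : ℝ := ((#S : ℕ) : ℝ) with hsdef
  set N := min K ⌈t / (4 * s)⌉₊ with hN
  have hNK : N ≤ K := min_le_left _ _
  set J : Finset (Fin M) := (univ : Finset (Fin N)).map (Fin.castLEEmb (by omega : N ≤ M)) with hJ
  have hJc : #J = N := by simp [hJ]
  have hJm : ∀ i ∈ J, i < m := by
    intro i hi
    obtain ⟨j, -, rfl⟩ := Finset.mem_map.1 hi
    rw [Fin.lt_def]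
    simp only [Fin.castLEEmb_apply, Fin.val_castLE]
    omega
  have hpair : ∀ i ∈ J, s * ((1 / t) ^ 2 * (3 / 4)) ≤
      codebookPr T r M (fun c => c m = x ∧ c i ∈ S) := by
    intro i hi
    refine le_trans ?_ (sum_codebookPr_eq_le (T := T) (r := r) (fun c => c m = x) i S)
    rw [hsdef, ← nsmul_eq_mul, ← sum_const]
    refine sum_le_sum fun x' hx' => ?_
    refine le_trans ?_ (codebookPr_eq_pair_ge hT hη1 h hr le_rfl (hJm i hi) hx (hS hx')
      (hrS x' hx'))
    exact mul_le_mul_of_nonneg_left (pair_const hη0 hη) (by positivity)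
  set B := 1 / ((1 - η) * t) with hB
  have hBle : B ≤ 10 / 9 * (1 / t) := one_div_one_sub_mul_le ht hη
  have hB0 : 0 ≤ B := by
    have : 0 < 1 - η := by linarith
    rw [hB]
    positivity
  have htriple : ∀ i ∈ J, ∀ j ∈ J.erase i,
      codebookPr T r M (fun c => c m = x ∧ c i ∈ S ∧ c j ∈ S) ≤ s * B * (s * B * B) := by
    intro i hi j hj
    have hji := (mem_erase.1 hj).1
    have hjm := (hJm j (mem_erase.1 hj).2).ne
    have him := (hJm i hi).ne
    refine le_trans ?_ ((codebookPr_forall_mem_le hT hη1 h le_rfl {i, j, m}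
      (fun k => if k = m then {x} else S)).trans_eq ?_)
    · refine codebookPr_mono fun c _ hE k hk => ?_
      simp only [mem_insert, mem_singleton] at hk
      rcases hk with rfl | rfl | rfl
      · rw [if_neg him]; exact hE.2.1
      · rw [if_neg hjm]; exact hE.2.2
      · simp [hE.1]
    · rw [prod_insert (by simp [hji.symm, him]), prod_pair hjm]
      simp [him, hjm, hB, hsdef, htdef]
  have hbon := codebookPr_bonferroni (T := T) (r := r) J (fun c => c m = x) (fun i c => c i ∈ S)
  have hfin : codebookPr T r M (fun c => c m = x ∧ ∃ i ∈ J, c i ∈ S) ≤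
      codebookPr T r M (fun c => c m = x ∧ ∃ i, i ≠ m ∧ c i ∈ S) :=
    codebookPr_mono fun c _ ⟨h1, i, hi, hiS⟩ => ⟨h1, i, (hJm i hi).ne, hiS⟩
  have h1 : N * (s * ((1 / t) ^ 2 * (3 / 4))) ≤
      ∑ i ∈ J, codebookPr T r M (fun c => c m = x ∧ c i ∈ S) := by
    rw [← hJc, ← nsmul_eq_mul, ← sum_const]
    exact sum_le_sum hpair
  have h2 : ∑ i ∈ J, ∑ j ∈ J.erase i, codebookPr T r M (fun c => c m = x ∧ c i ∈ S ∧ c j ∈ S) ≤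
      N * ((N - 1 : ℕ) * (s * B * (s * B * B))) := by
    rw [← hJc, ← nsmul_eq_mul (#J), ← sum_const]
    refine sum_le_sum fun i hi => ?_
    rw [← card_erase_of_mem hi, ← nsmul_eq_mul, ← sum_const]
    exact sum_le_sum (htriple i hi)
  refine le_trans (bonferroni_arith ht hs hB0 hBle hN) ?_
  linarith

end UnionBounds

/-! ### The ensemble average error probability -/

section Average

variable {A B : Type*} [Fintype A] [DecidableEq A] [Fintype B] [DecidableEq B] {n M : ℕ}

/-- The relation `d(x, x') > Δ` between sequences. -/
def farApart (d : (A × A → ℝ) → ℝ) (Δ : ℝ) (n : ℕ) (x x' : Fin n → A) : Prop :=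
  Δ < d (jointType x x')

theorem jointType_swap (x : Fin n → A) (y : Fin n → B) :
    jointType y x = jointType x y ∘ Prod.swap := by
  ext ⟨b, a⟩
  simp only [jointType, empirical, Function.comp_apply, Prod.swap_prod_mk, Prod.mk.injEq]
  simp_rw [and_comm]

theorem IsDistance.farApart_symm {d : (A × A → ℝ) → ℝ} (hd : IsDistance d) {Δ : ℝ} (hn : 0 < n)
    (x x' : Fin n → A) (h : farApart d Δ n x x') : farApart d Δ n x' x := by
  unfold farApart at *
  rwa [jointType_swap x x', hd.symm (jointType x x') (empirical_mem_stdSimplex hn _)]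

theorem codeProb_eq_seqProb (Q : A → ℝ) (d : (A × A → ℝ) → ℝ) (Δ : ℝ) (c : Fin M → Fin n → A) :
    codeProb Q d Δ c = seqProb (typeClass n Q) (farApart d Δ n) c := by
  unfold codeProb seqProb candidates farApart
  congr!

theorem smallVolume_of_volumeCondition {Q : A → ℝ} {d : (A × A → ℝ) → ℝ} {Δ δ : ℝ}
    (h : VolumeCondition n M Q d Δ δ) :
    SmallVolume (typeClass n Q) (farApart d Δ n) M (Real.exp (-(n * δ))) := by
  intro x hx
  have := h x hx
  rw [Real.exp_neg, ← div_eq_inv_mul, le_div_iff₀ (Real.exp_pos _)]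
  refine le_trans (le_of_eq ?_) this
  simp only [farApart, not_lt]
  ring_nf

theorem sum_codeProb_mul_errorProb (Q : A → ℝ) (d : (A × A → ℝ) → ℝ) (Δ : ℝ) (W : A → B → ℝ)
    (q : (A × B → ℝ) → ℝ) (m : Fin M) :
    ∑ c : Fin M → Fin n → A, codeProb Q d Δ c * errorProb W q c m =
      ∑ x : Fin n → A, ∑ y : Fin n → B, (∏ k, W (x k) (y k)) *
        codebookPr (typeClass n Q) (farApart d Δ n) M
          (fun c => c m = x ∧ ∃ i, i ≠ m ∧ q (jointType x y) ≤ q (jointType (c i) y)) := by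
  classical
  simp_rw [codebookPr, mul_sum]
  have h1 : ∀ x : Fin n → A, (∑ y : Fin n → B, ∑ c : Fin M → Fin n → A, (∏ k, W (x k) (y k)) *
      if c m = x ∧ ∃ i, i ≠ m ∧ q (jointType x y) ≤ q (jointType (c i) y) then
        seqProb (typeClass n Q) (farApart d Δ n) c else 0) = ∑ c : Fin M → Fin n → A, ∑ y : Fin n → B,
      (∏ k, W (x k) (y k)) *
      if c m = x ∧ ∃ i, i ≠ m ∧ q (jointType x y) ≤ q (jointType (c i) y) then
        seqProb (typeClass n Q) (farApart d Δ n) c else 0 := fun x => sum_comm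
  calc _ = ∑ x : Fin n → A, ∑ c : Fin M → Fin n → A, ∑ y : Fin n → B, (∏ k, W (x k) (y k)) *
      (if c m = x ∧ ∃ i, i ≠ m ∧ q (jointType x y) ≤ q (jointType (c i) y) then
        seqProb (typeClass n Q) (farApart d Δ n) c else 0) := by
        rw [sum_comm]
        refine sum_congr rfl fun c _ => ?_
        rw [sum_eq_single (c m)]
        · rw [codeProb_eq_seqProb, errorProb, mul_sum]
          refine sum_congr rfl fun y _ => ?_
          by_cases hex : ∃ i, i ≠ m ∧ q (jointType (c m) y) ≤ q (jointType (c i) y)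
          · rw [if_pos hex, if_pos ⟨rfl, hex⟩, mul_comm]
          · rw [if_neg hex, if_neg fun h => hex h.2]; simp
        · intro x _ hx
          exact sum_eq_zero fun y _ => by rw [if_neg fun h => hx h.1.symm, mul_zero]
        · simp
    _ = _ := by
        simp_rw [← h1]
        congr!

end Average

/-! ### The error probability in terms of joint types -/

section JointTypes

variable {A B : Type*} [Fintype A] [DecidableEq A] [Fintype B] [DecidableEq B] {n M : ℕ}

/-- The constraints on the joint type of `(x, x', y)` under which a codeword `x'` can cause an
error when `x` is sent and `y` is received with positive probability. -/
structure Admissible (Q : A → ℝ) (W : A → B → ℝ) (q : (A × B → ℝ) → ℝ) (d : (A × A → ℝ) → ℝ)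
    (Δ : ℝ) (V : A × A × B → ℝ) : Prop where
  fst : marginal (fun z => z.1) V = Q
  snd : marginal (fun z => z.2.1) V = Q
  metric : q (marginal (fun z => (z.1, z.2.2)) V) ≤ q (marginal (fun z => (z.2.1, z.2.2)) V)
  dist : Δ < d (marginal (fun z => (z.1, z.2.1)) V)
  channel : ∀ x y, W x y = 0 → marginal (fun z => (z.1, z.2.2)) V (x, y) = 0

/-- The number of `x'` such that `(x, x', y)` has joint type `V`. -/
def shellCard (x : Fin n → A) (y : Fin n → B) (V : A × A × B → ℝ) : ℕ :=
  open scoped Classical in #{x' : Fin n → A | empirical (fun k => (x k, x' k, y k)) = V}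

/-- The sequences counted by `shellCard` form a fibre of the projection of the type class of `z`
onto pairs `(x, y)`, and all these fibres have the same size. -/
theorem shellCard_mul_card_typeClass (z : Fin n → A × A × B) {x : Fin n → A} {y : Fin n → B}
    (h : jointType x y = marginal (fun z => (z.1, z.2.2)) (empirical z)) :
    shellCard x y (empirical z) * #(typeClass n (jointType x y)) =
      #(typeClass n (empirical z)) := by
  classical
  rw [← card_fiber_mul_card_typeClass (fun z : A × A × B => (z.1, z.2.2)) z
    (fun k => (x k, y k)) (by rw [← marginal_empirical (fun z : A × A × B => (z.1, z.2.2)) z]; exact h)]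
  refine congrArg₂ _ ?_ rfl
  unfold shellCard
  refine card_bij' (fun x' _ k => (x k, x' k, y k)) (fun z' _ k => (z' k).2.1) ?_ ?_ ?_ ?_
  · intro x' hx'
    simpa [mem_typeClass] using hx'
  · intro z' hz'
    obtain ⟨h1, h2⟩ := mem_filter.1 hz'
    simp only [mem_filter, mem_univ, true_and]
    rw [← mem_typeClass.1 h1]
    congr 1
    ext k : 1
    have := congrFun h2 k
    simp only [Prod.mk.injEq] at this
    rw [← this.1, ← this.2]
  · intro x' _; rfl
  · intro z' hz'
    obtain ⟨h1, h2⟩ := mem_filter.1 hz'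
    ext k : 1
    have := congrFun h2 k
    simp only [Prod.mk.injEq] at this
    simp only [← this.1, ← this.2]

/-- The contribution of the pair `(x, y)` and of the competing codewords of joint type `V`. -/
def shellTerm (M : ℕ) (Q : A → ℝ) (W : A → B → ℝ) (V : A × A × B → ℝ) (x : Fin n → A)
    (y : Fin n → B) : ℝ :=
  (∏ k, W (x k) (y k)) *
    (1 / (#(typeClass n Q) : ℝ) * min 1 (M * (shellCard x y V : ℝ) / #(typeClass n Q)))

theorem shellTerm_nonneg {W : A → B → ℝ} (hW : ∀ x y, 0 ≤ W x y) (M : ℕ) (Q : A → ℝ)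
    (V : A × A × B → ℝ) (x : Fin n → A) (y : Fin n → B) : 0 ≤ shellTerm M Q W V x y := by
  unfold shellTerm
  have : 0 ≤ ∏ k, W (x k) (y k) := prod_nonneg fun k _ => hW _ _
  positivity

/-- The contribution of the joint type `V` to the error probability. -/
def typeTerm (n M : ℕ) (Q : A → ℝ) (W : A → B → ℝ) (V : A × A × B → ℝ) : ℝ :=
  open scoped Classical in
  ∑ x : Fin n → A, ∑ y : Fin n → B,
    if jointType x y = marginal (fun z => (z.1, z.2.2)) V then shellTerm M Q W V x y else 0

/-- Lets the clipped union bound be split over joint types, so that each type is estimated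
separately. -/
theorem min_one_sum_le {ι : Type*} (s : Finset ι) {a : ι → ℝ} (ha : ∀ i ∈ s, 0 ≤ a i) :
    min 1 (∑ i ∈ s, a i) ≤ ∑ i ∈ s, min 1 (a i) := by
  by_cases h : ∃ i ∈ s, 1 ≤ a i
  · obtain ⟨i, hi, h1⟩ := h
    refine (min_le_left _ _).trans ?_
    have := single_le_sum (f := fun i => min 1 (a i))
      (fun j hj => le_min zero_le_one (ha j hj)) hi
    simpa [h1] using this
  · push Not at h
    refine (min_le_right _ _).trans (sum_le_sum fun i hi => ?_)
    rw [min_eq_right (h i hi).le]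

theorem mem_typeClass_of_marginal {Q : A → ℝ} {x : Fin n → A} {C : Type*} [Fintype C]
    [DecidableEq C] {z : Fin n → C} {f : C → A} (hf : ∀ k, f (z k) = x k)
    (h : marginal f (empirical z) = Q) : x ∈ typeClass n Q := by
  rw [mem_typeClass, ← h, marginal_empirical]
  congr 1
  ext k
  exact (hf k).symm

/-- The competitors that can cause an error lie in the shells of admissible joint types. The factor
`4` comes from `1/(1-η) ≤ 2`, used once outside the minimum and once inside. -/
theorem avgErrorProb_le {Q : A → ℝ} (hQ : (typeClass n Q).Nonempty) {W : A → B → ℝ}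
    (hW : ∀ x y, 0 ≤ W x y) (q : (A × B → ℝ) → ℝ) {d : (A × A → ℝ) → ℝ} (hd : IsDistance d)
    {Δ η : ℝ} (hn : 0 < n) (hη : η ≤ 1 / 10)
    (h : SmallVolume (typeClass n Q) (farApart d Δ n) M η) :
    avgErrorProb n M Q W q d Δ ≤
      open scoped Classical in
      ∑ V ∈ (types (A × A × B) n).filter (Admissible Q W q d Δ), 4 * typeTerm n M Q W V := by
  classical
  have hη1 : η < 1 := by linarith
  have ht : (0 : ℝ) < #(typeClass n Q) := by exact_mod_cast hQ.card_pos
  set t : ℝ := ((#(typeClass n Q) : ℕ) : ℝ) with htdef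
  set adm := (types (A × A × B) n).filter (Admissible Q W q d Δ) with hadm
  have key : ∀ (m : Fin M) (x : Fin n → A) (y : Fin n → B),
      (∏ k, W (x k) (y k)) * codebookPr (typeClass n Q) (farApart d Δ n) M
          (fun c => c m = x ∧ ∃ i, i ≠ m ∧ q (jointType x y) ≤ q (jointType (c i) y)) ≤
        ∑ V ∈ adm, if jointType x y = marginal (fun z => (z.1, z.2.2)) V
          then 4 * shellTerm M Q W V x y else 0 := by
    intro m x y
    have hRHS : 0 ≤ ∑ V ∈ adm, if jointType x y = marginal (fun z => (z.1, z.2.2)) V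
          then 4 * shellTerm M Q W V x y else 0 :=
      sum_nonneg fun V _ => by
        have := shellTerm_nonneg hW M Q V x y
        positivity
    by_cases h0 : ∏ k, W (x k) (y k) = 0
    · rw [h0, zero_mul]; exact hRHS
    by_cases hx : x ∈ typeClass n Q
    swap
    · refine le_trans (le_of_eq ?_) hRHS
      rw [mul_eq_zero]
      right
      refine sum_eq_zero fun c _ => ?_
      by_cases hc : seqProb (typeClass n Q) (farApart d Δ n) c = 0
      · simp [hc]
      · refine if_neg fun hE => hx ?_
        rw [← hE.1]
        exact mem_of_seqProb_ne_zero _ _ hc m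
    set S : Finset (Fin n → A) := (typeClass n Q).filter fun x' =>
      farApart d Δ n x x' ∧ q (jointType x y) ≤ q (jointType x' y) with hS
    have h1 : codebookPr (typeClass n Q) (farApart d Δ n) M
          (fun c => c m = x ∧ ∃ i, i ≠ m ∧ q (jointType x y) ≤ q (jointType (c i) y)) ≤
        codebookPr (typeClass n Q) (farApart d Δ n) M
          (fun c => c m = x ∧ ∃ i, i ≠ m ∧ c i ∈ S) := by
      refine codebookPr_mono fun c hc hE => ?_
      obtain ⟨hm, i, hi, hq⟩ := hE
      refine ⟨hm, i, hi, mem_filter.2 ⟨mem_of_seqProb_ne_zero _ _ hc i, ?_, hq⟩⟩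
      rcases lt_or_gt_of_ne hi with hlt | hlt
      · rw [← hm]; exact rel_of_seqProb_ne_zero _ _ hc hlt
      · rw [← hm]; exact hd.farApart_symm hn _ _ (rel_of_seqProb_ne_zero _ _ hc hlt)
    have h2 := codebookPr_union_le hQ hη1 h m x S
    have hB := one_div_one_sub_mul_le ht hη
    have hB0 : 0 ≤ 1 / ((1 - η) * t) := by
      have : 0 < 1 - η := by linarith
      positivity
    have h3 : 1 / ((1 - η) * t) * min 1 (M * #S * (1 / ((1 - η) * t))) ≤
        4 * (1 / t * min 1 (M * #S / t)) := by
      calc 1 / ((1 - η) * t) * min 1 (M * #S * (1 / ((1 - η) * t)))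
          ≤ 2 * (1 / t) * min 1 (M * #S * (2 * (1 / t))) := by
            have hB2 : 1 / ((1 - η) * t) ≤ 2 * (1 / t) :=
              hB.trans (by gcongr; norm_num)
            gcongr
        _ ≤ 2 * (1 / t) * (2 * min 1 (M * #S / t)) := by
            gcongr
            rw [mul_min_of_nonneg _ _ zero_le_two]
            refine min_le_min (by norm_num) (le_of_eq (by ring))
        _ = _ := by ring
    have hcard : #S ≤ ∑ V ∈ adm.filter fun V => jointType x y = marginal (fun z => (z.1, z.2.2)) V,
        shellCard x y V := by
      refine le_trans (card_le_card ?_) card_biUnion_le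
      intro x' hx'
      obtain ⟨hx'T, hfar, hq⟩ := mem_filter.1 hx'
      have m1 : marginal (fun z => (z.1, z.2.2)) (empirical fun k => (x k, x' k, y k)) =
        jointType x y := by rw [marginal_empirical]; rfl
      refine mem_biUnion.2 ⟨empirical fun k => (x k, x' k, y k), ?_, by simp⟩
      refine mem_filter.2 ⟨mem_filter.2 ⟨mem_types.2 ⟨_, rfl⟩, ?_⟩, m1.symm⟩
      refine ⟨?_, ?_, ?_, ?_, ?_⟩
      · rw [marginal_empirical]; exact mem_typeClass.1 hx
      · rw [marginal_empirical]; exact mem_typeClass.1 hx'T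
      · rw [m1, marginal_empirical]; exact hq
      · rw [marginal_empirical]; exact hfar
      -- The product of channel probabilities is nonzero here, so no forbidden pair of letters
      -- occurs in `(x, y)`.
      · intro a b hab
        rw [m1, jointType, empirical_apply, letterCount, filter_eq_empty_iff.2]
        · simp
        · intro k _ hk
          simp only [Prod.mk.injEq] at hk
          exact prod_ne_zero_iff.1 h0 k (mem_univ k) (by rw [hk.1, hk.2, hab])
    have hp : 0 ≤ ∏ k, W (x k) (y k) := prod_nonneg fun k _ => hW _ _
    calc _ ≤ (∏ k, W (x k) (y k)) * (4 * (1 / t * min 1 (M * #S / t))) := by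
          gcongr
          exact h1.trans (h2.trans h3)
      _ ≤ (∏ k, W (x k) (y k)) * (4 * (1 / t * ∑ V ∈ adm.filter fun V =>
          jointType x y = marginal (fun z => (z.1, z.2.2)) V,
            min 1 (M * (shellCard x y V : ℝ) / t))) := by
          gcongr
          refine le_trans ?_ (min_one_sum_le _ fun V _ => by positivity)
          refine min_le_min le_rfl ?_
          rw [← sum_div, ← mul_sum]
          gcongr
          exact_mod_cast hcard
      _ = _ := by
          rw [mul_sum, mul_sum, mul_sum, sum_filter]
          refine sum_congr rfl fun V _ => ?_
          unfold shellTerm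
          split_ifs <;> ring
  have h5 : ∀ m : Fin M, ∑ c : Fin M → Fin n → A, codeProb Q d Δ c * errorProb W q c m ≤
      ∑ V ∈ adm, 4 * typeTerm n M Q W V := by
    intro m
    rw [sum_codeProb_mul_errorProb]
    refine (sum_le_sum fun x _ => sum_le_sum fun y _ => key m x y).trans (le_of_eq ?_)
    simp_rw [sum_comm (s := (univ : Finset (Fin n → B)))]
    rw [sum_comm]
    refine sum_congr rfl fun V _ => ?_
    rw [typeTerm, mul_sum]
    refine sum_congr rfl fun x _ => ?_
    rw [mul_sum]
    refine sum_congr rfl fun y _ => ?_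
    split_ifs <;> ring
  have h6 : 0 ≤ ∑ V ∈ adm, 4 * typeTerm n M Q W V :=
    sum_nonneg fun V _ => mul_nonneg (by norm_num) <| sum_nonneg fun x _ => sum_nonneg fun y _ => by
      have := shellTerm_nonneg hW M Q V x y
      positivity
  unfold avgErrorProb
  calc _ ≤ 1 / (M : ℝ) * ∑ _m : Fin M, ∑ V ∈ adm, 4 * typeTerm n M Q W V := by
        gcongr with m
        exact h5 m
    _ = ((M : ℝ) / M) * ∑ V ∈ adm, 4 * typeTerm n M Q W V := by
        rw [sum_const, card_univ, Fintype.card_fin, nsmul_eq_mul]; ring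
    _ ≤ _ := mul_le_of_le_one_left h6 (div_self_le_one _)

/-- A single shell of competitors already gives the bound. The messages in the second half have
enough earlier codewords; restricting to them costs `1/2`, and the per-message estimate costs `1/8`.
-/
theorem le_avgErrorProb {Q : A → ℝ} {W : A → B → ℝ}
    (hW : ∀ x y, 0 ≤ W x y) {q : (A × B → ℝ) → ℝ} {d : (A × A → ℝ) → ℝ} (hd : IsDistance d)
    {Δ η : ℝ} (hn : 0 < n) (hM : 2 ≤ M) (hη0 : 0 ≤ η) (hη : η ≤ 1 / 10)
    (h : SmallVolume (typeClass n Q) (farApart d Δ n) M η) {V : A × A × B → ℝ}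
    (hV : V ∈ types (A × A × B) n) (hadm : Admissible Q W q d Δ V) :
    1 / 16 * typeTerm n M Q W V ≤ avgErrorProb n M Q W q d Δ := by
  classical
  obtain ⟨z, rfl⟩ := mem_types.1 hV
  have hQ : (typeClass n Q).Nonempty :=
    ⟨fun k => (z k).1, mem_typeClass_of_marginal (fun _ => rfl) hadm.fst⟩
  have ht : (0 : ℝ) < #(typeClass n Q) := by exact_mod_cast hQ.card_pos
  set t : ℝ := ((#(typeClass n Q) : ℕ) : ℝ) with htdef
  have key : ∀ (m : Fin M) (_ : M / 2 ≤ m) (x : Fin n → A) (y : Fin n → B),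
      (if jointType x y = marginal (fun z => (z.1, z.2.2)) (empirical z)
          then 1 / 8 * shellTerm M Q W (empirical z) x y else 0) ≤
      (∏ k, W (x k) (y k)) * codebookPr (typeClass n Q) (farApart d Δ n) M
          (fun c => c m = x ∧ ∃ i, i ≠ m ∧ q (jointType x y) ≤ q (jointType (c i) y)) := by
    intro m hm x y
    have hp : 0 ≤ ∏ k, W (x k) (y k) := prod_nonneg fun k _ => hW _ _
    split_ifs with hxy
    swap
    · exact mul_nonneg hp (codebookPr_nonneg _)
    set S : Finset (Fin n → A) :=
      {x' : Fin n → A | empirical (fun k => (x k, x' k, y k)) = empirical z} with hS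
    have hSc : shellCard x y (empirical z) = #S := rfl
    have hxT : x ∈ typeClass n Q := by
      refine mem_typeClass_of_marginal (z := fun k => (x k, y k)) (f := Prod.fst)
        (fun _ => rfl) ?_
      have : marginal Prod.fst (jointType x y) = Q := by
        rw [hxy, marginal_marginal, ← hadm.fst]
      exact this
    have hST : S ⊆ typeClass n Q := by
      intro x' hx'
      refine mem_typeClass_of_marginal (z := fun k => (x k, x' k, y k)) (f := fun z => z.2.1)
        (fun _ => rfl) ?_
      rw [(mem_filter.1 hx').2, hadm.snd]
    have hSfar : ∀ x' ∈ S, farApart d Δ n x x' := by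
      intro x' hx'
      have := hadm.dist
      rw [← (mem_filter.1 hx').2, marginal_empirical] at this
      exact this
    have hSq : ∀ x' ∈ S, q (jointType x y) ≤ q (jointType x' y) := by
      intro x' hx'
      have := hadm.metric
      rw [← (mem_filter.1 hx').2, marginal_empirical, marginal_empirical] at this
      exact this
    have h1 := le_codebookPr_union hQ hη0 hη h (hd.farApart_symm hn) m hm hxT hST hSfar
    have h2 : codebookPr (typeClass n Q) (farApart d Δ n) M
          (fun c => c m = x ∧ ∃ i, i ≠ m ∧ c i ∈ S) ≤
        codebookPr (typeClass n Q) (farApart d Δ n) M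
          (fun c => c m = x ∧ ∃ i, i ≠ m ∧ q (jointType x y) ≤ q (jointType (c i) y)) :=
      codebookPr_mono fun c _ ⟨hm, i, hi, hiS⟩ => ⟨hm, i, hi, hSq _ hiS⟩
    -- Here `M / 2` is a floor; `2 ≤ M` excludes the case where it vanishes.
    have hM3 : (M : ℝ) / 4 ≤ (M / 2 : ℕ) := by
      have : M ≤ 4 * (M / 2) := by omega
      have : (M : ℝ) ≤ 4 * (M / 2 : ℕ) := by exact_mod_cast this
      linarith
    have h3 : 1 / 8 * (1 / t * min 1 (M * (#S : ℝ) / t)) ≤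
        1 / (2 * t) * min (((M / 2 : ℕ) : ℝ) * #S / t) (1 / 4) := by
      calc 1 / 8 * (1 / t * min 1 (M * (#S : ℝ) / t))
          = 1 / (2 * t) * (1 / 4 * min 1 (M * (#S : ℝ) / t)) := by field_simp; ring
        _ ≤ 1 / (2 * t) * min (((M / 2 : ℕ) : ℝ) * #S / t) (1 / 4) := by
          gcongr
          rw [mul_min_of_nonneg _ _ (by norm_num), min_comm, mul_one]
          refine min_le_min ?_ le_rfl
          calc 1 / 4 * (M * (#S : ℝ) / t) = (M : ℝ) / 4 * #S / t := by ring
            _ ≤ _ := by gcongr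
    calc 1 / 8 * shellTerm M Q W (empirical z) x y
        = (∏ k, W (x k) (y k)) * (1 / 8 * (1 / t * min 1 (M * (#S : ℝ) / t))) := by
          rw [shellTerm, hSc]; ring
      _ ≤ _ := by
          gcongr
          exact h3.trans (h1.trans h2)
  have h5 : ∀ m : Fin M, M / 2 ≤ m → 1 / 8 * typeTerm n M Q W (empirical z) ≤
      ∑ c : Fin M → Fin n → A, codeProb Q d Δ c * errorProb W q c m := by
    intro m hm
    rw [sum_codeProb_mul_errorProb, typeTerm, mul_sum]
    refine sum_le_sum fun x _ => ?_
    rw [mul_sum]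
    refine sum_le_sum fun y _ => ?_
    refine le_trans (le_of_eq ?_) (key m hm x y)
    split_ifs <;> ring
  have hnn : 0 ≤ typeTerm n M Q W (empirical z) :=
    sum_nonneg fun x _ => sum_nonneg fun y _ => by
      have := shellTerm_nonneg hW M Q (empirical z) x y
      positivity
  have hcount : (M : ℝ) / 2 ≤ #{m : Fin M | M / 2 ≤ (m : ℕ)} := by
    have h7 : M - M / 2 ≤ #{m : Fin M | M / 2 ≤ (m : ℕ)} := by
      have : #((univ : Finset (Fin (M - M / 2))).map
        ⟨fun j : Fin (M - M / 2) => (⟨M / 2 + j, by omega⟩ : Fin M), fun a b hab => by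
          simp only [Fin.mk.injEq] at hab; omega⟩) = M - M / 2 := by simp
      rw [← this]
      refine card_le_card fun m hm => ?_
      obtain ⟨j, -, rfl⟩ := Finset.mem_map.1 hm
      exact mem_filter.2 ⟨mem_univ _, Nat.le_add_right _ _⟩
    have h8 : M ≤ 2 * #{m : Fin M | M / 2 ≤ (m : ℕ)} := by omega
    have : (M : ℝ) ≤ 2 * #{m : Fin M | M / 2 ≤ (m : ℕ)} := by exact_mod_cast h8
    linarith
  unfold avgErrorProb
  have hM0 : (0 : ℝ) < M := by exact_mod_cast (by omega : 0 < M)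
  calc 1 / 16 * typeTerm n M Q W (empirical z)
      = 1 / (M : ℝ) * ((M : ℝ) / 2 * (1 / 8 * typeTerm n M Q W (empirical z))) := by
        field_simp; ring
    _ ≤ 1 / (M : ℝ) * (#{m : Fin M | M / 2 ≤ (m : ℕ)} *
          (1 / 8 * typeTerm n M Q W (empirical z))) := by gcongr
    _ = 1 / (M : ℝ) * ∑ m with M / 2 ≤ (m : Fin M).val,
          1 / 8 * typeTerm n M Q W (empirical z) := by
        rw [sum_const, nsmul_eq_mul]
    _ ≤ 1 / (M : ℝ) * ∑ m with M / 2 ≤ (m : Fin M).val,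
          ∑ c : Fin M → Fin n → A, codeProb Q d Δ c * errorProb W q c m := by
        gcongr with m hm
        exact h5 m (mem_filter.1 hm).2
    _ ≤ _ := by
        refine mul_le_mul_of_nonneg_left (sum_le_sum_of_subset_of_nonneg (filter_subset _ _)
          fun m _ _ => ?_) (by positivity)
        rw [sum_codeProb_mul_errorProb]
        exact sum_nonneg fun x _ => sum_nonneg fun y _ =>
          mul_nonneg (prod_nonneg fun k _ => hW _ _) (codebookPr_nonneg _)

end JointTypes

/-! ### Exponential size of the contribution of a joint type -/

section Cost

variable {A B : Type*} [Fintype A] [DecidableEq A] [Fintype B] [DecidableEq B] {n M : ℕ}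

/-- The mutual information `I(X̃; Y, X)` under a joint distribution of `(X, X̃, Y)`, in terms of
entropies. -/
def tripleInfo (V : A × A × B → ℝ) : ℝ :=
  entropy (marginal (fun z => z.2.1) V) + entropy (marginal (fun z => (z.1, z.2.2)) V) - entropy V

/-- The objective function of the exponent, for `V` supported on the support of the channel. -/
def cost (W : A → B → ℝ) (R : ℝ) (V : A × A × B → ℝ) : ℝ :=
  condDivReal (marginal (fun z => (z.1, z.2.2)) V) W + max (tripleInfo V - R) 0

theorem entropy_marginal_equiv {C D : Type*} [Fintype C] [Fintype D] [DecidableEq D] (e : C ≃ D)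
    (V : C → ℝ) : entropy (marginal e V) = entropy V := by
  unfold entropy
  rw [← e.sum_comp]
  refine sum_congr rfl fun c _ => ?_
  congr 1
  rw [marginal, sum_filter, sum_eq_single c] <;> simp +contextual

theorem mutualInfo_marginal_eq_tripleInfo {V : A × A × B → ℝ} (hV : ∀ z, 0 ≤ V z) :
    mutualInfo (marginal (fun z => (z.2.1, (z.2.2, z.1))) V) = tripleInfo V := by
  rw [mutualInfo_eq_entropy (marginal_nonneg _ hV), marginal_marginal, marginal_marginal,
    tripleInfo]
  refine congrArg₂ _ (congrArg₂ _ rfl ?_) ?_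
  · have := entropy_marginal_equiv (Equiv.prodComm A B) (marginal (fun z => (z.1, z.2.2)) V)
    rw [← this, marginal_marginal]
    rfl
  · let e : A × A × B ≃ A × B × A :=
      ⟨fun z => (z.2.1, (z.2.2, z.1)), fun z => (z.2.2, z.1, z.2.1), fun _ => rfl, fun _ => rfl⟩
    exact entropy_marginal_equiv e V

theorem continuous_condDivReal (W : A → B → ℝ) : Continuous fun V => condDivReal V W := by
  unfold condDivReal
  refine (((continuous_entropy.comp (continuous_marginal _))).sub continuous_entropy).sub ?_
  fun_prop

theorem continuous_tripleInfo : Continuous (tripleInfo : (A × A × B → ℝ) → ℝ) := by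
  unfold tripleInfo
  exact ((continuous_entropy.comp (continuous_marginal _)).add
    (continuous_entropy.comp (continuous_marginal _))).sub continuous_entropy

theorem continuous_cost (W : A → B → ℝ) :
    Continuous fun p : ℝ × (A × A × B → ℝ) => cost W p.1 p.2 := by
  unfold cost
  refine Continuous.add ?_ ?_
  · exact (continuous_condDivReal W).comp ((continuous_marginal _).comp continuous_snd)
  · exact ((continuous_tripleInfo.comp continuous_snd).sub continuous_fst).max continuous_const

theorem condDiv_add_eq_cost {V : A × A × B → ℝ} {W : A → B → ℝ} (R : ℝ) (hV : ∀ z, 0 ≤ V z)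
    (h : ∀ x y, W x y = 0 → marginal (fun z => (z.1, z.2.2)) V (x, y) = 0) :
    condDiv (marginal (fun z => (z.1, z.2.2)) V) W +
      ((max (mutualInfo (marginal (fun z => (z.2.1, (z.2.2, z.1))) V) - R) 0 : ℝ) : EReal) =
      (cost W R V : EReal) := by
  rw [condDiv_eq_condDivReal (marginal_nonneg _ hV) h, mutualInfo_marginal_eq_tripleInfo hV,
    ← EReal.coe_add]
  rfl

theorem sum_comp_eq_sum_empirical {C : Type*} [Fintype C] [DecidableEq C] (x : Fin n → C)
    (g : C → ℝ) : ∑ k, g (x k) = n * ∑ a, empirical x a * g a := by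
  rw [mul_sum]
  simp_rw [← mul_assoc, natCast_mul_empirical]
  rw [← sum_fiberwise univ x (fun k => g (x k))]
  refine sum_congr rfl fun a _ => ?_
  rw [sum_congr rfl (g := fun _ => g a) fun k hk => by rw [(mem_filter.1 hk).2], sum_const,
    nsmul_eq_mul]
  rfl

theorem prod_channel_eq_exp {W : A → B → ℝ} (hW : ∀ x y, 0 ≤ W x y) (x : Fin n → A)
    (y : Fin n → B) (h : ∀ a b, W a b = 0 → jointType x y (a, b) = 0) :
    ∏ k, W (x k) (y k) = Real.exp (n * ∑ z, jointType x y z * Real.log (W z.1 z.2)) := by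
  rw [jointType, ← sum_comp_eq_sum_empirical (fun k => (x k, y k))
    (fun z => Real.log (W z.1 z.2)), Real.exp_sum]
  refine prod_congr rfl fun k _ => (Real.exp_log ((hW _ _).lt_of_ne' fun h0 => ?_)).symm
  have h1 := h _ _ h0
  have hn : 0 < n := k.pos
  rw [jointType, empirical_apply, div_eq_zero_iff] at h1
  rcases h1 with h1 | h1
  · have : letterCount (fun k => (x k, y k)) (x k, y k) = 0 := by exact_mod_cast h1
    rw [letterCount, card_eq_zero, filter_eq_empty_iff] at this
    exact this (mem_univ k) rfl
  · have : n = 0 := by exact_mod_cast h1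
    omega

/-- The channel probability and the shell size depend on `(x, y)` only through the joint type, so
all pairs of that type contribute equally and it remains to count them. -/
theorem typeTerm_eq {Q : A → ℝ} {W : A → B → ℝ} (hW : ∀ x y, 0 ≤ W x y)
    (z : Fin n → A × A × B)
    (h : ∀ x y, W x y = 0 → marginal (fun z => (z.1, z.2.2)) (empirical z) (x, y) = 0) :
    typeTerm n M Q W (empirical z) =
      #(typeClass n (marginal (fun z => (z.1, z.2.2)) (empirical z))) *
        (Real.exp (n * ∑ w, marginal (fun z => (z.1, z.2.2)) (empirical z) w *
            Real.log (W w.1 w.2)) *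
          (1 / (#(typeClass n Q) : ℝ) * min 1 ((M : ℝ) * #(typeClass n (empirical z)) /
            (#(typeClass n (marginal (fun z => (z.1, z.2.2)) (empirical z))) *
              #(typeClass n Q))))) := by
  classical
  set U := marginal (fun z => (z.1, z.2.2)) (empirical z) with hU
  have h1 : ∀ (x : Fin n → A) (y : Fin n → B),
      (if jointType x y = U then shellTerm M Q W (empirical z) x y else 0) =
      if jointType x y = U then Real.exp (n * ∑ w, U w * Real.log (W w.1 w.2)) *
          (1 / (#(typeClass n Q) : ℝ) * min 1 ((M : ℝ) * #(typeClass n (empirical z)) /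
            (#(typeClass n U) * #(typeClass n Q)))) else 0 := by
    intro x y
    split_ifs with hxy
    · have hs := shellCard_mul_card_typeClass z hxy
      rw [hxy] at hs
      have hpos : (0 : ℝ) < #(typeClass n U) := by
        exact_mod_cast card_pos.2 ⟨fun k => (x k, y k), mem_typeClass.2 hxy⟩
      rw [shellTerm, prod_channel_eq_exp hW x y (by rw [hxy]; exact h), hxy]
      congr 3
      rw [← hs]
      push_cast
      rw [← mul_assoc, mul_comm _ (#(typeClass n U) : ℝ), mul_div_mul_left _ _ hpos.ne']
    · rfl
  rw [typeTerm]
  simp_rw [← hU, h1]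
  rw [← Fintype.sum_prod_type', ← (Equiv.arrowProdEquivProdArrow (Fin n) (fun _ => A)
    (fun _ => B)).sum_comp]
  rw [← sum_filter, sum_const, nsmul_eq_mul]
  congr 3

/-- Replacing type class sizes by exponentials of entropies costs one `p` per replacement: one for
`T₁`, one for `1/t`, and three inside the minimum. -/
theorem typeTerm_bounds {t T₁ T₂ p N R hQ h₁ h₂ l : ℝ} (hp : 1 ≤ p) (ht : 0 < t) (hT₁ : 0 < T₁)
    (hT₂ : 0 < T₂)
    (ht1 : t ≤ p * Real.exp (N * hQ)) (ht2 : Real.exp (N * hQ) ≤ p * t)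
    (hT₁1 : T₁ ≤ p * Real.exp (N * h₁)) (hT₁2 : Real.exp (N * h₁) ≤ p * T₁)
    (hT₂1 : T₂ ≤ p * Real.exp (N * h₂)) (hT₂2 : Real.exp (N * h₂) ≤ p * T₂) (hN : 0 ≤ N) :
    T₁ * (Real.exp (N * l) * (1 / t * min 1 (Real.exp (N * R) * T₂ / (T₁ * t)))) ≤
        p ^ 5 * Real.exp (-(N * (hQ - h₁ - l + max (hQ + h₁ - h₂ - R) 0))) ∧
    Real.exp (-(N * (hQ - h₁ - l + max (hQ + h₁ - h₂ - R) 0))) ≤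
      p ^ 5 * (T₁ * (Real.exp (N * l) * (1 / t * min 1 (Real.exp (N * R) * T₂ / (T₁ * t))))) := by
  have hp0 : 0 < p := by linarith
  have hmin : min 1 (Real.exp (N * R) * Real.exp (N * h₂) / (Real.exp (N * h₁) * Real.exp (N * hQ)))
      = Real.exp (-(N * max (hQ + h₁ - h₂ - R) 0)) := by
    rw [← Real.exp_add, ← Real.exp_add, ← Real.exp_sub, mul_max_of_nonneg _ _ hN, mul_zero,
      ← min_neg_neg, neg_zero, Real.exp_monotone.map_min, Real.exp_zero, min_comm]
    congr 2
    ring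
  have hexp : Real.exp (-(N * (hQ - h₁ - l + max (hQ + h₁ - h₂ - R) 0))) =
      Real.exp (N * h₁) * (Real.exp (N * l) * (1 / Real.exp (N * hQ) *
        min 1 (Real.exp (N * R) * Real.exp (N * h₂) /
          (Real.exp (N * h₁) * Real.exp (N * hQ))))) := by
    rw [hmin, one_div, ← Real.exp_neg, ← Real.exp_add, ← Real.exp_add, ← Real.exp_add]
    congr 1
    ring
  rw [hexp]
  set a := Real.exp (N * h₁)
  set b := Real.exp (N * hQ)
  set c := Real.exp (N * h₂)
  set e := Real.exp (N * l)
  set M := Real.exp (N * R)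
  have ha : 0 < a := Real.exp_pos _
  have hb : 0 < b := Real.exp_pos _
  have hc : 0 < c := Real.exp_pos _
  have he : 0 < e := Real.exp_pos _
  have hM : 0 < M := Real.exp_pos _
  have hp3 : 1 ≤ p ^ 3 := one_le_pow₀ hp
  have it : 1 / t ≤ p * (1 / b) := by
    rw [mul_one_div, div_le_div_iff₀ ht hb]; linarith
  have ib : 1 / b ≤ p * (1 / t) := by
    rw [mul_one_div, div_le_div_iff₀ hb ht]; linarith
  have iT : 1 / T₁ ≤ p * (1 / a) := by
    rw [mul_one_div, div_le_div_iff₀ hT₁ ha]; linarith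
  have ia : 1 / a ≤ p * (1 / T₁) := by
    rw [mul_one_div, div_le_div_iff₀ ha hT₁]; linarith
  have m1 : min 1 (M * T₂ / (T₁ * t)) ≤ p ^ 3 * min 1 (M * c / (a * b)) := by
    rw [mul_min_of_nonneg _ _ (by positivity), mul_one]
    refine min_le_min hp3 ?_
    calc M * T₂ / (T₁ * t) = M * T₂ * (1 / T₁) * (1 / t) := by field_simp
      _ ≤ M * (p * c) * (p * (1 / a)) * (p * (1 / b)) := by gcongr
      _ = _ := by field_simp
  have m2 : min 1 (M * c / (a * b)) ≤ p ^ 3 * min 1 (M * T₂ / (T₁ * t)) := by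
    rw [mul_min_of_nonneg _ _ (by positivity), mul_one]
    refine min_le_min hp3 ?_
    calc M * c / (a * b) = M * c * (1 / a) * (1 / b) := by field_simp
      _ ≤ M * (p * T₂) * (p * (1 / T₁)) * (p * (1 / t)) := by gcongr
      _ = _ := by field_simp
  constructor
  · calc T₁ * (e * (1 / t * min 1 (M * T₂ / (T₁ * t))))
        ≤ (p * a) * (e * ((p * (1 / b)) * (p ^ 3 * min 1 (M * c / (a * b))))) := by gcongr
      _ = _ := by ring
  · calc a * (e * (1 / b * min 1 (M * c / (a * b))))
        ≤ (p * T₁) * (e * ((p * (1 / t)) * (p ^ 3 * min 1 (M * T₂ / (T₁ * t))))) := by gcongr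
      _ = _ := by ring

/-- A polynomial in `n` that dominates all the polynomial factors of the method of types. -/
def polyFactor (A B : Type*) [Fintype A] [Fintype B] (n : ℕ) : ℝ :=
  (3 * ((n : ℝ) + 1)) ^
    (1 + Fintype.card A + Fintype.card (A × B) + Fintype.card (A × A × B) + Fintype.card (A × A))

theorem one_le_polyFactor (n : ℕ) : 1 ≤ polyFactor A B n :=
  one_le_pow₀ (by have : (0 : ℝ) ≤ n := n.cast_nonneg
                  linarith)

theorem card_typeClass_le_polyFactor {C : Type*} [Fintype C] [DecidableEq C] (hn : 0 < n)
    (x : Fin n → C) :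
    (#(typeClass n (empirical x)) : ℝ) ≤
      polyFactor A B n * Real.exp (n * entropy (empirical x)) := by
  refine (card_typeClass_le hn x).trans ?_
  gcongr
  refine le_self_pow₀ ?_ (by omega)
  have : (0 : ℝ) ≤ n := n.cast_nonneg
  linarith

theorem exp_entropy_le_polyFactor {C : Type*} [Fintype C] [DecidableEq C] (hn : 0 < n)
    (hC : Fintype.card C ≤ 1 + Fintype.card A + Fintype.card (A × B) +
      Fintype.card (A × A × B) + Fintype.card (A × A))
    (x : Fin n → C) :
    Real.exp (n * entropy (empirical x)) ≤
      polyFactor A B n * #(typeClass n (empirical x)) := by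
  refine (exp_entropy_le hn x).trans ?_
  have : (0 : ℝ) ≤ n := n.cast_nonneg
  unfold polyFactor
  gcongr
  linarith

theorem eventually_polyFactor_le (A B : Type*) [Fintype A] [Fintype B] (c : ℝ) (k : ℕ) {η : ℝ}
    (hη : 0 < η) :
    ∀ᶠ n : ℕ in atTop, c * polyFactor A B n ^ k ≤ Real.exp (n * η) := by
  unfold polyFactor
  simp_rw [← pow_mul]
  generalize (1 + Fintype.card A + Fintype.card (A × B) + Fintype.card (A × A × B) +
    Fintype.card (A × A)) * k = D
  have h1 : Tendsto (fun x : ℝ => Real.exp (η * x) / x ^ D) atTop atTop := by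
    exact tendsto_exp_mul_div_rpow_atTop D η hη |>.congr fun x => by rw [Real.rpow_natCast]
  have h2 : Tendsto (fun n : ℕ => (n : ℝ) + 1) atTop atTop :=
    tendsto_atTop_add_const_right _ _ tendsto_natCast_atTop_atTop
  filter_upwards [(h1.comp h2).eventually_ge_atTop (|c| * 3 ^ D * Real.exp η)] with n hn
  simp only [Function.comp_apply] at hn
  rw [le_div_iff₀ (by positivity), mul_add, Real.exp_add, mul_one, mul_right_comm] at hn
  have := le_of_mul_le_mul_right hn (Real.exp_pos η)
  calc c * (3 * ((n : ℝ) + 1)) ^ D ≤ |c| * (3 * ((n : ℝ) + 1)) ^ D := by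
        gcongr; exact le_abs_self c
    _ = |c| * 3 ^ D * ((n : ℝ) + 1) ^ D := by rw [mul_pow]; ring
    _ ≤ _ := by rwa [mul_comm (n : ℝ)]

theorem exp_natCast_mul_log_div (hn : 0 < n) (hM : 0 < M) :
    Real.exp (n * (Real.log M / n)) = M := by
  have : (n : ℝ) ≠ 0 := by positivity
  rw [mul_div_cancel₀ _ this, Real.exp_log (by exact_mod_cast hM)]

theorem card_typeClass_empirical_pos {C : Type*} [Fintype C] [DecidableEq C] (x : Fin n → C) :
    (0 : ℝ) < #(typeClass n (empirical x)) := by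
  exact_mod_cast card_pos.2 ⟨x, mem_typeClass.2 rfl⟩

theorem typeTerm_bounds_cost {Q : A → ℝ} {W : A → B → ℝ} (hW : ∀ x y, 0 ≤ W x y) (hn : 0 < n)
    (hM : 0 < M) {q : (A × B → ℝ) → ℝ} {d : (A × A → ℝ) → ℝ} {Δ : ℝ} {V : A × A × B → ℝ}
    (hV : V ∈ types (A × A × B) n) (hadm : Admissible Q W q d Δ V) :
    typeTerm n M Q W V ≤
      polyFactor A B n ^ 5 * Real.exp (-(n * cost W (Real.log M / n) V)) ∧
    Real.exp (-(n * cost W (Real.log M / n) V)) ≤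
      polyFactor A B n ^ 5 * typeTerm n M Q W V := by
  obtain ⟨z, rfl⟩ := mem_types.1 hV
  rw [typeTerm_eq hW z hadm.channel]
  have hQ : empirical (fun k => (z k).1) = Q := by rw [← hadm.fst, marginal_empirical]
  have hU : marginal (fun z => (z.1, z.2.2)) (empirical z) =
    empirical fun k => ((z k).1, (z k).2.2) := marginal_empirical _ _
  have hcost : cost W (Real.log M / n) (empirical z) =
      entropy Q - entropy (marginal (fun z => (z.1, z.2.2)) (empirical z)) -
        (∑ w, marginal (fun z => (z.1, z.2.2)) (empirical z) w * Real.log (W w.1 w.2)) +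
      max (entropy Q + entropy (marginal (fun z => (z.1, z.2.2)) (empirical z)) -
        entropy (empirical z) - Real.log M / n) 0 := by
    rw [cost, condDivReal, tripleInfo, marginal_marginal, hadm.fst, hadm.snd]
  rw [hcost, ← exp_natCast_mul_log_div hn hM, exp_natCast_mul_log_div hn hM]
  have := typeTerm_bounds (l := ∑ w, marginal (fun z => (z.1, z.2.2)) (empirical z) w *
      Real.log (W w.1 w.2)) (R := Real.log M / n) (one_le_polyFactor (A := A) (B := B) n)
    (card_typeClass_empirical_pos fun k => (z k).1) (card_typeClass_empirical_pos fun k => ((z k).1, (z k).2.2)) (card_typeClass_empirical_pos z)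
    (card_typeClass_le_polyFactor hn _) (exp_entropy_le_polyFactor hn (by omega) _)
    (card_typeClass_le_polyFactor hn _) (exp_entropy_le_polyFactor hn (by omega) _)
    (card_typeClass_le_polyFactor hn _) (exp_entropy_le_polyFactor hn (by omega) _)
    (n.cast_nonneg)
  rw [← hU, hQ] at this
  rwa [exp_natCast_mul_log_div hn hM] at this

theorem avgErrorProb_le_sum_cost {Q : A → ℝ} (hQ : (typeClass n Q).Nonempty) {W : A → B → ℝ}
    (hW : ∀ x y, 0 ≤ W x y) (q : (A × B → ℝ) → ℝ) {d : (A × A → ℝ) → ℝ} (hd : IsDistance d)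
    {Δ η : ℝ} (hn : 0 < n) (hM : 0 < M) (hη : η ≤ 1 / 10)
    (h : SmallVolume (typeClass n Q) (farApart d Δ n) M η) :
    avgErrorProb n M Q W q d Δ ≤
      open scoped Classical in
      ∑ V ∈ (types (A × A × B) n).filter (Admissible Q W q d Δ),
        4 * polyFactor A B n ^ 5 * Real.exp (-(n * cost W (Real.log M / n) V)) := by
  classical
  refine (avgErrorProb_le hQ hW q hd hn hη h).trans (sum_le_sum fun V hV => ?_)
  obtain ⟨h1, h2⟩ := mem_filter.1 hV
  rw [mul_assoc]
  gcongr
  exact (typeTerm_bounds_cost hW hn hM h1 h2).1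

theorem exp_cost_le_avgErrorProb {Q : A → ℝ} {W : A → B → ℝ}
    (hW : ∀ x y, 0 ≤ W x y) {q : (A × B → ℝ) → ℝ} {d : (A × A → ℝ) → ℝ} (hd : IsDistance d)
    {Δ η : ℝ} (hn : 0 < n) (hM : 2 ≤ M) (hη0 : 0 ≤ η) (hη : η ≤ 1 / 10)
    (h : SmallVolume (typeClass n Q) (farApart d Δ n) M η) {V : A × A × B → ℝ}
    (hV : V ∈ types (A × A × B) n) (hadm : Admissible Q W q d Δ V) :
    Real.exp (-(n * cost W (Real.log M / n) V)) ≤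
      16 * polyFactor A B n ^ 5 * avgErrorProb n M Q W q d Δ := by
  have h1 := le_avgErrorProb hW hd hn hM hη0 hη h hV hadm
  have h2 := (typeTerm_bounds_cost hW hn (by omega : 0 < M) hV hadm).2
  have hp := one_le_polyFactor (A := A) (B := B) n
  calc _ ≤ polyFactor A B n ^ 5 * typeTerm n M Q W V := h2
    _ = 16 * polyFactor A B n ^ 5 * (1 / 16 * typeTerm n M Q W V) := by ring
    _ ≤ _ := by gcongr

end Cost

/-! ### Limits of types -/

section Compactness

/-- The compactness device: a statement about all `V` that fails for infinitely many `n` produces a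
convergent sequence of counterexamples, whose limit gives a contradiction. -/
theorem exists_tendsto_of_frequently {C : Type*} [Fintype C] {p : ℕ → (C → ℝ) → Prop}
    (h : ∃ᶠ n in atTop, ∃ V ∈ stdSimplex ℝ C, p n V) :
    ∃ V ∈ stdSimplex ℝ C, ∃ φ : ℕ → ℕ, Tendsto φ atTop atTop ∧ ∃ v : ℕ → C → ℝ,
      (∀ k, v k ∈ stdSimplex ℝ C ∧ p (φ k) (v k)) ∧ Tendsto v atTop (𝓝 V) := by
  obtain ⟨ψ, hψ, h1⟩ := extraction_of_frequently_atTop h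
  choose v hv hp using h1
  obtain ⟨V, hV, θ, hθ, hlim⟩ := (isCompact_stdSimplex ℝ C).tendsto_subseq hv
  exact ⟨V, hV, ψ ∘ θ, (hψ.comp hθ).tendsto_atTop, v ∘ θ, fun k => ⟨hv _, hp _⟩, hlim⟩

theorem tendsto_of_isTypeApprox {A : Type*} [Fintype A] [DecidableEq A] {P : A → ℝ}
    {Pn : ℕ → A → ℝ} (h : ∀ᶠ n in atTop, IsTypeApprox n P (Pn n)) : Tendsto Pn atTop (𝓝 P) := by
  rw [tendsto_pi_nhds]
  intro a
  rw [tendsto_iff_norm_sub_tendsto_zero]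
  refine squeeze_zero' (Eventually.of_forall fun n => norm_nonneg _) ?_
    tendsto_one_div_atTop_nhds_zero_nat
  filter_upwards [h] with n hn
  exact hn.2.2 a

theorem ContinuousOn.tendsto_comp_marginal {C D : Type*} [Fintype C] [Fintype D] [DecidableEq D]
    {g : (D → ℝ) → ℝ} (hg : ContinuousOn g (stdSimplex ℝ D)) (f : C → D) {v : ℕ → C → ℝ}
    {V : C → ℝ} (hv : ∀ k, v k ∈ stdSimplex ℝ C) (hV : V ∈ stdSimplex ℝ C)
    (hlim : Tendsto v atTop (𝓝 V)) :
    Tendsto (fun k => g (marginal f (v k))) atTop (𝓝 (g (marginal f V))) := by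
  refine (hg _ (marginal_mem_stdSimplex f hV)).tendsto.comp ?_
  refine tendsto_nhdsWithin_iff.2 ⟨((continuous_marginal f).tendsto V).comp hlim, ?_⟩
  exact Eventually.of_forall fun k => marginal_mem_stdSimplex f (hv k)

theorem marginal_id {C : Type*} [Fintype C] [DecidableEq C] (V : C → ℝ) :
    marginal (fun z => z) V = V := by
  ext c
  simp [marginal, sum_filter]

end Compactness

/-! ### The volume condition -/

section Volume

variable {A : Type*} [Fintype A] [DecidableEq A]

/-- The rate condition concerns `P`, the code has type `P_n`. Violating couplings for infinitely
many `n` would accumulate at one with marginals `P` and mutual information at most `R₀`. -/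
theorem eventually_lt_mutualInfo {P : A → ℝ} {d : (A × A → ℝ) → ℝ} (hd : IsDistance d)
    {Δ R₀ : ℝ} (hrate : ∀ V ∈ stdSimplex ℝ (A × A), marginal Prod.fst V = P →
      marginal Prod.snd V = P → d V ≤ Δ → R₀ < mutualInfo V)
    {Pn : ℕ → A → ℝ} (hPn : Tendsto Pn atTop (𝓝 P)) :
    ∀ᶠ n in atTop, ∀ V ∈ stdSimplex ℝ (A × A), marginal Prod.fst V = Pn n →
      marginal Prod.snd V = Pn n → d V ≤ Δ → R₀ < mutualInfo V := by
  by_contra hcon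
  have hfr : ∃ᶠ n in atTop, ∃ V ∈ stdSimplex ℝ (A × A), marginal Prod.fst V = Pn n ∧
      marginal Prod.snd V = Pn n ∧ d V ≤ Δ ∧ mutualInfo V ≤ R₀ := by
    refine (not_eventually.1 hcon).mono fun n hn => ?_
    push Not at hn
    exact hn
  obtain ⟨V, hV, φ, hφ, v, hv, hlim⟩ := exists_tendsto_of_frequently hfr
  have hPφ := hPn.comp hφ
  have m1 : marginal Prod.fst V = P := by
    refine tendsto_nhds_unique (((continuous_marginal Prod.fst).tendsto V).comp hlim) ?_
    exact hPφ.congr fun k => (hv k).2.1.symm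
  have m2 : marginal Prod.snd V = P := by
    refine tendsto_nhds_unique (((continuous_marginal Prod.snd).tendsto V).comp hlim) ?_
    exact hPφ.congr fun k => (hv k).2.2.1.symm
  have hdV : d V ≤ Δ := by
    have := ContinuousOn.tendsto_comp_marginal hd.continuousOn (fun z => z) (fun k => (hv k).1)
      hV hlim
    simp only [marginal_id] at this
    exact le_of_tendsto' this fun k => (hv k).2.2.2.1
  have hI : mutualInfo V ≤ R₀ := by
    have hcont : Continuous fun V : A × A → ℝ =>
        entropy (marginal Prod.fst V) + entropy (marginal Prod.snd V) - entropy V :=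
      ((continuous_entropy.comp (continuous_marginal _)).add
        (continuous_entropy.comp (continuous_marginal _))).sub continuous_entropy
    rw [mutualInfo_eq_entropy hV.1]
    refine le_of_tendsto' ((hcont.tendsto V).comp hlim) fun k => ?_
    have := (hv k).2.2.2.2
    rwa [mutualInfo_eq_entropy (hv k).1.1] at this
  exact absurd (hrate V hV m1 m2 hdV) (not_lt.2 hI)

/-- For each joint type `V` with `d V ≤ Δ`, the sequences of that joint type with `x` number
`|T(V)|/|T(Q)|`, which is at most `|T(Q)| e^{-nI}` up to a polynomial; there are polynomially many
such `V`. -/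
theorem volumeCondition_of_bounds {n M : ℕ} (hn : 0 < n) (hM : 0 < M) {Q : A → ℝ}
    {d : (A × A → ℝ) → ℝ} {Δ δ R₀ : ℝ}
    (hI : ∀ V ∈ stdSimplex ℝ (A × A), marginal Prod.fst V = Q →
      marginal Prod.snd V = Q → d V ≤ Δ → R₀ < mutualInfo V)
    (hbound : polyFactor A A n ^ 4 ≤ Real.exp (n * (R₀ - Real.log M / n - δ))) :
    VolumeCondition n M Q d Δ δ := by
  classical
  intro x hx
  set p := polyFactor A A n with hp
  have hp1 : 1 ≤ p := one_le_polyFactor n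
  have hQ := mem_typeClass.1 hx
  have ht : (0 : ℝ) < #(typeClass n Q) := by exact_mod_cast card_pos.2 ⟨x, hx⟩
  set t : ℝ := ((#(typeClass n Q) : ℕ) : ℝ) with htdef
  have ht1 : t ≤ p * Real.exp (n * entropy Q) := by
    have := card_typeClass_le_polyFactor (A := A) (B := A) hn x
    rwa [hQ] at this
  have ht2 : Real.exp (n * entropy Q) ≤ p * t := by
    have := exp_entropy_le_polyFactor (A := A) (B := A) hn (by omega) x
    rwa [hQ] at this
  set G := (types (A × A) n).filter fun V => marginal Prod.fst V = Q ∧ marginal Prod.snd V = Q ∧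
    d V ≤ Δ with hG
  have hcard : #((typeClass n Q).filter fun x' => d (jointType x' x) ≤ Δ) ≤
      ∑ V ∈ G, #{z' ∈ typeClass n V | (fun i => (z' i).2) = x} := by
    refine le_trans ?_ card_biUnion_le
    refine card_le_card_of_injOn (fun x' i => (x' i, x i)) ?_ ?_
    · intro x' hx'
      obtain ⟨h1, h2⟩ := mem_filter.1 (mem_coe.1 hx')
      refine mem_coe.2 (mem_biUnion.2 ⟨jointType x' x, mem_filter.2 ⟨mem_types.2 ⟨_, rfl⟩,
        ?_, ?_, h2⟩, mem_filter.2 ⟨mem_typeClass.2 rfl, rfl⟩⟩)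
      · rw [jointType, marginal_empirical]; exact mem_typeClass.1 h1
      · rw [jointType, marginal_empirical]; exact hQ
    · intro a _ b _ hab
      ext i
      exact congrArg Prod.fst (congrFun hab i)
  have hV : ∀ V ∈ G, (#{z' ∈ typeClass n V | (fun i => (z' i).2) = x} : ℝ) ≤
      p ^ 3 * t * Real.exp (-(n * R₀)) := by
    intro V hV
    obtain ⟨h1, h2, h3, h4⟩ := mem_filter.1 hV
    obtain ⟨z, rfl⟩ := mem_types.1 h1
    have h5 : empirical x = empirical fun i => (z i).2 := by
      rw [hQ, ← h3, marginal_empirical]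
    have h6 := card_fiber_mul_card_typeClass Prod.snd z x h5
    rw [hQ] at h6
    have h7 : (#{z' ∈ typeClass n (empirical z) | (fun i => (z' i).2) = x} : ℝ) * t =
      #(typeClass n (empirical z)) := by rw [htdef]; exact_mod_cast h6
    have h8 := card_typeClass_le_polyFactor (A := A) (B := A) hn z
    have hz := empirical_mem_stdSimplex hn z
    have h9 := hI _ hz h2 h3 h4
    rw [mutualInfo_eq_entropy hz.1, h2, h3] at h9
    refine le_of_mul_le_mul_right ?_ ht
    rw [h7]
    calc (#(typeClass n (empirical z)) : ℝ) ≤ p * Real.exp (n * entropy (empirical z)) := h8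
      _ ≤ p * Real.exp (n * (entropy Q + entropy Q - R₀)) := by
          gcongr
          linarith
      _ = p * (Real.exp (n * entropy Q) * Real.exp (n * entropy Q) * Real.exp (-(n * R₀))) := by
          rw [← Real.exp_add, ← Real.exp_add]
          congr 2
          ring
      _ ≤ p * ((p * t) * (p * t) * Real.exp (-(n * R₀))) := by gcongr
      _ = _ := by ring
  have hGc : (#G : ℝ) ≤ p := by
    calc (#G : ℝ) ≤ (#(types (A × A) n) : ℝ) := by exact_mod_cast card_filter_le _ _
      _ ≤ ((n : ℝ) + 1) ^ Fintype.card (A × A) := by exact_mod_cast card_types_le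
      _ ≤ (3 * ((n : ℝ) + 1)) ^ Fintype.card (A × A) := by
          gcongr
          have : (0 : ℝ) ≤ n := n.cast_nonneg
          linarith
      _ ≤ p := by
          rw [hp, polyFactor]
          have : (0 : ℝ) ≤ n := n.cast_nonneg
          exact pow_le_pow_right₀ (by linarith) (by omega)
  have hcard' : (#((typeClass n Q).filter fun x' => d (jointType x' x) ≤ Δ) : ℝ) ≤
      p ^ 4 * t * Real.exp (-(n * R₀)) := by
    calc (#((typeClass n Q).filter fun x' => d (jointType x' x) ≤ Δ) : ℝ)
        ≤ ∑ V ∈ G, (#{z' ∈ typeClass n V | (fun i => (z' i).2) = x} : ℝ) := by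
          exact_mod_cast hcard
      _ ≤ ∑ V ∈ G, p ^ 3 * t * Real.exp (-(n * R₀)) := sum_le_sum hV
      _ = #G * (p ^ 3 * t * Real.exp (-(n * R₀))) := by rw [sum_const, nsmul_eq_mul]
      _ ≤ p * (p ^ 3 * t * Real.exp (-(n * R₀))) := by gcongr
      _ = _ := by ring
  calc (M : ℝ) * Real.exp (n * δ) *
      (#((typeClass n Q).filter fun x' => d (jointType x' x) ≤ Δ) : ℝ)
      ≤ Real.exp (n * (Real.log M / n)) * Real.exp (n * δ) *
        (Real.exp (n * (R₀ - Real.log M / n - δ)) * t * Real.exp (-(n * R₀))) := by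
        rw [exp_natCast_mul_log_div hn hM]
        gcongr
        refine hcard'.trans ?_
        gcongr
    _ = (Real.exp (n * (Real.log M / n)) * Real.exp (n * δ) *
        Real.exp (n * (R₀ - Real.log M / n - δ)) * Real.exp (-(n * R₀))) * t := by ring
    _ = t := by
        rw [← Real.exp_add, ← Real.exp_add, ← Real.exp_add]
        have : (n : ℝ) * (Real.log M / n) + n * δ + n * (R₀ - Real.log M / n - δ) + -(n * R₀) = 0 := by
          ring
        rw [this, Real.exp_zero, one_mul]

theorem eventually_two_le {M : ℕ → ℕ} {R : ℝ} (hR : 0 < R)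
    (hM : Tendsto (fun n : ℕ => Real.log (M n) / n) atTop (𝓝 R)) : ∀ᶠ n in atTop, 2 ≤ M n := by
  filter_upwards [hM.eventually (lt_mem_nhds hR), eventually_gt_atTop 0] with n h1 h2
  by_contra h3
  have h4 : M n = 0 ∨ M n = 1 := by omega
  -- Both `Real.log 0` and `Real.log 1` are `0`, against the positive limit `R`.
  rcases h4 with h4 | h4 <;> simp [h4] at h1

theorem eventually_volumeCondition {P : A → ℝ} {d : (A × A → ℝ) → ℝ} (hd : IsDistance d)
    {δ Δ R : ℝ} (hδ : 0 < δ) (hR : 0 < R)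
    (hrate : (R : EReal) ≤ minMutualInfo P d Δ - ((2 * δ : ℝ) : EReal))
    {Pn : ℕ → A → ℝ} (hPn : Tendsto Pn atTop (𝓝 P))
    {M : ℕ → ℕ} (hM : Tendsto (fun n : ℕ => Real.log (M n) / n) atTop (𝓝 R)) :
    ∀ᶠ n in atTop, VolumeCondition n (M n) (Pn n) d Δ δ := by
  -- Of the margin `2δ`, a quarter turns the bound `3δ/2` into a strict one. The remaining `3δ/2`
  -- pays for `δ` in the volume condition, `δ/4` for the convergence of the rates and `δ/4` for the
  -- polynomial factor.
  have h1 : ∀ V ∈ stdSimplex ℝ (A × A), marginal Prod.fst V = P →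
      marginal Prod.snd V = P → d V ≤ Δ → R + 3 / 2 * δ < mutualInfo V := by
    intro V hV m1 m2 hdV
    have h2 : minMutualInfo P d Δ ≤ (mutualInfo V : EReal) :=
      iInf₂_le V ⟨hV, m1, m2, hdV⟩
    have h3 := hrate.trans (EReal.sub_le_sub h2 le_rfl)
    rw [← EReal.coe_sub, EReal.coe_le_coe_iff] at h3
    linarith
  filter_upwards [eventually_lt_mutualInfo hd h1 hPn, eventually_two_le hR hM,
    eventually_gt_atTop 0, eventually_polyFactor_le A A 1 4 (by positivity : 0 < δ / 4),
    hM.eventually (gt_mem_nhds (by linarith : R < R + δ / 4))] with n h2 h3 h4 h5 h6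
  refine volumeCondition_of_bounds h4 (by omega) h2 ?_
  rw [one_mul] at h5
  refine h5.trans (Real.exp_le_exp.2 ?_)
  gcongr
  linarith

end Volume

/-! ### Exponential inequalities -/

section ExpLE

theorem expLE_of_forall_eventually_le {f g : ℕ → ℝ≥0∞}
    (h : ∀ η : ℝ, 0 < η → ∀ᶠ n : ℕ in atTop, f n / g n ≤ ENNReal.ofReal (Real.exp (n * η))) :
    ExpLE f g := by
  unfold ExpLE
  rw [← EReal.le_of_forall_lt_iff_le]
  intro η hη
  have hη' : 0 < η := by exact_mod_cast hη
  refine limsup_le_of_le (by isBoundedDefault) ?_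
  filter_upwards [h η hη', eventually_gt_atTop 0] with n hn hn0
  rw [EReal.div_le_iff_le_mul (by exact_mod_cast hn0) (EReal.natCast_ne_top n)]
  refine (ENNReal.log_monotone hn).trans (le_of_eq ?_)
  rw [← EReal.exp_coe, EReal.log_exp, EReal.coe_mul]
  rfl

theorem expDecay_coe (E : ℝ) (n : ℕ) :
    expDecay (E : EReal) n = ENNReal.ofReal (Real.exp (-(n * E))) := by
  rw [expDecay, ← EReal.exp_coe, EReal.coe_neg, EReal.coe_mul]
  rfl

theorem expDecay_top {n : ℕ} (hn : 0 < n) : expDecay ⊤ n = 0 := by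
  rw [expDecay, EReal.mul_top_of_pos (by exact_mod_cast hn)]
  simp

theorem expDecay_bot {n : ℕ} (hn : 0 < n) : expDecay ⊥ n = ⊤ := by
  rw [expDecay, EReal.mul_bot_of_pos (by exact_mod_cast hn)]
  simp

theorem ofReal_div_ofReal_le {a b e : ℝ} (hb : 0 < b) (h : a ≤ e * b) :
    ENNReal.ofReal a / ENNReal.ofReal b ≤ ENNReal.ofReal e := by
  rw [← ENNReal.ofReal_div_of_pos hb]
  exact ENNReal.ofReal_le_ofReal ((div_le_iff₀ hb).2 h)

end ExpLE

/-! ### Upper bound on the error probability -/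

section Upper

variable {A B : Type*} [Fintype A] [DecidableEq A] [Fintype B] [DecidableEq B]

/-- All constraints pass to the limit; the strict `d > Δ` weakens to `d ≥ Δ`, exactly the feasible
set at level `Δ`. The closed set `s` is a half-line when the exponent is finite, and everything when
it is infinite, where the mere existence of a limit is contradictory. -/
theorem exists_limit_of_frequently_admissible {W : A → B → ℝ} {q : (A × B → ℝ) → ℝ}
    (hq : ContinuousOn q (stdSimplex ℝ (A × B))) {d : (A × A → ℝ) → ℝ} (hd : IsDistance d)
    {P : A → ℝ} {Pn : ℕ → A → ℝ} (hPn : Tendsto Pn atTop (𝓝 P)) {Δ R : ℝ} {r : ℕ → ℝ}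
    (hr : Tendsto r atTop (𝓝 R)) {s : Set ℝ} (hs : IsClosed s)
    (h : ∃ᶠ n in atTop, ∃ V ∈ stdSimplex ℝ (A × A × B), Admissible (Pn n) W q d Δ V ∧
      cost W (r n) V ∈ s) :
    ∃ e ∈ s, exponent R P W q d Δ ≤ (e : ℝ) := by
  obtain ⟨V, hV, φ, hφ, v, hv, hlim⟩ := exists_tendsto_of_frequently h
  have hPφ := hPn.comp hφ
  have m1 : marginal (fun z => z.1) V = P := by
    refine tendsto_nhds_unique (((continuous_marginal fun z : A × A × B => z.1).tendsto V).comp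
      hlim) ?_
    exact hPφ.congr fun k => (hv k).2.1.fst.symm
  have m2 : marginal (fun z => z.2.1) V = P := by
    refine tendsto_nhds_unique (((continuous_marginal fun z : A × A × B => z.2.1).tendsto V).comp
      hlim) ?_
    exact hPφ.congr fun k => (hv k).2.1.snd.symm
  have m3 := le_of_tendsto_of_tendsto'
    (ContinuousOn.tendsto_comp_marginal hq (fun z : A × A × B => (z.1, z.2.2))
      (fun k => (hv k).1) hV hlim)
    (ContinuousOn.tendsto_comp_marginal hq (fun z : A × A × B => (z.2.1, z.2.2))
      (fun k => (hv k).1) hV hlim) fun k => (hv k).2.1.metric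
  have m4 := ge_of_tendsto'
    (ContinuousOn.tendsto_comp_marginal hd.continuousOn (fun z : A × A × B => (z.1, z.2.1))
      (fun k => (hv k).1) hV hlim) fun k => (hv k).2.1.dist.le
  have m5 : ∀ x y, W x y = 0 → marginal (fun z => (z.1, z.2.2)) V (x, y) = 0 := by
    intro x y hxy
    have h1 := ((continuous_apply (x, y)).comp
      (continuous_marginal fun z : A × A × B => (z.1, z.2.2))).tendsto V |>.comp hlim
    refine tendsto_nhds_unique h1 ?_
    exact tendsto_const_nhds.congr fun k => ((hv k).2.1.channel x y hxy).symm
  have m6 : cost W R V ∈ s := by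
    refine hs.mem_of_tendsto (((continuous_cost W).tendsto (R, V)).comp
      ((hr.comp hφ).prodMk_nhds hlim)) (Eventually.of_forall fun k => (hv k).2.2)
  refine ⟨_, m6, ?_⟩
  rw [← condDiv_add_eq_cost R hV.1 m5]
  exact iInf₂_le (f := fun (V : A × A × B → ℝ) (_ : V ∈ feasible P q d Δ) =>
    condDiv (marginal (fun z => (z.1, z.2.2)) V) W +
      ((max (mutualInfo (marginal (fun z => (z.2.1, (z.2.2, z.1))) V) - R) 0 : ℝ) : EReal))
    V ⟨hV, m1, m2, m3, m4⟩

/-- Eventually all admissible types have cost above `E - η/2`. The other `η/2` absorbs the number of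
types and the polynomial factors. -/
theorem expLE_avgErrorProb {W : A → B → ℝ} (hW : ∀ x y, 0 ≤ W x y) {q : (A × B → ℝ) → ℝ}
    (hq : ContinuousOn q (stdSimplex ℝ (A × B))) {d : (A × A → ℝ) → ℝ} (hd : IsDistance d)
    {P : A → ℝ} {Pn : ℕ → A → ℝ} (hPn : ∀ᶠ n in atTop, IsTypeApprox n P (Pn n)) {Δ δ R : ℝ}
    (hR : 0 < R) (hδ : 0 < δ) {M : ℕ → ℕ}
    (hM : Tendsto (fun n : ℕ => Real.log (M n) / n) atTop (𝓝 R))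
    (hvol : ∀ᶠ n in atTop, VolumeCondition n (M n) (Pn n) d Δ δ) :
    ExpLE (fun n => ENNReal.ofReal (avgErrorProb n (M n) (Pn n) W q d Δ))
      (expDecay (exponent R P W q d Δ)) := by
  classical
  have hlim := tendsto_of_isTypeApprox hPn
  have hη : ∀ᶠ n : ℕ in atTop, Real.exp (-(n * δ)) ≤ 1 / 10 := by
    have : Tendsto (fun n : ℕ => Real.exp (-(n * δ))) atTop (𝓝 0) :=
      Real.tendsto_exp_neg_atTop_nhds_zero.comp
        (tendsto_natCast_atTop_atTop.atTop_mul_const hδ)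
    exact this.eventually (ge_mem_nhds (by norm_num))
  have hmain : ∀ᶠ n in atTop, avgErrorProb n (M n) (Pn n) W q d Δ ≤
      ∑ V ∈ (types (A × A × B) n).filter (Admissible (Pn n) W q d Δ),
        4 * polyFactor A B n ^ 5 * Real.exp (-(n * cost W (Real.log (M n) / n) V)) := by
    filter_upwards [hη, hvol, hPn, eventually_two_le hR hM, eventually_gt_atTop 0] with
      n h1 h2 h3 h4 h5
    obtain ⟨x, hx⟩ := h3.1
    exact avgErrorProb_le_sum_cost ⟨x, mem_typeClass.2 hx⟩ hW q hd h5 (by omega) h1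
      (smallVolume_of_volumeCondition h2)
  refine expLE_of_forall_eventually_le fun η hη0 => ?_
  induction hE : exponent R P W q d Δ with
  | bot =>
    filter_upwards [eventually_gt_atTop 0] with n hn
    rw [expDecay_bot hn]
    simp
  | top =>
    have hnone : ∀ᶠ n in atTop, ∀ V ∈ stdSimplex ℝ (A × A × B),
        ¬ Admissible (Pn n) W q d Δ V := by
      by_contra hcon
      have hfr : ∃ᶠ n in atTop, ∃ V ∈ stdSimplex ℝ (A × A × B), Admissible (Pn n) W q d Δ V ∧
          cost W (Real.log (M n) / n) V ∈ Set.univ := by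
        refine (not_eventually.1 hcon).mono fun n hn => ?_
        push Not at hn
        obtain ⟨V, h1, h2⟩ := hn
        exact ⟨V, h1, h2, Set.mem_univ _⟩
      obtain ⟨e, -, he⟩ := exists_limit_of_frequently_admissible hq hd hlim hM isClosed_univ hfr
      rw [hE] at he
      exact absurd he (not_le.2 (EReal.coe_lt_top e))
    filter_upwards [hmain, hnone, eventually_gt_atTop 0] with n h1 h2 h3
    have : (types (A × A × B) n).filter (Admissible (Pn n) W q d Δ) = ∅ := by
      refine filter_eq_empty_iff.2 fun V hV => h2 V ?_
      obtain ⟨z, rfl⟩ := mem_types.1 hV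
      exact empirical_mem_stdSimplex h3 z
    -- With infinite exponent the right-hand side vanishes, so the error probability has to be
    -- exactly zero for large `n`.
    rw [this, sum_empty] at h1
    rw [ENNReal.ofReal_of_nonpos h1]
    simp
  | coe E =>
    have hcost : ∀ᶠ n in atTop, ∀ V ∈ stdSimplex ℝ (A × A × B),
        Admissible (Pn n) W q d Δ V → E - η / 2 < cost W (Real.log (M n) / n) V := by
      by_contra hcon
      have hfr : ∃ᶠ n in atTop, ∃ V ∈ stdSimplex ℝ (A × A × B), Admissible (Pn n) W q d Δ V ∧
          cost W (Real.log (M n) / n) V ∈ Set.Iic (E - η / 2) := by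
        refine (not_eventually.1 hcon).mono fun n hn => ?_
        push Not at hn
        exact hn
      obtain ⟨e, he1, he⟩ := exists_limit_of_frequently_admissible hq hd hlim hM isClosed_Iic hfr
      rw [hE, EReal.coe_le_coe_iff] at he
      have := Set.mem_Iic.1 he1
      linarith
    filter_upwards [hmain, hcost, eventually_gt_atTop 0,
      eventually_polyFactor_le A B 4 6 (half_pos hη0)] with n h1 h2 h3 h4
    rw [expDecay_coe]
    refine ofReal_div_ofReal_le (Real.exp_pos _) (h1.trans ?_)
    have hp := one_le_polyFactor (A := A) (B := B) n
    set p := polyFactor A B n with hpdef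
    have hc : (#((types (A × A × B) n).filter (Admissible (Pn n) W q d Δ)) : ℝ) ≤ p := by
      calc (#((types (A × A × B) n).filter (Admissible (Pn n) W q d Δ)) : ℝ)
          ≤ (#(types (A × A × B) n) : ℝ) := by exact_mod_cast card_filter_le _ _
        _ ≤ ((n : ℝ) + 1) ^ Fintype.card (A × A × B) := by exact_mod_cast card_types_le
        _ ≤ (3 * ((n : ℝ) + 1)) ^ Fintype.card (A × A × B) := by
            gcongr
            have : (0 : ℝ) ≤ n := n.cast_nonneg
            linarith
        _ ≤ p := by
            rw [hpdef, polyFactor]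
            have : (0 : ℝ) ≤ n := n.cast_nonneg
            exact pow_le_pow_right₀ (by linarith) (by omega)
    calc _ ≤ ∑ V ∈ (types (A × A × B) n).filter (Admissible (Pn n) W q d Δ),
          4 * p ^ 5 * Real.exp (-(n * (E - η / 2))) := by
          refine sum_le_sum fun V hV => ?_
          obtain ⟨h5, h6⟩ := mem_filter.1 hV
          obtain ⟨z, rfl⟩ := mem_types.1 h5
          have := h2 _ (empirical_mem_stdSimplex h3 z) h6
          gcongr
      _ = #((types (A × A × B) n).filter (Admissible (Pn n) W q d Δ)) *
          (4 * p ^ 5 * Real.exp (-(n * (E - η / 2)))) := by rw [sum_const, nsmul_eq_mul]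
      _ ≤ p * (4 * p ^ 5 * Real.exp (-(n * (E - η / 2)))) := by gcongr
      _ = 4 * p ^ 6 * Real.exp (-(n * (E - η / 2))) := by ring
      _ ≤ Real.exp (n * (η / 2)) * Real.exp (-(n * (E - η / 2))) := by gcongr
      _ = Real.exp (n * η) * Real.exp (-(n * E)) := by
          rw [← Real.exp_add, ← Real.exp_add]
          congr 1
          ring

end Upper

/-! ### Approximation of a joint distribution by joint types -/

/-- Real vectors can be approximated by rational ones satisfying the same rational linear
relations. -/
theorem exists_rat_approx {C : Type*} [Fintype C] (v : C → ℝ) {η : ℝ} (hη : 0 < η) :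
    ∃ w : C → ℚ, (∀ c, |(w c : ℝ) - v c| < η) ∧
      ∀ a : C → ℚ, ∑ c, (a c : ℝ) * v c = 0 → ∑ c, a c * w c = 0 := by
  -- Express the `v c` in a rational basis of their `ℚ`-span and move the basis elements to nearby
  -- rationals. This is a `ℚ`-linear map, so all rational relations persist.
  set S := Submodule.span ℚ (Set.range v) with hS
  have : Module.Finite ℚ S := Module.Finite.span_of_finite ℚ (Set.finite_range v)
  set b := Module.finBasis ℚ S
  set u : C → S := fun c => ⟨v c, Submodule.subset_span ⟨c, rfl⟩⟩ with hu
  have hrepr : ∀ c, ∑ j, (b.repr (u c) j : ℝ) * (b j : ℝ) = v c := by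
    intro c
    have h1 := congrArg (fun s : S => (s : ℝ)) (b.sum_repr (u c))
    simpa only [AddSubmonoidClass.coe_finsetSum, Submodule.coe_smul, Rat.smul_def] using h1
  have hopen : IsOpen {β : Fin (Module.finrank ℚ S) → ℝ |
      ∀ c, |∑ j, (b.repr (u c) j : ℝ) * β j - v c| < η} := by
    simp only [Set.ofPred_forall]
    refine isOpen_iInter_of_finite fun c => isOpen_lt ?_ continuous_const
    fun_prop
  have hdense : DenseRange fun (β : Fin (Module.finrank ℚ S) → ℚ) j => (β j : ℝ) :=
    DenseRange.piMap fun _ => Rat.denseRange_cast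
  obtain ⟨β, hβ⟩ := hdense.exists_mem_open hopen ⟨fun j => (b j : ℝ), fun c => by
    rw [hrepr c]; simpa using hη⟩
  refine ⟨fun c => b.constr ℚ β (u c), fun c => ?_, fun a ha => ?_⟩
  · have h1 := hβ c
    simp only [Module.Basis.constr_apply_fintype, Module.Basis.equivFun_apply, smul_eq_mul]
    push_cast
    exact h1
  · have h0 : ∑ c, a c • u c = 0 := by
      apply Subtype.ext
      simpa [Rat.smul_def, hu] using ha
    have h1 := congrArg (b.constr ℚ β) h0
    simpa using h1

theorem exists_common_denom {C : Type*} [Fintype C] (w : C → ℚ) (hw : ∀ c, 0 ≤ w c) :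
    ∃ (K : ℕ) (k : C → ℕ), 0 < K ∧ ∀ c, (w c : ℝ) = k c / K := by
  have h : ∀ c, ∃ k : ℕ, (w c : ℝ) = k / ((∏ c, (w c).den : ℕ) : ℝ) := by
    intro c
    obtain ⟨e, he⟩ := dvd_prod_of_mem (fun c => (w c).den) (mem_univ c)
    refine ⟨(w c).num.toNat * e, ?_⟩
    have he0 : (e : ℝ) ≠ 0 := by
      intro h0
      have h1 : e = 0 := by exact_mod_cast h0
      rw [h1, mul_zero] at he
      exact prod_ne_zero_iff.2 (fun c _ => (w c).den_nz) he
    rw [he]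
    push_cast
    rw [mul_div_mul_right _ _ he0]
    have h2 : ((w c).num.toNat : ℝ) = (w c).num := by
      exact_mod_cast Int.toNat_of_nonneg (Rat.num_nonneg.2 (hw c))
    rw [h2]
    exact Rat.cast_def (w c)
  choose k hk using h
  exact ⟨_, k, Nat.pos_of_ne_zero (prod_ne_zero_iff.2 fun c _ => (w c).den_nz), hk⟩

theorem exists_pos_le_of_ne_zero {C : Type*} [Fintype C] {V : C → ℝ} (hV : ∀ c, 0 ≤ V c) :
    ∃ ε > 0, ∀ c, V c ≠ 0 → ε ≤ V c := by
  classical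
  have h : ∀ s : Finset C, ∃ ε > 0, ∀ c ∈ s, V c ≠ 0 → ε ≤ V c := by
    intro s
    induction s using Finset.induction_on with
    | empty => exact ⟨1, one_pos, by simp⟩
    | insert a s _ ih =>
      obtain ⟨ε, hε, h⟩ := ih
      by_cases ha : V a = 0
      · refine ⟨ε, hε, fun c hc h0 => ?_⟩
        rcases mem_insert.1 hc with rfl | hc
        · exact absurd ha h0
        · exact h c hc h0
      · refine ⟨min ε (V a), lt_min hε ((hV a).lt_of_ne' ha), fun c hc h0 => ?_⟩
        rcases mem_insert.1 hc with rfl | hc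
        · exact min_le_right _ _
        · exact (min_le_left _ _).trans (h c hc h0)
  obtain ⟨ε, hε, h⟩ := h univ
  exact ⟨ε, hε, fun c => h c (mem_univ c)⟩

section Approximation

variable {A B : Type*} [Fintype A] [DecidableEq A] [Fintype B] [DecidableEq B]

/-- The vector with value `g a` at `(a, a, y a)`, and zero elsewhere. -/
def diagVec (y : A → B) (g : A → ℝ) (z : A × A × B) : ℝ :=
  if z = (z.1, z.1, y z.1) then g z.1 else 0

theorem marginal_fst_diagVec (y : A → B) (g : A → ℝ) :
    marginal (fun z : A × A × B => z.1) (diagVec y g) = g := by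
  ext a
  rw [marginal, sum_eq_single (a, a, y a)]
  · simp [diagVec]
  · rintro ⟨a', b, c⟩ h1 h2
    have h3 : a' = a := (mem_filter.1 h1).2
    subst h3
    exact if_neg h2
  · simp

theorem marginal_snd_diagVec (y : A → B) (g : A → ℝ) :
    marginal (fun z : A × A × B => z.2.1) (diagVec y g) = g := by
  ext a
  rw [marginal, sum_eq_single (a, a, y a)]
  · simp [diagVec]
  · rintro ⟨a', b, c⟩ h1 h2
    have h3 : b = a := (mem_filter.1 h1).2
    subst h3
    refine if_neg fun h => h2 ?_
    simp only [Prod.mk.injEq, true_and] at h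
    obtain ⟨h4, h5⟩ := h
    subst h4
    rw [h5]
  · simp

theorem marginal_add_smul {C D : Type*} [Fintype C] [DecidableEq D] (f : C → D) (r s : ℝ)
    (U V : C → ℝ) :
    marginal f (fun z => r * U z + s * V z) = fun c => r * marginal f U c + s * marginal f V c := by
  ext c
  simp only [marginal, sum_add_distrib, mul_sum]

/-- Round `V` to rational `w = k/K` and take `⌊n/K⌋` copies of the counts `k`. The two marginals
then agree but miss `P_n` slightly. The defect, of either sign, is put on one cell `(a, a, y a)` per
letter, which corrects both marginals together; `hdiag` makes these cells positive enough to absorb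
it. -/
theorem eventually_exists_type {P : A → ℝ} {V : A × A × B → ℝ}
    (hV : V ∈ stdSimplex ℝ (A × A × B)) (hV1 : marginal (fun z => z.1) V = P)
    (hV2 : marginal (fun z => z.2.1) V = P) (hdiag : ∀ a, P a ≠ 0 → ∃ y, V (a, a, y) ≠ 0)
    {Pn : ℕ → A → ℝ} (hPn : ∀ᶠ n in atTop, IsTypeApprox n P (Pn n))
    {s : Set (A × A × B → ℝ)} (hs : s ∈ 𝓝 V) :
    ∀ᶠ n in atTop, ∃ U ∈ types (A × A × B) n, U ∈ s ∧ marginal (fun z => z.1) U = Pn n ∧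
      marginal (fun z => z.2.1) U = Pn n ∧ ∀ z, V z = 0 → U z = 0 := by
  obtain ⟨η, hη, hηs⟩ := Metric.mem_nhds_iff.1 hs
  obtain ⟨ε, hε, hεV⟩ := exists_pos_le_of_ne_zero hV.1
  have hy : ∀ a, ∃ y, P a ≠ 0 → V (a, a, y) ≠ 0 := by
    intro a
    by_cases ha : P a = 0
    · have : Nonempty (A × A × B) := by
        by_contra hne
        rw [not_nonempty_iff] at hne
        have := hV.2
        simp at this
      exact ⟨this.some.2.2, fun h => absurd ha h⟩
    · obtain ⟨y, hy⟩ := hdiag a ha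
      exact ⟨y, fun _ => hy⟩
  choose y hy using hy
  set C : ℝ := (Fintype.card (A × A × B) : ℝ) + 1 with hC
  have hC0 : 0 < C := by positivity
  -- A cell moves by at most `ζ` from rounding and `card * ζ` from the diagonal correction, in all
  -- `C * ζ`. This must stay below both the radius of the neighbourhood and the smallest nonzero
  -- value of `V`.
  set ζ := min (η / 2) ε / (2 * C) with hζ
  have hζ0 : 0 < ζ := by
    have : 0 < min (η / 2) ε := lt_min (half_pos hη) hε
    positivity
  have hζC : C * ζ < min (η / 2) ε := by
    have : 0 < min (η / 2) ε := lt_min (half_pos hη) hε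
    have h1 : C * ζ = min (η / 2) ε / 2 := by rw [hζ]; field_simp
    linarith
  obtain ⟨w, hw1, hw2⟩ := exists_rat_approx V hζ0
  have hζε : ζ < ε := by
    have h1 : min (η / 2) ε ≤ ε := min_le_right _ _
    have h2 : 1 ≤ C := by rw [hC]; have : (0 : ℝ) ≤ Fintype.card (A × A × B) := by positivity
                          linarith
    nlinarith
  -- The vanishing of one coordinate is itself a rational linear relation, hence inherited by `w`;
  -- so is the equality of the two marginals below.
  have hw0 : ∀ z, V z = 0 → w z = 0 := by
    intro z hz
    have := hw2 (Pi.single z 1) (by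
      rw [sum_eq_single z] <;> simp +contextual [hz])
    rw [sum_eq_single z] at this <;> simp_all [Pi.single_apply]
  have hwnn : ∀ z, 0 ≤ w z := by
    intro z
    by_cases hz : V z = 0
    · exact (hw0 z hz).ge
    · have h1 := (abs_lt.1 (hw1 z)).1
      have h2 := hεV z hz
      have : (0 : ℝ) ≤ w z := by linarith
      exact_mod_cast this
  obtain ⟨K, k, hK, hk⟩ := exists_common_denom w hwnn
  set wr : A × A × B → ℝ := fun z => w z with hwr
  have hmarg : marginal (fun z => z.1) wr = marginal (fun z => z.2.1) wr := by
    ext a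
    have h1 := hw2 (fun z => (if z.1 = a then 1 else 0) - if z.2.1 = a then 1 else 0) (by
      have h2 := congrFun (hV1.trans hV2.symm) a
      simp only [marginal, sum_filter] at h2
      simp only [Rat.cast_sub, apply_ite (Rat.cast : ℚ → ℝ), Rat.cast_one, Rat.cast_zero, sub_mul,
        sum_sub_distrib, ite_mul, one_mul, zero_mul]
      rw [h2, sub_self])
    simp only [sub_mul, sum_sub_distrib, ite_mul, one_mul, zero_mul] at h1
    rw [← sum_filter, ← sum_filter] at h1
    simp only [marginal, hwr]
    exact_mod_cast sub_eq_zero.1 h1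
  set m : A → ℝ := marginal (fun z => z.1) wr with hm
  set l : ℕ → ℕ := fun n => ⌊(1 / (K : ℝ)) * n⌋₊ with hl
  set U : ℕ → A × A × B → ℝ := fun n z => (l n : ℝ) / n * K * wr z +
    1 * diagVec y (fun a => Pn n a - (l n : ℝ) / n * K * m a) z with hU
  -- The limit of `U n`. It need not equal `V`, only lie close to it.
  set U' : A × A × B → ℝ := fun z => wr z + diagVec y (fun a => P a - m a) z with hU'
  have hKr : (0 : ℝ) < K := by exact_mod_cast hK
  have hlim : Tendsto (fun n => (l n : ℝ) / n * K) atTop (𝓝 1) := by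
    have h1 := (tendsto_nat_floor_mul_div_atTop (R := ℝ) (a := 1 / (K : ℝ)) (by positivity)).comp
      tendsto_natCast_atTop_atTop
    have h2 := h1.mul_const (K : ℝ)
    rwa [one_div_mul_cancel hKr.ne'] at h2
  have hPlim := tendsto_of_isTypeApprox hPn
  have hUlim : Tendsto U atTop (𝓝 U') := by
    rw [tendsto_pi_nhds]
    intro z
    have h1 : Tendsto (fun n => (l n : ℝ) / n * K * wr z) atTop (𝓝 (wr z)) := by
      simpa using hlim.mul_const (wr z)
    refine h1.add ?_
    simp only [one_mul, diagVec]
    split_ifs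
    · have h2 : Tendsto (fun n => (l n : ℝ) / n * K * m z.1) atTop (𝓝 (m z.1)) := by
        simpa using hlim.mul_const (m z.1)
      exact ((tendsto_pi_nhds.1 hPlim) z.1).sub h2
    · exact tendsto_const_nhds
  have hUV : ∀ z, |U' z - V z| ≤ C * ζ := by
    intro z
    have h1 := (hw1 z).le
    have h2 : ∀ a, |P a - m a| ≤ (Fintype.card (A × A × B) : ℝ) * ζ := by
      intro a
      rw [← hV1, hm]
      simp only [marginal]
      rw [← sum_sub_distrib]
      calc |∑ z with z.1 = a, (V z - wr z)| ≤ ∑ z with z.1 = a, |V z - wr z| :=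
            abs_sum_le_sum_abs _ _
        _ ≤ ∑ z : A × A × B, |V z - wr z| :=
            sum_le_sum_of_subset_of_nonneg (filter_subset _ _) fun _ _ _ => abs_nonneg _
        _ ≤ ∑ _z : A × A × B, ζ := sum_le_sum fun z _ => by rw [abs_sub_comm]; exact (hw1 z).le
        _ = _ := by rw [sum_const, card_univ, nsmul_eq_mul]
    have h3 : |diagVec y (fun a => P a - m a) z| ≤ (Fintype.card (A × A × B) : ℝ) * ζ := by
      rw [diagVec]
      split_ifs
      · exact h2 _
      · rw [abs_zero]; positivity
    calc |U' z - V z| = |(wr z - V z) + diagVec y (fun a => P a - m a) z| := by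
          rw [hU']; congr 1; ring
      _ ≤ ζ + (Fintype.card (A × A × B) : ℝ) * ζ := (abs_add_le _ _).trans (add_le_add h1 h3)
      _ = C * ζ := by rw [hC]; ring
  have hnear : ∀ᶠ n in atTop, U n ∈ s := by
    refine hUlim.eventually ?_
    have : U' ∈ Metric.ball V η := by
      rw [Metric.mem_ball, dist_pi_lt_iff hη]
      intro z
      rw [Real.dist_eq]
      have := min_le_left (η / 2) ε
      linarith [hUV z]
    exact mem_of_superset (Metric.isOpen_ball.mem_nhds this) hηs
  have hpos : ∀ᶠ n in atTop, ∀ z, V z ≠ 0 → 0 < U n z := by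
    rw [eventually_all]
    intro z
    by_cases hz : V z = 0
    · exact Eventually.of_forall fun n h => absurd hz h
    · have h1 : 0 < U' z := by
        have := (abs_le.1 (hUV z)).1
        have h2 := hεV z hz
        have h3 := min_le_right (η / 2) ε
        linarith
      filter_upwards [((tendsto_pi_nhds.1 hUlim) z).eventually (lt_mem_nhds h1)] with n hn _
      exact hn
  filter_upwards [hnear, hpos, hPn, eventually_gt_atTop 0] with n h1 h2 h3 hn
  have hn' : (0 : ℝ) < n := by exact_mod_cast hn
  have hzero : ∀ z, V z = 0 → U n z = 0 := by
    intro z hz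
    have hwz : wr z = 0 := by simp [hwr, hw0 z hz]
    have : diagVec y (fun a => Pn n a - (l n : ℝ) / n * K * m a) z = 0 := by
      rw [diagVec]
      split_ifs with hzd
      · have hP0 : P z.1 = 0 := by
          by_contra hne
          rw [hzd] at hz
          exact hy z.1 hne hz
        have hPn0 : Pn n z.1 = 0 := by
          by_contra hne
          exact (h3.2.1 z.1).1 hne hP0
        have hm0 : m z.1 = 0 := by
          refine sum_eq_zero fun z' hz' => ?_
          have hz1 : z'.1 = z.1 := (mem_filter.1 hz').2
          have : V z' = 0 := by
            refine le_antisymm ?_ (hV.1 z')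
            have h5 := le_marginal (fun z : A × A × B => z.1) hV.1 z'
            rw [hV1, hz1, hP0] at h5
            exact h5
          simp [hwr, hw0 z' this]
        rw [hPn0, hm0]; ring
      · rfl
    rw [hU]
    simp only [hwz, this]
    ring
  have hUnn : ∀ z, 0 ≤ U n z := by
    intro z
    by_cases hz : V z = 0
    · exact (hzero z hz).ge
    · exact (h2 z hz).le
  have hm1 : marginal (fun z => z.1) (U n) = Pn n := by
    rw [hU, marginal_add_smul, marginal_fst_diagVec]
    ext a
    rw [← hm]
    ring
  have hm2 : marginal (fun z => z.2.1) (U n) = Pn n := by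
    rw [hU, marginal_add_smul, marginal_snd_diagVec]
    ext a
    rw [← hmarg]
    ring
  obtain ⟨x, hx⟩ := h3.1
  -- Off the corrected cells the count is `l n * k z`; on them one adds the integer `n P_n(a) - l n
  -- * ∑ k`. Nonnegativity comes from `hUnn`.
  have hint : ∀ z, ∃ j : ℕ, (j : ℝ) = n * U n z := by
    intro z
    have h4 : ∃ j : ℤ, (j : ℝ) = n * U n z := by
      have h5 : ∀ z, (K : ℝ) * wr z = k z := by
        intro z
        change (K : ℝ) * (w z : ℝ) = k z
        rw [hk z, mul_div_cancel₀ _ hKr.ne']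
      have h6 : ∀ a, (K : ℝ) * m a = ((∑ z : A × A × B with z.1 = a, k z : ℕ) : ℝ) := by
        intro a
        rw [hm, marginal, mul_sum, Nat.cast_sum]
        exact sum_congr rfl fun z _ => h5 z
      have h7 : (n : ℝ) * Pn n z.1 = letterCount x z.1 := by
        rw [← hx, natCast_mul_empirical]
      by_cases hzd : z = (z.1, z.1, y z.1)
      · refine ⟨(l n * k z : ℤ) + (letterCount x z.1 -
          l n * (∑ z' : A × A × B with z'.1 = z.1, k z' : ℕ)), ?_⟩
        have h8 : U n z = (l n : ℝ) / n * (K * wr z) +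
            (Pn n z.1 - (l n : ℝ) / n * (K * m z.1)) := by
          simp only [hU, diagVec]
          rw [if_pos hzd]
          ring
        rw [h8, h5, h6, mul_add, mul_sub, h7]
        push_cast
        field_simp
      · refine ⟨(l n * k z : ℤ), ?_⟩
        have h8 : U n z = (l n : ℝ) / n * (K * wr z) := by
          simp only [hU, diagVec]
          rw [if_neg hzd]
          ring
        rw [h8, h5]
        push_cast
        field_simp
    obtain ⟨j, hj⟩ := h4
    have hj0 : 0 ≤ j := by
      have : (0 : ℝ) ≤ j := by rw [hj]; exact mul_nonneg hn'.le (hUnn z)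
      exact_mod_cast this
    exact ⟨j.toNat, by rw [← hj]; exact_mod_cast Int.toNat_of_nonneg hj0⟩
  choose j hj using hint
  have hsum : ∑ z, j z = n := by
    have h9 : ∑ z, (j z : ℝ) = n := by
      simp_rw [hj]
      rw [← mul_sum, ← sum_marginal (fun z : A × A × B => z.1) (U n), hm1, ← hx,
        (empirical_mem_stdSimplex hn x).2, mul_one]
    exact_mod_cast h9
  obtain ⟨z, hz⟩ := exists_empirical_eq hsum
  refine ⟨U n, mem_types.2 ⟨z, ?_⟩, h1, hm1, hm2, hzero⟩
  rw [hz]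
  ext c
  rw [hj, mul_div_cancel_left₀ _ hn'.ne']

end Approximation

/-! ### Lower bound on the error probability -/

section Lower

variable {A B : Type*} [Fintype A] [DecidableEq A] [Fintype B] [DecidableEq B]

theorem continuous_cost_right (W : A → B → ℝ) (R : ℝ) : Continuous (cost W R) := by
  refine Continuous.add ?_ ?_
  · exact (continuous_condDivReal W).comp (continuous_marginal _)
  · exact (continuous_tripleInfo.sub continuous_const).max continuous_const

/-- The difference of the metrics of the competing and the transmitted codeword, for an additive
metric. -/
def metricGap (ρ : A → B → ℝ) (V : A × A × B → ℝ) : ℝ :=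
  ∑ z, V z * (ρ z.2.1 z.2.2 - ρ z.1 z.2.2)

/-- The point where additivity enters: the metric constraint becomes a linear inequality in `V`. -/
theorem metric_le_iff_metricGap_nonneg {q : (A × B → ℝ) → ℝ} {ρ : A → B → ℝ}
    (hρ : ∀ V ∈ stdSimplex ℝ (A × B), q V = ∑ x, ∑ y, V (x, y) * ρ x y) {V : A × A × B → ℝ}
    (hV : V ∈ stdSimplex ℝ (A × A × B)) :
    q (marginal (fun z => (z.1, z.2.2)) V) ≤ q (marginal (fun z => (z.2.1, z.2.2)) V) ↔
      0 ≤ metricGap ρ V := by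
  have h : ∀ f : A × A × B → A × B, q (marginal f V) = ∑ z, V z * ρ (f z).1 (f z).2 := by
    intro f
    rw [hρ _ (marginal_mem_stdSimplex f hV), ← sum_marginal_mul f V (fun w => ρ w.1 w.2),
      Fintype.sum_prod_type]
  rw [h, h, metricGap]
  simp only [mul_sub, sum_sub_distrib, sub_nonneg]

theorem continuous_metricGap (ρ : A → B → ℝ) : Continuous (metricGap ρ) := by
  unfold metricGap
  fun_prop

theorem metricGap_add_smul (ρ : A → B → ℝ) (r s : ℝ) (U V : A × A × B → ℝ) :
    metricGap ρ (fun z => r * U z + s * V z) = r * metricGap ρ U + s * metricGap ρ V := by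
  simp only [metricGap, mul_sum, ← sum_add_distrib]
  exact sum_congr rfl fun z _ => by ring

/-- Joint distributions of `(X, X̃, Y)` with `X` and `X̃` distributed as `P`, and such that `Y` is a
possible channel output for the input `X`. -/
structure IsCoupling (P : A → ℝ) (W : A → B → ℝ) (V : A × A × B → ℝ) : Prop where
  mem : V ∈ stdSimplex ℝ (A × A × B)
  fst : marginal (fun z => z.1) V = P
  snd : marginal (fun z => z.2.1) V = P
  channel : ∀ z, W z.1 z.2.2 = 0 → V z = 0

theorem marginal_eq_zero_of_channel {W : A → B → ℝ} {V : A × A × B → ℝ}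
    (h : ∀ z, W z.1 z.2.2 = 0 → V z = 0) (x : A) (y : B) (hxy : W x y = 0) :
    marginal (fun z => (z.1, z.2.2)) V (x, y) = 0 := by
  refine sum_eq_zero fun z hz => h z ?_
  have := (mem_filter.1 hz).2
  simp only [Prod.mk.injEq] at this
  rw [this.1, this.2, hxy]

theorem channel_of_marginal_eq_zero {W : A → B → ℝ} {V : A × A × B → ℝ} (hV : ∀ z, 0 ≤ V z)
    (h : ∀ x y, W x y = 0 → marginal (fun z => (z.1, z.2.2)) V (x, y) = 0) (z : A × A × B)
    (hz : W z.1 z.2.2 = 0) : V z = 0 := by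
  refine le_antisymm ?_ (hV z)
  have := le_marginal (fun z : A × A × B => (z.1, z.2.2)) hV z
  rwa [h _ _ hz] at this

/-- The joint distribution of `(X, X, Y)` when `X` has law `Q` and `Y` is the channel output. -/
def diagChannel (Q : A → ℝ) (W : A → B → ℝ) (z : A × A × B) : ℝ :=
  if z.1 = z.2.1 then Q z.1 * W z.1 z.2.2 else 0

theorem isCoupling_diagChannel {Q : A → ℝ} (hQ : Q ∈ stdSimplex ℝ A) {W : A → B → ℝ}
    (hW : IsChannel W) : IsCoupling Q W (diagChannel Q W) := by
  have h1 : marginal (fun z => z.1) (diagChannel Q W) = Q := by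
    ext a
    rw [marginal, sum_filter, Fintype.sum_prod_type, sum_eq_single a]
    · simp only [diagChannel, if_true]
      rw [Fintype.sum_prod_type, sum_eq_single a]
      · simp only [if_true, ← mul_sum, (hW a).2, mul_one]
      · intro b _ hb
        exact sum_eq_zero fun y _ => if_neg fun h => hb h.symm
      · simp
    · intro b _ hb
      simp [hb]
    · simp
  have h2 : marginal (fun z => z.2.1) (diagChannel Q W) = Q := by
    refine Eq.trans ?_ h1
    ext a
    simp only [marginal, sum_filter]
    refine sum_congr rfl fun z _ => ?_
    unfold diagChannel
    by_cases hz : z.1 = z.2.1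
    · simp [hz]
    · simp [hz]
  refine ⟨⟨fun z => ?_, ?_⟩, h1, h2, fun z hz => ?_⟩
  · unfold diagChannel
    have := hQ.1 z.1
    have := (hW z.1).1 z.2.2
    positivity
  · rw [← sum_marginal (fun z : A × A × B => z.1), h1, hQ.2]
  · simp [diagChannel, hz]

/-- Sent and competing letters coincide, so the metrics cancel. This makes `diagChannel` a neutral
coupling for mixing and for repairing marginals. -/
theorem metricGap_diagChannel (ρ : A → B → ℝ) (Q : A → ℝ) (W : A → B → ℝ) :
    metricGap ρ (diagChannel Q W) = 0 := by
  refine sum_eq_zero fun z _ => ?_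
  unfold diagChannel
  split_ifs with h
  · rw [h]; ring
  · ring

theorem IsCoupling.mix {P : A → ℝ} {W : A → B → ℝ} {U V : A × A × B → ℝ} (hU : IsCoupling P W U)
    (hV : IsCoupling P W V) {r s : ℝ} (hr : 0 ≤ r) (hs : 0 ≤ s) (hrs : r + s = 1) :
    IsCoupling P W (fun z => r * U z + s * V z) := by
  refine ⟨convex_stdSimplex ℝ _ hU.mem hV.mem hr hs hrs, ?_, ?_, fun z hz => ?_⟩
  · rw [marginal_add_smul, hU.fst, hV.fst]
    ext a
    rw [← add_mul, hrs, one_mul]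
  · rw [marginal_add_smul, hU.snd, hV.snd]
    ext a
    rw [← add_mul, hrs, one_mul]
  · simp only [hU.channel z hz, hV.channel z hz]
    ring

/-- If no coupling has a positive metric gap, then the metric gap of every distribution with equal
marginals whose support is contained in that of a coupling with zero gap is nonnegative. -/
theorem metricGap_nonneg_of_support {P : A → ℝ} {W : A → B → ℝ} (hW : IsChannel W)
    {ρ : A → B → ℝ} (hmax : ∀ V, IsCoupling P W V → metricGap ρ V ≤ 0) {V : A × A × B → ℝ}
    (hV : IsCoupling P W V) (hV0 : 0 ≤ metricGap ρ V) {U : A × A × B → ℝ}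
    (hU : U ∈ stdSimplex ℝ (A × A × B))
    (hUm : marginal (fun z => z.1) U = marginal (fun z => z.2.1) U)
    (hsupp : ∀ z, V z = 0 → U z = 0) : 0 ≤ metricGap ρ U := by
  by_contra hneg
  push Not at hneg
  obtain ⟨ε, hε, hεV⟩ := exists_pos_le_of_ne_zero hV.mem.1
  set Q := marginal (fun z => z.1) U with hQ
  have hD := isCoupling_diagChannel (marginal_mem_stdSimplex (fun z : A × A × B => z.1) hU) hW
  rw [← hQ] at hD
  set D := diagChannel Q W
  -- Subtract a small multiple of `U` from `V` and restore both marginals with the zero-gap coupling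
  -- `D`. Nonnegativity needs the support of `U` inside that of `V`; if the gap of `U` were
  -- negative, the new coupling would have positive gap, against maximality.
  have hV' : IsCoupling P W (fun z => 1 * V z + ε * (1 * D z + (-1) * U z)) := by
    have hm1 : marginal (fun z : A × A × B => z.1)
        (fun z => 1 * V z + ε * (1 * D z + (-1) * U z)) = P := by
      rw [marginal_add_smul _ 1 ε V (fun z => 1 * D z + (-1) * U z), marginal_add_smul, hV.fst,
        hD.fst]
      ext a
      rw [← hQ]
      ring
    have hm2 : marginal (fun z : A × A × B => z.2.1)
        (fun z => 1 * V z + ε * (1 * D z + (-1) * U z)) = P := by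
      rw [marginal_add_smul _ 1 ε V (fun z => 1 * D z + (-1) * U z), marginal_add_smul, hV.snd,
        hD.snd]
      ext a
      rw [← hUm]
      ring
    refine ⟨⟨fun z => ?_, ?_⟩, hm1, hm2, fun z hz => ?_⟩
    · have h1 := hD.mem.1 z
      have h2 : ε * U z ≤ V z := by
        by_cases hz : V z = 0
        · rw [hz, hsupp z hz, mul_zero]
        · have h3 : U z ≤ 1 := (mem_Icc_of_mem_stdSimplex hU z).2
          have h4 := hU.1 z
          calc ε * U z ≤ ε * 1 := by gcongr
            _ ≤ V z := by rw [mul_one]; exact hεV z hz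
      have h5 : 0 ≤ ε * D z := by positivity
      nlinarith
    · rw [← sum_marginal (fun z : A × A × B => z.1), hm1, ← hV.fst, sum_marginal, hV.mem.2]
    · simp only [hV.channel z hz, hD.channel z hz, hsupp z (hV.channel z hz)]
      ring
  have h1 := hmax _ hV'
  rw [metricGap_add_smul ρ 1 ε V (fun z => 1 * D z + (-1) * U z), metricGap_add_smul,
    metricGap_diagChannel] at h1
  nlinarith

/-- A coupling can be perturbed so that it charges the diagonal and so that its metric gap is
positive, unless no coupling has a positive metric gap. -/
theorem IsCoupling.exists_perturbation {W : A → B → ℝ} (hW : IsChannel W) (ρ : A → B → ℝ)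
    {d : (A × A → ℝ) → ℝ} (hd : IsDistance d) {P : A → ℝ} (hP : P ∈ stdSimplex ℝ A) {Δ : ℝ}
    (R : ℝ) {V : A × A × B → ℝ} (hV : IsCoupling P W V) (hVq : 0 ≤ metricGap ρ V)
    (hVd : Δ < d (marginal (fun z => (z.1, z.2.1)) V)) {η : ℝ} (hη : 0 < η) :
    ∃ V₁, IsCoupling P W V₁ ∧ (∀ a, P a ≠ 0 → ∃ y, V₁ (a, a, y) ≠ 0) ∧
      cost W R V₁ < cost W R V + η ∧ Δ < d (marginal (fun z => (z.1, z.2.1)) V₁) ∧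
      0 ≤ metricGap ρ V₁ ∧
      (0 < metricGap ρ V₁ ∨ ∀ V', IsCoupling P W V' → metricGap ρ V' ≤ 0) := by
  have hD := isCoupling_diagChannel hP hW
  set D := diagChannel P W with hDdef
  -- `V'` is a coupling of positive gap when one exists; otherwise `V` itself serves.
  obtain ⟨V', hV', hV'0, hV'1⟩ : ∃ V', IsCoupling P W V' ∧ 0 ≤ metricGap ρ V' ∧
      (0 < metricGap ρ V' ∨ ∀ V'', IsCoupling P W V'' → metricGap ρ V'' ≤ 0) := by
    by_cases h : ∃ V', IsCoupling P W V' ∧ 0 < metricGap ρ V'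
    · obtain ⟨V', h1, h2⟩ := h
      exact ⟨V', h1, h2.le, Or.inl h2⟩
    · push Not at h
      exact ⟨V, hV, hVq, Or.inr h⟩
  set E : A × A × B → ℝ := fun z => 1 / 2 * V' z + 1 / 2 * D z with hE
  -- Half of `E` charges the diagonal, and the other half carries the gap of `V'`. Mixing a small
  -- multiple of `E` into `V` gives both properties while continuity keeps cost and distance under
  -- control.
  have hEc : IsCoupling P W E := hV'.mix hD (by norm_num) (by norm_num) (by norm_num)
  have hEgap : metricGap ρ E = 1 / 2 * metricGap ρ V' := by
    rw [hE, metricGap_add_smul, hDdef, metricGap_diagChannel]; ring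
  set v : ℕ → A × A × B → ℝ := fun k z =>
    (1 - 1 / ((k : ℝ) + 1)) * V z + 1 / ((k : ℝ) + 1) * E z with hv
  have hk1 : ∀ k : ℕ, 1 / ((k : ℝ) + 1) ≤ 1 := fun k => by
    rw [div_le_one (by positivity)]
    have : (0 : ℝ) ≤ k := k.cast_nonneg
    linarith
  have hvc : ∀ k, IsCoupling P W (v k) := fun k =>
    hV.mix hEc (by linarith [hk1 k]) (by positivity) (by ring)
  have hvlim : Tendsto v atTop (𝓝 V) := by
    rw [tendsto_pi_nhds]
    intro z
    have h0 : Tendsto (fun k : ℕ => 1 / ((k : ℝ) + 1)) atTop (𝓝 0) :=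
      tendsto_one_div_add_atTop_nhds_zero_nat
    have h1 := ((tendsto_const_nhds (x := (1 : ℝ))).sub h0).mul_const (V z) |>.add
      (h0.mul_const (E z))
    simp only [sub_zero, one_mul, zero_mul, add_zero] at h1
    exact h1
  have hcost : ∀ᶠ k in atTop, cost W R (v k) < cost W R V + η := by
    exact (((continuous_cost_right W R).tendsto V).comp hvlim).eventually (gt_mem_nhds (by linarith))
  have hdist : ∀ᶠ k in atTop, Δ < d (marginal (fun z => (z.1, z.2.1)) (v k)) :=
    (ContinuousOn.tendsto_comp_marginal hd.continuousOn (fun z : A × A × B => (z.1, z.2.1))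
      (fun k => (hvc k).mem) hV.mem hvlim).eventually (lt_mem_nhds hVd)
  obtain ⟨k, hk2, hk3⟩ := (hcost.and hdist).exists
  set V₁ := v k with hV₁
  have hV₁c := hvc k
  have hpos : 0 < 1 / ((k : ℝ) + 1) := by positivity
  have hV₁gap : 1 / ((k : ℝ) + 1) * (1 / 2 * metricGap ρ V') ≤ metricGap ρ V₁ := by
    rw [hV₁, hv, metricGap_add_smul, hEgap]
    have : 0 ≤ (1 - 1 / ((k : ℝ) + 1)) * metricGap ρ V :=
      mul_nonneg (by linarith [hk1 k]) hVq
    linarith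
  have hV₁0 : 0 ≤ metricGap ρ V₁ := le_trans (by positivity) hV₁gap
  refine ⟨V₁, hV₁c, ?_, hk2, hk3, hV₁0, ?_⟩
  · intro a ha
    obtain ⟨y, hy⟩ : ∃ y, W a y ≠ 0 := by
      by_contra hcon
      push Not at hcon
      have := (hW a).2
      simp [hcon] at this
    have hPa := (hP.1 a).lt_of_ne' ha
    have hWy := ((hW a).1 y).lt_of_ne' hy
    refine ⟨y, ne_of_gt ?_⟩
    have h1 : 0 < D (a, a, y) := by
      simp only [hDdef, diagChannel, if_true]
      positivity
    have h2 := hV'.mem.1 (a, a, y)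
    have h3 := hV.mem.1 (a, a, y)
    have h4 : 0 < E (a, a, y) := by
      simp only [hE]; linarith
    have h5 : 0 ≤ (1 - 1 / ((k : ℝ) + 1)) * V (a, a, y) :=
      mul_nonneg (by linarith [hk1 k]) h3
    have h6 : 0 < 1 / ((k : ℝ) + 1) * E (a, a, y) := mul_pos hpos h4
    simp only [hV₁, hv]
    linarith
  · rcases hV'1 with h | h
    · exact Or.inl (lt_of_lt_of_le (by positivity) hV₁gap)
    · exact Or.inr h

/-- Every coupling satisfying the constraints with slack in the distance is approximated by
admissible joint types. -/
theorem eventually_exists_admissible {W : A → B → ℝ} (hW : IsChannel W) {q : (A × B → ℝ) → ℝ}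
    {ρ : A → B → ℝ} (hρ : ∀ V ∈ stdSimplex ℝ (A × B), q V = ∑ x, ∑ y, V (x, y) * ρ x y)
    {d : (A × A → ℝ) → ℝ} (hd : IsDistance d) {P : A → ℝ} (hP : P ∈ stdSimplex ℝ A)
    {Pn : ℕ → A → ℝ} (hPn : ∀ᶠ n in atTop, IsTypeApprox n P (Pn n)) {Δ R : ℝ} {r : ℕ → ℝ}
    (hr : Tendsto r atTop (𝓝 R)) {V : A × A × B → ℝ} (hV : IsCoupling P W V)
    (hVq : 0 ≤ metricGap ρ V) (hVd : Δ < d (marginal (fun z => (z.1, z.2.1)) V)) {η : ℝ}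
    (hη : 0 < η) :
    ∀ᶠ n in atTop, ∃ U ∈ types (A × A × B) n, Admissible (Pn n) W q d Δ U ∧
      cost W (r n) U < cost W R V + η := by
  obtain ⟨V₁, hV₁c, hdiag, hk2, hk3, hV₁0, hV'1⟩ :=
    hV.exists_perturbation hW ρ hd hP R hVq hVd hη
  have n1 : ∀ᶠ U in 𝓝 V₁, U ∈ stdSimplex ℝ (A × A × B) →
      Δ < d (marginal (fun z => (z.1, z.2.1)) U) := by
    rw [← eventually_nhdsWithin_iff]
    have hc : ContinuousOn (fun U : A × A × B → ℝ => d (marginal (fun z => (z.1, z.2.1)) U))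
        (stdSimplex ℝ (A × A × B)) :=
      hd.continuousOn.comp (continuous_marginal _).continuousOn
        fun U hU => marginal_mem_stdSimplex _ hU
    exact (hc V₁ hV₁c.mem).eventually (lt_mem_nhds hk3)
  have n2 : ∀ᶠ p in 𝓝 R ×ˢ 𝓝 V₁, cost W p.1 p.2 < cost W R V + η := by
    rw [← nhds_prod_eq]
    exact ((continuous_cost W).tendsto (R, V₁)).eventually (gt_mem_nhds hk2)
  obtain ⟨pR, hpR, pU, hpU, n3⟩ := eventually_prod_iff.1 n2
  -- A positive gap is an open condition. In the degenerate case the support condition and equal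
  -- marginals suffice, with no closeness to `V₁`.
  have n4 : ∀ᶠ U in 𝓝 V₁, U ∈ stdSimplex ℝ (A × A × B) →
      marginal (fun z => z.1) U = marginal (fun z => z.2.1) U → (∀ z, V₁ z = 0 → U z = 0) →
      0 ≤ metricGap ρ U := by
    rcases hV'1 with h | h
    · filter_upwards [(continuous_metricGap ρ).continuousAt.eventually (lt_mem_nhds h)] with
        U hU _ _ _
      exact hU.le
    · exact Eventually.of_forall fun U h1 h2 h3 =>
        metricGap_nonneg_of_support hW h hV₁c hV₁0 h1 h2 h3
  have hs := n1.and (hpU.and n4)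
  filter_upwards [eventually_exists_type hV₁c.mem hV₁c.fst hV₁c.snd hdiag hPn hs,
    hr.eventually hpR, eventually_gt_atTop 0] with n h1 h2 h3
  obtain ⟨U, hU, ⟨u1, u2, u3⟩, um1, um2, hsupp⟩ := h1
  have hUs : U ∈ stdSimplex ℝ (A × A × B) := by
    obtain ⟨z, rfl⟩ := mem_types.1 hU
    exact empirical_mem_stdSimplex h3 z
  refine ⟨U, hU, ⟨um1, um2, ?_, u1 hUs, ?_⟩, n3 h2 u2⟩
  · exact (metric_le_iff_metricGap_nonneg hρ hUs).2 (u3 hUs (um1.trans um2.symm) hsupp)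
  · exact marginal_eq_zero_of_channel fun z hz => hsupp z (hV₁c.channel z hz)

/-- Of the loss `η`, one half covers the approximation of `V` by types and of `R` by the actual
rates, the other the polynomial factor. -/
theorem eventually_exp_neg_le_avgErrorProb {W : A → B → ℝ} (hW : IsChannel W)
    {q : (A × B → ℝ) → ℝ}
    {ρ : A → B → ℝ} (hρ : ∀ V ∈ stdSimplex ℝ (A × B), q V = ∑ x, ∑ y, V (x, y) * ρ x y)
    {d : (A × A → ℝ) → ℝ} (hd : IsDistance d) {P : A → ℝ} (hP : P ∈ stdSimplex ℝ A)
    {Pn : ℕ → A → ℝ} (hPn : ∀ᶠ n in atTop, IsTypeApprox n P (Pn n)) {Δ δ R : ℝ}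
    (hR : 0 < R) (hδ : 0 < δ) {M : ℕ → ℕ}
    (hM : Tendsto (fun n : ℕ => Real.log (M n) / n) atTop (𝓝 R))
    (hvol : ∀ᶠ n in atTop, VolumeCondition n (M n) (Pn n) d Δ δ)
    {V : A × A × B → ℝ} (hV : IsCoupling P W V)
    (hVq : 0 ≤ metricGap ρ V) (hVd : Δ < d (marginal (fun z => (z.1, z.2.1)) V)) {η : ℝ}
    (hη : 0 < η) :
    ∀ᶠ n : ℕ in atTop, Real.exp (-(n * (cost W R V + η))) ≤
      avgErrorProb n (M n) (Pn n) W q d Δ := by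
  have hη' : ∀ᶠ n : ℕ in atTop, Real.exp (-(n * δ)) ≤ 1 / 10 := by
    have : Tendsto (fun n : ℕ => Real.exp (-(n * δ))) atTop (𝓝 0) :=
      Real.tendsto_exp_neg_atTop_nhds_zero.comp
        (tendsto_natCast_atTop_atTop.atTop_mul_const hδ)
    exact this.eventually (ge_mem_nhds (by norm_num))
  filter_upwards [eventually_exists_admissible hW hρ hd hP hPn hM hV hVq hVd (half_pos hη),
    hη', hvol, eventually_two_le hR hM, eventually_gt_atTop 0,
    eventually_polyFactor_le A B 16 5 (half_pos hη)] with n h1 h2 h3 h4 h5 h6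
  obtain ⟨U, hU, hadm, hc⟩ := h1
  have h7 := exp_cost_le_avgErrorProb (fun x y => (hW x).1 y) hd h5 h4 (Real.exp_pos _).le h2
    (smallVolume_of_volumeCondition h3) hU hadm
  have hp := one_le_polyFactor (A := A) (B := B) n
  have hpos : 0 < 16 * polyFactor A B n ^ 5 := by positivity
  have h8 : 0 ≤ avgErrorProb n (M n) (Pn n) W q d Δ := by
    by_contra hneg
    push Not at hneg
    have := mul_neg_of_pos_of_neg hpos hneg
    linarith [Real.exp_pos (-(n * cost W (Real.log (M n) / n) U))]
  have h9 : Real.exp (-(n * (cost W R V + η / 2))) ≤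
      Real.exp (n * (η / 2)) * avgErrorProb n (M n) (Pn n) W q d Δ := by
    calc Real.exp (-(n * (cost W R V + η / 2)))
        ≤ Real.exp (-(n * cost W (Real.log (M n) / n) U)) := by gcongr
      _ ≤ _ := h7
      _ ≤ _ := by gcongr
  have h10 : Real.exp (-(n * (cost W R V + η / 2))) =
      Real.exp (n * (η / 2)) * Real.exp (-(n * (cost W R V + η))) := by
    rw [← Real.exp_add]
    congr 1
    ring
  rw [h10] at h9
  exact le_of_mul_le_mul_left h9 (Real.exp_pos _)

theorem expDecay_expLE_avgErrorProb {W : A → B → ℝ} (hW : IsChannel W)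
    {q : (A × B → ℝ) → ℝ} (hq : IsAdditive q)
    {d : (A × A → ℝ) → ℝ} (hd : IsDistance d) {P : A → ℝ} (hP : P ∈ stdSimplex ℝ A)
    {Pn : ℕ → A → ℝ} (hPn : ∀ᶠ n in atTop, IsTypeApprox n P (Pn n)) {Δ δ R ε : ℝ}
    (hR : 0 < R) (hδ : 0 < δ) (hε : 0 < ε) {M : ℕ → ℕ}
    (hM : Tendsto (fun n : ℕ => Real.log (M n) / n) atTop (𝓝 R))
    (hvol : ∀ᶠ n in atTop, VolumeCondition n (M n) (Pn n) d Δ δ) :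
    ExpLE (expDecay (exponent R P W q d (Δ + ε)))
      (fun n => ENNReal.ofReal (avgErrorProb n (M n) (Pn n) W q d Δ)) := by
  obtain ⟨ρ, hρ⟩ := hq
  refine expLE_of_forall_eventually_le fun η hη => ?_
  induction hE : exponent R P W q d (Δ + ε) with
  -- Excluded: the objective is `⊤` off the support of the channel and otherwise equals `cost`,
  -- which is bounded below on the compact simplex.
  | bot =>
    exfalso
    obtain ⟨c, hc⟩ := ((isCompact_stdSimplex ℝ (A × A × B)).image
      (continuous_cost_right W R)).bddBelow
    have h1 : (c : EReal) ≤ exponent R P W q d (Δ + ε) := by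
      refine le_iInf₂ fun V hV => ?_
      by_cases hch : ∀ x y, W x y = 0 → marginal (fun z => (z.1, z.2.2)) V (x, y) = 0
      · rw [condDiv_add_eq_cost R hV.1.1 hch, EReal.coe_le_coe_iff]
        exact hc ⟨V, hV.1, rfl⟩
      · rw [condDiv_eq_top hch, EReal.top_add_coe]
        exact le_top
    rw [hE] at h1
    exact absurd h1 (not_le.2 (EReal.bot_lt_coe c))
  | top =>
    filter_upwards [eventually_gt_atTop 0] with n hn
    rw [expDecay_top hn]
    simp
  | coe E =>
    have hlt : exponent R P W q d (Δ + ε) < ((E + η / 2 : ℝ) : EReal) := by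
      rw [hE, EReal.coe_lt_coe_iff]
      linarith
    obtain ⟨V, hVf, hVlt⟩ : ∃ V ∈ feasible P q d (Δ + ε),
        condDiv (marginal (fun z => (z.1, z.2.2)) V) W +
          ((max (mutualInfo (marginal (fun z => (z.2.1, (z.2.2, z.1))) V) - R) 0 : ℝ) : EReal) <
          ((E + η / 2 : ℝ) : EReal) := by
      unfold exponent at hlt
      simpa only [iInf_lt_iff, exists_prop] using hlt
    by_cases hch : ∀ x y, W x y = 0 → marginal (fun z => (z.1, z.2.2)) V (x, y) = 0
    swap
    · rw [condDiv_eq_top hch, EReal.top_add_coe] at hVlt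
      exact absurd hVlt not_top_lt
    obtain ⟨hV1, hV2, hV3, hV4, hV5⟩ := hVf
    rw [condDiv_add_eq_cost R hV1.1 hch, EReal.coe_lt_coe_iff] at hVlt
    have hVc : IsCoupling P W V := ⟨hV1, hV2, hV3, channel_of_marginal_eq_zero hV1.1 hch⟩
    -- The distance of `V` is at least `Δ + ε`, hence strictly above `Δ`; this is the only use of
    -- `ε`.
    filter_upwards [eventually_exp_neg_le_avgErrorProb hW hρ hd hP hPn hR hδ hM hvol hVc
      ((metric_le_iff_metricGap_nonneg hρ hV1).1 hV4) (by linarith) (half_pos hη)] with n hn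
    rw [expDecay_coe]
    refine ofReal_div_ofReal_le (lt_of_lt_of_le (Real.exp_pos _) hn) ?_
    calc Real.exp (-(n * E)) = Real.exp (n * η) * Real.exp (-(n * (E + η))) := by
          rw [← Real.exp_add]
          congr 1
          ring
      _ ≤ Real.exp (n * η) * Real.exp (-(n * (cost W R V + η / 2))) := by
          refine mul_le_mul_of_nonneg_left (Real.exp_le_exp.2 (neg_le_neg
            (mul_le_mul_of_nonneg_left ?_ n.cast_nonneg))) (Real.exp_pos _).le
          linarith
      _ ≤ _ := by gcongr

end Lower

end

end RGV

/-! ### The ensemble exponent of the generalized RGV code -/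

theorem theorem1 {𝒳 𝒴 : Type*} [Fintype 𝒳] [DecidableEq 𝒳] [Fintype 𝒴] [DecidableEq 𝒴]
    (W : 𝒳 → 𝒴 → ℝ) (hW : RGV.IsChannel W)
    (q : (𝒳 × 𝒴 → ℝ) → ℝ) (hq : ContinuousOn q (stdSimplex ℝ (𝒳 × 𝒴)))
    (P : 𝒳 → ℝ) (hP : P ∈ stdSimplex ℝ 𝒳)
    (δ : ℝ) (hδ : 0 < δ) (Δ : ℝ)
    (d : (𝒳 × 𝒳 → ℝ) → ℝ) (hd : RGV.IsDistance d)
    (R : ℝ) (hR : 0 < R)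
    (hrate : (R : EReal) ≤ RGV.minMutualInfo P d Δ - ((2 * δ : ℝ) : EReal))
    (Pn : ℕ → 𝒳 → ℝ) (hPn : ∀ᶠ n in atTop, RGV.IsTypeApprox n P (Pn n))
    (M : ℕ → ℕ) (hM : Tendsto (fun n : ℕ => Real.log (M n) / n) atTop (𝓝 R)) :
    -- for large `n` the volume condition holds and all `M n` codewords can be drawn
    (∀ᶠ n in atTop, RGV.VolumeCondition n (M n) (Pn n) d Δ δ ∧
      ∑ c : Fin (M n) → Fin n → 𝒳, RGV.codeProb (Pn n) d Δ c = 1) ∧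
    RGV.ExpLE (fun n => ENNReal.ofReal (RGV.avgErrorProb n (M n) (Pn n) W q d Δ))
      (RGV.expDecay (RGV.exponent R P W q d Δ)) ∧
    (RGV.IsAdditive q → ∀ ε > 0,
      RGV.ExpLE (RGV.expDecay (RGV.exponent R P W q d (Δ + ε)))
        (fun n => ENNReal.ofReal (RGV.avgErrorProb n (M n) (Pn n) W q d Δ))) := by
  have hvol := RGV.eventually_volumeCondition hd hδ hR hrate (RGV.tendsto_of_isTypeApprox hPn) hM
  refine ⟨?_, RGV.expLE_avgErrorProb (fun x y => (hW x).1 y) hq hd hPn hR hδ hM hvol,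
    fun hadd ε hε => RGV.expDecay_expLE_avgErrorProb hW hadd hd hP hPn hR hδ hε hM hvol⟩
  filter_upwards [hvol, hPn, eventually_gt_atTop 0] with n h1 h2 h3
  refine ⟨h1, ?_⟩
  obtain ⟨x, hx⟩ := h2.1
  simp_rw [RGV.codeProb_eq_seqProb]
  have hlt : Real.exp (-(n * δ)) < 1 := by
    rw [Real.exp_lt_one_iff, neg_lt_zero]
    positivity
  exact RGV.sum_seqProb ⟨x, RGV.mem_typeClass.2 hx⟩ hlt (RGV.smallVolume_of_volumeCondition h1)
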